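/- Let $n\ge 2$ and let $U$ be an open subset of the first-order jet space with coordinates $(x,u,p)$, $x\in\mathbb R^n$, $u\in\mathbb R$, $p=(u_1,\dots,u_n)\in\mathbb R^n$. A *differential function over $U$* is a smooth function $f$ of $x$ and of finitely many jet coordinates $u_I$ ($I$ a multi-index), defined at all jets whose first-order part lies in $U$; $D_i=\partial_{x^i}+\sum_I u_{I+e_i}\partial_{u_I}$ denotes the total derivative and $E_u(f)=\sum_I(-1)^{|I|}D^I\big(\partial f/\partial u_I\big)$ the Euler--Lagrange operator. Let $G=\sum_{i,j}A^{ij}(x,u,p)\,u_{ij}+B(x,u,p)$, with $A^{ij},B$ smooth on $U$, be a quasilinear second-order differential function that is Euler--Lagrange: $G=E_u(L_0)$ for some differential function $L_0$ over $U$ (of any order). Let $W$ be a variational integrating factor of $G$: a differential function over $U$, of any order, not identically zero, such that $WG=E_u(\tilde L)$ for some differential function $\tilde L$ over $U$. A *formal solution* of $G=0$ is an infinite jet over $U$ at which $G$ and all its total derivatives $D^IG$ vanish. For an open set $V\subseteq U$, a *first-order Lagrangian* of $G$ over $V$ is a smooth function $L(x,u,p)$ on $V$ with $E_u(L)=G$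 at all jets over $V$. Then: 1. If $X\subseteq\mathbb R^n$ is open, and $Y\subseteq\mathbb R$ and $P\subseteq\mathbb R^n$ are open and convex, with $X\times Y\times P\subseteq U$, then $G$ has a first-order Lagrangian over $X\times Y\times P$. 2. Let $L$ be any first-order Lagrangian of $G$ over an open set $V\subseteq U$. Then the Monge--Ampère equation $$\det\big(L_{u_iu_j}\big)=0$$ holds at every point $q\in V$ near which $W$ is non-constant, in either of the following senses: (a) in no neighbourhood of $q$ in the first-order jet space is $W$ constant on the set of formal solutions of $G=0$ whose first-order part lies in that neighbourhood; or (b) $W=W(x,u,\partial u,\partial^2u)$ is of order at most two, and in no neighbourhood of $q$ is $W$ constant on the set of all jets whose first-order part lies in that neighbourhood. In particular, if $W$ is non-constant in one of these senses at every point of $V$, then $\det(L_{u_iu_j})\equiv0$ on $V$. -/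

import Mathlib

open scoped ContDiff

namespace VarIF

/-- The jet space of real functions `u(x)`, `x ∈ ℝⁿ`: a point consists of `x` and of one real number
`u_I` for every multi-index `I` (`u_0 = u`, `u_{e_i} = u_i`, `u_{e_i + e_j} = u_{ij}`, …). -/
abbrev Jet (n : ℕ) : Type := (Fin n → ℝ) × ((Fin n → ℕ) → ℝ)

/-- The first-order jet space, with coordinates `(x, u, (u_1, …, u_n))`. -/
abbrev Jet1 (n : ℕ) : Type := (Fin n → ℝ) × ℝ × (Fin n → ℝ)

/-- The multi-index `e_i`. -/
def e {n : ℕ} (i : Fin n) : Fin n → ℕ := Pi.single i 1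

/-- The order `|I|` of a multi-index. -/
def order {n : ℕ} (I : Fin n → ℕ) : ℕ := ∑ i, I i

/-- The projection of a jet to its first-order part. -/
def toJet1 {n : ℕ} (z : Jet n) : Jet1 n := (z.1, z.2 0, fun i => z.2 (e i))

/-- The finite set of multi-indices of order at most `k`. -/
def multiIdx (n k : ℕ) : Finset (Fin n → ℕ) :=
  (Fintype.piFinset fun _ : Fin n => Finset.range (k + 1)).filter fun I => order I ≤ k

theorem mem_multiIdx {n k : ℕ} {I : Fin n → ℕ} : I ∈ multiIdx n k ↔ order I ≤ k := by
  simp only [multiIdx, Finset.mem_filter, Fintype.mem_piFinset, Finset.mem_range, Nat.lt_succ_iff,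
    and_iff_right_iff_imp]
  intro h i
  exact (Finset.single_le_sum (f := I) (fun _ _ => Nat.zero_le _) (Finset.mem_univ i)).trans h

/-- A `k`-jet, completed to a jet by setting all coordinates of order above `k` to zero. -/
noncomputable def ofKJet {n k : ℕ} (y : (Fin n → ℝ) × (multiIdx n k → ℝ)) : Jet n :=
  (y.1, fun I => if h : I ∈ multiIdx n k then y.2 ⟨I, h⟩ else 0)

/-- `f` restricts, over the part `U` of the first-order jet space, to a smooth function of the jet
coordinates of order at most `k` (used for `k ≥ 1`). The values of `f` elsewhere are irrelevant. -/
def SmoothOfOrderLE {n : ℕ} (U : Set (Jet1 n)) (k : ℕ) (f : Jet n → ℝ) : Prop :=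
  (∀ z z' : Jet n, toJet1 z ∈ U → z.1 = z'.1 → (∀ I, order I ≤ k → z.2 I = z'.2 I) → f z = f z') ∧
  ContDiffOn ℝ ∞ (fun y : (Fin n → ℝ) × (multiIdx n k → ℝ) => f (ofKJet y))
    {y | toJet1 (ofKJet y) ∈ U}

/-- Differential functions over `U`: smooth functions of finitely many jet coordinates. -/
def IsDifferentialFunction {n : ℕ} (U : Set (Jet1 n)) (f : Jet n → ℝ) : Prop :=
  ∃ k, 1 ≤ k ∧ SmoothOfOrderLE U k f

/-- The partial derivative `∂f/∂xⁱ` on jet space. -/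
noncomputable def dx {n : ℕ} (i : Fin n) (f : Jet n → ℝ) (z : Jet n) : ℝ :=
  deriv (fun t : ℝ => f (Function.update z.1 i t, z.2)) (z.1 i)

/-- The partial derivative `∂f/∂u_I` on jet space. -/
noncomputable def du {n : ℕ} (I : Fin n → ℕ) (f : Jet n → ℝ) (z : Jet n) : ℝ :=
  deriv (fun t : ℝ => f (z.1, Function.update z.2 I t)) (z.2 I)

/-- The total derivative `D_i f = ∂f/∂xⁱ + ∑_I u_{I + e_i} ∂f/∂u_I`
(a finite sum for a differential function). -/
noncomputable def totalDeriv {n : ℕ} (i : Fin n) (f : Jet n → ℝ) (z : Jet n) : ℝ :=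
  dx i f z + ∑ᶠ I : Fin n → ℕ, z.2 (I + e i) * du I f z

/-- The iterated total derivative `D^I = D_1^{I_1} ⋯ D_n^{I_n}`. -/
noncomputable def iterD {n : ℕ} (I : Fin n → ℕ) (f : Jet n → ℝ) : Jet n → ℝ :=
  (List.finRange n).foldr (fun i g => (totalDeriv i)^[I i] g) f

/-- The Euler--Lagrange operator `E_u(f) = ∑_I (-1)^{|I|} D^I (∂f/∂u_I)`
(a finite sum for a differential function). -/
noncomputable def euler {n : ℕ} (f : Jet n → ℝ) (z : Jet n) : ℝ :=
  ∑ᶠ I : Fin n → ℕ, (-1) ^ order I * iterD I (du I f) z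

/-- `G` has the form of an Euler--Lagrange expression over `U`, with a Lagrangian of any order. -/
def IsEulerLagrange {n : ℕ} (U : Set (Jet1 n)) (G : Jet n → ℝ) : Prop :=
  ∃ L : Jet n → ℝ, IsDifferentialFunction U L ∧ ∀ z, toJet1 z ∈ U → euler L z = G z

/-- `G = ∑ A^{ij}(x, u, ∂u) u_{ij} + B(x, u, ∂u)` over `U`, with smooth coefficients. -/
def IsQuasilinearSecondOrder {n : ℕ} (U : Set (Jet1 n)) (G : Jet n → ℝ) : Prop :=
  ∃ (A : Fin n → Fin n → Jet1 n → ℝ) (B : Jet1 n → ℝ),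
    (∀ i j, ContDiffOn ℝ ∞ (A i j) U) ∧ ContDiffOn ℝ ∞ B U ∧
    ∀ z, toJet1 z ∈ U → G z = ∑ i, ∑ j, A i j (toJet1 z) * z.2 (e i + e j) + B (toJet1 z)

/-- `W` is a variational integrating factor of `G` over `U`: a differential function, not
identically zero, such that `W G` is an Euler--Lagrange expression. -/
def IsVariationalIntegratingFactor {n : ℕ} (U : Set (Jet1 n)) (G W : Jet n → ℝ) : Prop :=
  IsDifferentialFunction U W ∧ (∃ z, toJet1 z ∈ U ∧ W z ≠ 0) ∧
    IsEulerLagrange U fun z => W z * G z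

/-- `L(x, u, ∂u)` is a first-order Lagrangian of `G` over `V`. -/
def IsFirstOrderLagrangian {n : ℕ} (V : Set (Jet1 n)) (L : Jet1 n → ℝ) (G : Jet n → ℝ) : Prop :=
  ContDiffOn ℝ ∞ L V ∧ ∀ z, toJet1 z ∈ V → euler (fun w => L (toJet1 w)) z = G z

/-- The jet `z` is (the Taylor data of) a formal solution of `G = 0`: `G` and all its total
derivatives vanish at `z`. -/
def IsFormalSolution {n : ℕ} (G : Jet n → ℝ) (z : Jet n) : Prop :=
  ∀ I : Fin n → ℕ, iterD I G z = 0

/-- In no neighbourhood of the first-order jet `q` is `W` constant on the formal solutions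
of `G = 0`. -/
def NonconstantOnSolutionsNear {n : ℕ} (G W : Jet n → ℝ) (q : Jet1 n) : Prop :=
  ∀ V : Set (Jet1 n), IsOpen V → q ∈ V → ∃ z z' : Jet n, toJet1 z ∈ V ∧ toJet1 z' ∈ V ∧
    IsFormalSolution G z ∧ IsFormalSolution G z' ∧ W z ≠ W z'

/-- In no neighbourhood of the first-order jet `q` is `W` constant. -/
def NonconstantNear {n : ℕ} (W : Jet n → ℝ) (q : Jet1 n) : Prop :=
  ∀ V : Set (Jet1 n), IsOpen V → q ∈ V → ∃ z z' : Jet n, toJet1 z ∈ V ∧ toJet1 z' ∈ V ∧ W z ≠ W z'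

/-- The partial derivative `∂L/∂u_i` on the first-order jet space. -/
noncomputable def dp {n : ℕ} (i : Fin n) (L : Jet1 n → ℝ) (q : Jet1 n) : ℝ :=
  deriv (fun t : ℝ => L (q.1, q.2.1, Function.update q.2.2 i t)) (q.2.2 i)

/-- The matrix `(L_{u_i u_j})`. -/
noncomputable def hessian {n : ℕ} (L : Jet1 n → ℝ) (q : Jet1 n) : Matrix (Fin n) (Fin n) ℝ :=
  Matrix.of fun i j => dp i (dp j L) q

end VarIF

/-! The linearization of an Euler–Lagrange expression is formally self-adjoint. Only one consequence
is used: the coefficients of D_i in the linearization and in its adjoint agree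
(`helmholtz_abstract`, `helmholtz_order_two`).

Existence of a Lagrangian. For quasilinear G the condition, sorted by powers of the second-order
coordinates, says that ∂A^{ab}/∂u_i is totally symmetric (`fderiv_A`) and expresses ∂B/∂u_i through
A (`fderiv_B`). So -A is a Hessian in p: two fibrewise Poincaré integrations give M with M_{u_i u_j}
= -A^{ij}, the defect G - E_u(M) turns out to depend on (x, u) only, and one integration in u
absorbs it.

Monge–Ampère equation. Every first-order Lagrangian has Hessian -A (`hessian_eq`), so suppose det A
≠ 0 near q. On formal solutions, the condition for WG minus W times the condition for G leaves Σ_j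
A^{ij} D_j W = 0, hence D_j W = 0. It remains to see that W is then constant on formal solutions.
Let Q be the quadratic form of A and σ = Σ W_I ξ^I the symbol of W in its top order. The top-order
directions tangent to the formal solutions are the functionals that kill multiples of Q. Vanishing
of D_i W at all formal solutions gives Q | ξ_i σ for every i, and Q | σ follows because n ≥ 2
provides two coprime variables. Thus W does not vary in the top-order tangent directions and agrees
on formal solutions with a function of lower order (`exists_lower_order`). The descent ends at order
one, where constancy is checked directly. Formal solutions are plentiful enough for this:
contraction with Q ≠ 0 is onto in every order, so a jet can be corrected order by order to a formal
solution (`proj`). This contradicts (a).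

For (b), the Helmholtz condition makes WG affine along the directions ξ^I, |I| = 2, just as G is.
Hence W is constant along those with Q(ξ) ≠ 0, W is a function of the first-order jet, and every
first-order jet underlies a formal solution. -/

namespace VarIF

/-! ### Differential calculus on jet space. -/

variable {n k m : ℕ} {U V : Set (Jet1 n)} {f f' g : Jet n → ℝ} {z v w : Jet n}

/-- The space of `k`-jets. -/
abbrev KJet (n k : ℕ) : Type := (Fin n → ℝ) × (multiIdx n k → ℝ)

/-- The truncation of a jet to order `k`. -/
def toKJet (k : ℕ) : Jet n →ₗ[ℝ] KJet n k where
  toFun z := (z.1, fun I => z.2 I)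
  map_add' _ _ := rfl
  map_smul' _ _ := rfl

/-- The `k`-jets whose first-order part lies in `U`. -/
def kdom (U : Set (Jet1 n)) (k : ℕ) : Set (KJet n k) := {y | toJet1 (ofKJet y) ∈ U}

theorem order_e (i : Fin n) : order (e i) = 1 := by
  simp [order, e, Pi.single_apply]

theorem order_zero : order (0 : Fin n → ℕ) = 0 := by
  simp [order]

theorem order_add (I J : Fin n → ℕ) : order (I + J) = order I + order J := by
  simp [order, Finset.sum_add_distrib]

theorem toKJet_ofKJet (y : KJet n k) : toKJet k (ofKJet y) = y := by
  refine Prod.ext rfl (funext fun I => ?_)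
  simp [toKJet, ofKJet]

theorem ofKJet_toKJet_apply {I : Fin n → ℕ} (hI : order I ≤ k) (z : Jet n) :
    (ofKJet (toKJet k z)).2 I = z.2 I := by
  simp [toKJet, ofKJet, mem_multiIdx.2 hI]

theorem toJet1_congr {z z' : Jet n} (hx : z.1 = z'.1) (h : ∀ I, order I ≤ 1 → z.2 I = z'.2 I) :
    toJet1 z = toJet1 z' := by
  simp only [toJet1, hx, h 0 (by simp [order_zero]), h (e _) (order_e _).le]

theorem toJet1_ofKJet_toKJet (hk : 1 ≤ k) (z : Jet n) :
    toJet1 (ofKJet (toKJet k z)) = toJet1 z :=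
  toJet1_congr rfl fun _ hI => ofKJet_toKJet_apply (hI.trans hk) z

theorem toKJet_mem_kdom (hk : 1 ≤ k) : toKJet k z ∈ kdom U k ↔ toJet1 z ∈ U := by
  rw [kdom, Set.mem_ofPred_eq, toJet1_ofKJet_toKJet hk]

theorem contDiff_ofKJet_apply (I : Fin n → ℕ) :
    ContDiff ℝ ∞ fun y : KJet n k => (ofKJet y).2 I := by
  by_cases h : I ∈ multiIdx n k
  · simp only [ofKJet, h, dite_true]
    fun_prop
  · simp only [ofKJet, h, dite_false]
    fun_prop

theorem contDiff_toJet1_ofKJet : ContDiff ℝ ∞ fun y : KJet n k => toJet1 (ofKJet y) :=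
  contDiff_fst.prodMk ((contDiff_ofKJet_apply 0).prodMk
    (contDiff_pi.2 fun i => contDiff_ofKJet_apply (e i)))

theorem isOpen_kdom (hU : IsOpen U) : IsOpen (kdom U k) :=
  hU.preimage contDiff_toJet1_ofKJet.continuous

theorem SmoothOfOrderLE.eq (hf : SmoothOfOrderLE U k f) (hz : toJet1 z ∈ U) :
    f z = f (ofKJet (toKJet k z)) :=
  hf.1 _ _ hz rfl fun _ hI => (ofKJet_toKJet_apply hI z).symm

/-- Reduces smoothness to a function on the finite-dimensional space of k-jets. The bound k ≥ 1 is
needed so that the k-jet decides membership in U. -/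
theorem smoothOfOrderLE_of_rep (hk : 1 ≤ k) {Φ : KJet n k → ℝ} (hΦ : ContDiffOn ℝ ∞ Φ (kdom U k))
    (h : ∀ z, toJet1 z ∈ U → f z = Φ (toKJet k z)) : SmoothOfOrderLE U k f := by
  refine ⟨fun z z' hz hx hI => ?_, hΦ.congr fun y hy => ?_⟩
  · rw [h z hz, h z' (by
      rwa [← toJet1_congr hx fun I hI1 => hI I (hI1.trans hk)])]
    congr 1
    exact Prod.ext hx (funext fun I => hI I (mem_multiIdx.1 I.2))
  · rw [h _ hy, toKJet_ofKJet]

theorem SmoothOfOrderLE.congr (hk : 1 ≤ k) (hf : SmoothOfOrderLE U k f)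
    (h : ∀ z, toJet1 z ∈ U → f' z = f z) : SmoothOfOrderLE U k f' :=
  smoothOfOrderLE_of_rep hk hf.2 fun z hz => by rw [h z hz, hf.eq hz]

theorem SmoothOfOrderLE.mono (hf : SmoothOfOrderLE U k f) (hVU : V ⊆ U) : SmoothOfOrderLE V k f :=
  ⟨fun z z' hz => hf.1 z z' (hVU hz), hf.2.mono fun _ hy => hVU hy⟩

/-- Composition of finitely many differential functions with a smooth function. -/
theorem SmoothOfOrderLE.comp {E : Type*} [NormedAddCommGroup E] [NormedSpace ℝ E] {s : Set E}
    {Φ : E → ℝ} (hΦ : ContDiffOn ℝ ∞ Φ s) (hk : 1 ≤ k) {X : Jet n → E}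
    (hX : ∀ z, toJet1 z ∈ U → X z = X (ofKJet (toKJet k z)))
    (hX' : ContDiffOn ℝ ∞ (fun y : KJet n k => X (ofKJet y)) (kdom U k))
    (hs : ∀ z, toJet1 z ∈ U → X z ∈ s) : SmoothOfOrderLE U k fun z => Φ (X z) :=
  smoothOfOrderLE_of_rep hk (Φ := fun y => Φ (X (ofKJet y))) (hΦ.comp hX' fun _ hy => hs _ hy)
    fun z hz => by rw [← hX z hz]

theorem SmoothOfOrderLE.mono_order (hf : SmoothOfOrderLE U k f) (hk : 1 ≤ k) (hkm : k ≤ m) :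
    SmoothOfOrderLE U m f := by
  refine smoothOfOrderLE_of_rep (hk.trans hkm)
    (Φ := fun y => f (ofKJet (toKJet k (ofKJet y)))) ?_ ?_
  · refine ContDiffOn.comp (g := fun y => f (ofKJet y))
      (f := fun y : KJet n m => toKJet k (ofKJet y)) hf.2 ?_ ?_
    · exact (contDiff_fst.prodMk (contDiff_pi.2 fun I => contDiff_ofKJet_apply _)).contDiffOn
    · intro y hy
      exact (toKJet_mem_kdom hk).2 hy
  · intro z hz
    rw [hf.eq hz]
    congr 2
    exact Prod.ext rfl (funext fun I =>
      (ofKJet_toKJet_apply ((mem_multiIdx.1 I.2).trans hkm) z).symm)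

theorem SmoothOfOrderLE.toJet1_comp {A : Jet1 n → ℝ} (hA : ContDiffOn ℝ ∞ A U) (hk : 1 ≤ k) :
    SmoothOfOrderLE U k fun z => A (toJet1 z) :=
  .comp hA hk (fun z _ => (toJet1_ofKJet_toKJet hk z).symm) contDiff_toJet1_ofKJet.contDiffOn
    fun _ hz => hz

theorem smoothOfOrderLE_const (hk : 1 ≤ k) (c : ℝ) : SmoothOfOrderLE U k fun _ => c :=
  smoothOfOrderLE_of_rep hk (Φ := fun _ => c) contDiffOn_const fun _ _ => rfl

theorem smoothOfOrderLE_coord {I : Fin n → ℕ} (hI : order I ≤ k) :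
    SmoothOfOrderLE U k fun z => z.2 I :=
  ⟨fun _ _ _ _ h => h I hI, (contDiff_ofKJet_apply I).contDiffOn⟩

theorem SmoothOfOrderLE.add (hf : SmoothOfOrderLE U k f) (hg : SmoothOfOrderLE U k g) :
    SmoothOfOrderLE U k fun z => f z + g z :=
  ⟨fun z z' hz hx h => by simp only [hf.1 z z' hz hx h, hg.1 z z' hz hx h], hf.2.add hg.2⟩

theorem SmoothOfOrderLE.mul (hf : SmoothOfOrderLE U k f) (hg : SmoothOfOrderLE U k g) :
    SmoothOfOrderLE U k fun z => f z * g z :=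
  ⟨fun z z' hz hx h => by simp only [hf.1 z z' hz hx h, hg.1 z z' hz hx h], hf.2.mul hg.2⟩

theorem SmoothOfOrderLE.const_mul (hf : SmoothOfOrderLE U k f) (c : ℝ) :
    SmoothOfOrderLE U k fun z => c * f z :=
  ⟨fun z z' hz hx h => by simp only [hf.1 z z' hz hx h], contDiffOn_const.mul hf.2⟩

theorem SmoothOfOrderLE.sub (hf : SmoothOfOrderLE U k f) (hg : SmoothOfOrderLE U k g) :
    SmoothOfOrderLE U k fun z => f z - g z :=
  ⟨fun z z' hz hx h => by simp only [hf.1 z z' hz hx h, hg.1 z z' hz hx h], hf.2.sub hg.2⟩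

theorem SmoothOfOrderLE.sum {ι : Type*} (s : Finset ι) {f : ι → Jet n → ℝ}
    (hf : ∀ a ∈ s, SmoothOfOrderLE U k (f a)) : SmoothOfOrderLE U k fun z => ∑ a ∈ s, f a z := by
  refine ⟨fun z z' hz hx h => ?_, ?_⟩
  · exact Finset.sum_congr rfl fun a ha => (hf a ha).1 z z' hz hx h
  · exact ContDiffOn.sum fun a ha => (hf a ha).2

/-- The curve `γ` in jet space has velocity `v` at `t`, coordinate by coordinate. -/
def HasVelocity (γ : ℝ → Jet n) (v : Jet n) (t : ℝ) : Prop :=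
  (∀ i, HasDerivAt (fun s => (γ s).1 i) (v.1 i) t) ∧ ∀ I, HasDerivAt (fun s => (γ s).2 I) (v.2 I) t

theorem HasVelocity.toKJet {γ : ℝ → Jet n} {t : ℝ} (h : HasVelocity γ v t) (k : ℕ) :
    HasDerivAt (fun s => toKJet k (γ s)) (toKJet k v) t :=
  (hasDerivAt_pi.2 h.1).prodMk (hasDerivAt_pi.2 fun I => h.2 I)

theorem HasVelocity.toJet1 {γ : ℝ → Jet n} {t : ℝ} (h : HasVelocity γ v t) :
    HasDerivAt (fun s => toJet1 (γ s)) (toJet1 v) t :=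
  (hasDerivAt_pi.2 h.1).prodMk ((h.2 0).prodMk (hasDerivAt_pi.2 fun i => h.2 (e i)))

theorem HasVelocity.eventually {γ : ℝ → Jet n} {t : ℝ} (h : HasVelocity γ v t) (hU : IsOpen U)
    (ht : VarIF.toJet1 (γ t) ∈ U) : ∀ᶠ s in nhds t, VarIF.toJet1 (γ s) ∈ U :=
  h.toJet1.continuousAt (hU.mem_nhds ht)

theorem hasVelocity_line (z v : Jet n) (t : ℝ) : HasVelocity (fun s => z + s • v) v t := by
  constructor
  · intro i
    simpa using ((hasDerivAt_id t).mul_const (v.1 i)).const_add (z.1 i)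
  · intro i
    simpa using ((hasDerivAt_id t).mul_const (v.2 i)).const_add (z.2 i)

/-- The derivative of `f` at the jet `z` in the direction `v`. -/
noncomputable def dirD (f : Jet n → ℝ) (z v : Jet n) : ℝ := deriv (fun t : ℝ => f (z + t • v)) 0

/-- The differential of `f` on the space of `k`-jets. -/
noncomputable def kfderiv (k : ℕ) (f : Jet n → ℝ) (y : KJet n k) : KJet n k →L[ℝ] ℝ :=
  fderiv ℝ (fun y : KJet n k => f (ofKJet y)) y

theorem SmoothOfOrderLE.contDiffAt (hf : SmoothOfOrderLE U k f) (hU : IsOpen U) (hk : 1 ≤ k)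
    (hz : toJet1 z ∈ U) : ContDiffAt ℝ ∞ (fun y : KJet n k => f (ofKJet y)) (toKJet k z) :=
  hf.2.contDiffAt ((isOpen_kdom hU).mem_nhds ((toKJet_mem_kdom hk).2 hz))

theorem SmoothOfOrderLE.hasFDerivAt (hf : SmoothOfOrderLE U k f) (hU : IsOpen U) (hk : 1 ≤ k)
    (hz : toJet1 z ∈ U) :
    HasFDerivAt (fun y : KJet n k => f (ofKJet y)) (kfderiv k f (toKJet k z)) (toKJet k z) :=
  ((hf.contDiffAt hU hk hz).differentiableAt (by simp)).hasFDerivAt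

/-- The jet space is an infinite product without a norm, so the chain rule is applied to the
truncated curve. Near t the first-order part stays in U, where f agrees with its truncation. -/
theorem SmoothOfOrderLE.hasDerivAt_kfderiv (hf : SmoothOfOrderLE U k f) (hU : IsOpen U)
    (hk : 1 ≤ k) {γ : ℝ → Jet n} {t : ℝ} (hγ : HasVelocity γ v t) (hz : toJet1 (γ t) ∈ U) :
    HasDerivAt (fun s => f (γ s)) (kfderiv k f (toKJet k (γ t)) (toKJet k v)) t := by
  have h := (hf.hasFDerivAt hU hk hz).comp_hasDerivAt t (hγ.toKJet k)
  refine h.congr_of_eventuallyEq ?_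
  filter_upwards [hγ.eventually hU hz] with s hs using hf.eq hs

theorem SmoothOfOrderLE.dirD_eq (hf : SmoothOfOrderLE U k f) (hU : IsOpen U) (hk : 1 ≤ k)
    (hz : toJet1 z ∈ U) (v : Jet n) : dirD f z v = kfderiv k f (toKJet k z) (toKJet k v) := by
  have := hf.hasDerivAt_kfderiv hU hk (hasVelocity_line z v 0) (by simpa using hz)
  simpa [dirD] using this.deriv

theorem SmoothOfOrderLE.hasDerivAt (hf : SmoothOfOrderLE U k f) (hU : IsOpen U)
    (hk : 1 ≤ k) {γ : ℝ → Jet n} {t : ℝ} (hγ : HasVelocity γ v t) (hz : toJet1 (γ t) ∈ U) :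
    HasDerivAt (fun s => f (γ s)) (dirD f (γ t) v) t := by
  rw [hf.dirD_eq hU hk hz]
  exact hf.hasDerivAt_kfderiv hU hk hγ hz

theorem dirD_congr (hU : IsOpen U) (h : ∀ z, toJet1 z ∈ U → f z = f' z) (hz : toJet1 z ∈ U)
    (v : Jet n) : dirD f z v = dirD f' z v := by
  refine Filter.EventuallyEq.deriv_eq ?_
  have := (hasVelocity_line z v 0).eventually hU (by simpa using hz)
  filter_upwards [this] with s hs using h _ hs

theorem SmoothOfOrderLE.dirD_add (hf : SmoothOfOrderLE U k f) (hU : IsOpen U) (hk : 1 ≤ k)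
    (hz : toJet1 z ∈ U) (v w : Jet n) : dirD f z (v + w) = dirD f z v + dirD f z w := by
  simp only [hf.dirD_eq hU hk hz, map_add]

theorem SmoothOfOrderLE.dirD_sub (hf : SmoothOfOrderLE U k f) (hU : IsOpen U) (hk : 1 ≤ k)
    (hz : toJet1 z ∈ U) (v w : Jet n) : dirD f z (v - w) = dirD f z v - dirD f z w := by
  simp only [hf.dirD_eq hU hk hz, map_sub]

theorem SmoothOfOrderLE.dirD_smul (hf : SmoothOfOrderLE U k f) (hU : IsOpen U) (hk : 1 ≤ k)
    (hz : toJet1 z ∈ U) (c : ℝ) (v : Jet n) : dirD f z (c • v) = c * dirD f z v := by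
  simp only [hf.dirD_eq hU hk hz, map_smul, smul_eq_mul]

theorem SmoothOfOrderLE.dirD_sum (hf : SmoothOfOrderLE U k f) (hU : IsOpen U) (hk : 1 ≤ k)
    (hz : toJet1 z ∈ U) {ι : Type*} (s : Finset ι) (v : ι → Jet n) :
    dirD f z (∑ a ∈ s, v a) = ∑ a ∈ s, dirD f z (v a) := by
  simp only [hf.dirD_eq hU hk hz, map_sum]

theorem SmoothOfOrderLE.dirD_congr_dir (hf : SmoothOfOrderLE U k f) (hU : IsOpen U) (hk : 1 ≤ k)
    (hz : toJet1 z ∈ U) (hvw : v.1 = w.1) (h : ∀ I, order I ≤ k → v.2 I = w.2 I) :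
    dirD f z v = dirD f z w := by
  rw [hf.dirD_eq hU hk hz, hf.dirD_eq hU hk hz]
  congr 1
  exact Prod.ext hvw (funext fun I => h I (mem_multiIdx.1 I.2))

theorem SmoothOfOrderLE.dirD_fun_add (hf : SmoothOfOrderLE U k f) (hg : SmoothOfOrderLE U k g)
    (hU : IsOpen U) (hk : 1 ≤ k) (hz : toJet1 z ∈ U) (v : Jet n) :
    dirD (fun z => f z + g z) z v = dirD f z v + dirD g z v := by
  have hl := hasVelocity_line z v 0
  have hz0 : toJet1 (z + (0 : ℝ) • v) ∈ U := by simpa using hz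
  simpa [dirD] using ((hf.hasDerivAt hU hk hl hz0).fun_add (hg.hasDerivAt hU hk hl hz0)).deriv

theorem SmoothOfOrderLE.dirD_fun_mul (hf : SmoothOfOrderLE U k f) (hg : SmoothOfOrderLE U k g)
    (hU : IsOpen U) (hk : 1 ≤ k) (hz : toJet1 z ∈ U) (v : Jet n) :
    dirD (fun z => f z * g z) z v = dirD f z v * g z + f z * dirD g z v := by
  have hl := hasVelocity_line z v 0
  have hz0 : toJet1 (z + (0 : ℝ) • v) ∈ U := by simpa using hz
  simpa [dirD] using ((hf.hasDerivAt hU hk hl hz0).fun_mul (hg.hasDerivAt hU hk hl hz0)).deriv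

theorem dirD_fun_const_mul (c : ℝ) (f : Jet n → ℝ) (z v : Jet n) :
    dirD (fun z => c * f z) z v = c * dirD f z v := by
  simp [dirD]

theorem dirD_fun_sum (hU : IsOpen U) (hk : 1 ≤ k) (hz : toJet1 z ∈ U) {ι : Type*} (s : Finset ι)
    {f : ι → Jet n → ℝ} (hf : ∀ a ∈ s, SmoothOfOrderLE U k (f a)) (v : Jet n) :
    dirD (fun z => ∑ a ∈ s, f a z) z v = ∑ a ∈ s, dirD (f a) z v := by
  have hl := hasVelocity_line z v 0
  have hz0 : toJet1 (z + (0 : ℝ) • v) ∈ U := by simpa using hz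
  simpa [dirD] using
    (HasDerivAt.fun_sum fun a ha => (hf a ha).hasDerivAt hU hk hl hz0).deriv

theorem dirD_coord (I : Fin n → ℕ) (z v : Jet n) : dirD (fun z => z.2 I) z v = v.2 I := by
  exact ((hasVelocity_line z v 0).2 I).deriv

/-- The derivative of a differential function along a field of directions is a differential
function. -/
theorem SmoothOfOrderLE.dirD_field (hf : SmoothOfOrderLE U k f) (hU : IsOpen U) (hk : 1 ≤ k)
    (hkm : k ≤ m) {X : Jet n → Jet n} (h1 : ∀ i, SmoothOfOrderLE U m fun z => (X z).1 i)
    (h2 : ∀ I, order I ≤ k → SmoothOfOrderLE U m fun z => (X z).2 I) :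
    SmoothOfOrderLE U m fun z => dirD f z (X z) := by
  have hm := hk.trans hkm
  refine smoothOfOrderLE_of_rep hm (Φ := fun y =>
    kfderiv k f (toKJet k (ofKJet y)) (toKJet k (X (ofKJet y)))) ?_ ?_
  · refine ContDiffOn.clm_apply ?_ ?_
    · refine ContDiffOn.comp (t := kdom U k) (g := kfderiv k f)
        (f := fun y : KJet n m => toKJet k (ofKJet y)) ?_ ?_ ?_
      · exact hf.2.fderiv_of_isOpen (isOpen_kdom hU) (by simp)
      · exact (contDiff_fst.prodMk (contDiff_pi.2 fun I => contDiff_ofKJet_apply _)).contDiffOn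
      · intro y hy
        exact (toKJet_mem_kdom hk).2 hy
    · exact (contDiffOn_pi.2 fun i => (h1 i).2).prodMk
        (contDiffOn_pi.2 fun I => (h2 I (mem_multiIdx.1 I.2)).2)
  · intro z hz
    have hz' : toJet1 (ofKJet (toKJet m z)) ∈ U := by rwa [toJet1_ofKJet_toKJet hm]
    rw [← hf.dirD_eq hU hk hz', hf.dirD_eq hU hk hz, hf.dirD_eq hU hk hz']
    congr 1
    · congr 1
      exact Prod.ext rfl (funext fun I =>
        (ofKJet_toKJet_apply ((mem_multiIdx.1 I.2).trans hkm) z).symm)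
    · exact Prod.ext (funext fun i => (h1 i).eq hz)
        (funext fun I => (h2 I (mem_multiIdx.1 I.2)).eq hz)

theorem SmoothOfOrderLE.dirD_const (hf : SmoothOfOrderLE U k f) (hU : IsOpen U) (hk : 1 ≤ k)
    (v : Jet n) : SmoothOfOrderLE U k fun z => dirD f z v :=
  hf.dirD_field hU hk le_rfl (X := fun _ => v) (fun _ => smoothOfOrderLE_const hk _)
    fun _ _ => smoothOfOrderLE_const hk _

theorem SmoothOfOrderLE.hasFDerivAt_kfderiv (hf : SmoothOfOrderLE U k f) (hU : IsOpen U)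
    (hk : 1 ≤ k) (hz : toJet1 z ∈ U) :
    HasFDerivAt (kfderiv k f) (fderiv ℝ (kfderiv k f) (toKJet k z)) (toKJet k z) := by
  have h : ContDiffAt ℝ ∞ (kfderiv k f) (toKJet k z) :=
    (hf.contDiffAt hU hk hz).fderiv_right (m := ∞) (by simp)
  exact (h.differentiableAt (by simp)).hasFDerivAt

/-- Product rule for the pairing of the differential of f with the field X. The first term is a
second derivative, the second comes from the velocity of X; all commutation relations follow from
this and the symmetry of the second derivative. -/
theorem SmoothOfOrderLE.dirD_dirD_eq (hf : SmoothOfOrderLE U k f) (hU : IsOpen U) (hk : 1 ≤ k)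
    (hz : toJet1 z ∈ U) {X : Jet n → Jet n} {X' : Jet n}
    (hX : HasVelocity (fun t => X (z + t • v)) X' 0) :
    dirD (fun y => dirD f y (X y)) z v =
      fderiv ℝ (kfderiv k f) (toKJet k z) (toKJet k v) (toKJet k (X z)) + dirD f z X' := by
  have hl := hasVelocity_line z v 0
  have hz0 : toJet1 (z + (0 : ℝ) • v) ∈ U := by simpa using hz
  have e0 : z + (0 : ℝ) • v = z := by simp
  have hd := hf.hasFDerivAt_kfderiv hU hk hz0
  have h1 : HasDerivAt (fun t : ℝ => kfderiv k f (toKJet k (z + t • v)))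
      (fderiv ℝ (kfderiv k f) (toKJet k (z + (0 : ℝ) • v)) (toKJet k v)) 0 :=
    hd.comp_hasDerivAt (0 : ℝ) (hl.toKJet k)
  have h1 := h1.clm_apply (hX.toKJet k)
  have h2 : (fun t : ℝ => dirD f (z + t • v) (X (z + t • v))) =ᶠ[nhds 0]
      fun t => kfderiv k f (toKJet k (z + t • v)) (toKJet k (X (z + t • v))) := by
    filter_upwards [hl.eventually hU hz0] with s hs using hf.dirD_eq hU hk hs _
  have h3 := (h1.congr_of_eventuallyEq h2).deriv
  rw [e0] at h3
  rw [hf.dirD_eq hU hk hz]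
  exact h3

theorem hasVelocity_const (w : Jet n) (t : ℝ) : HasVelocity (fun _ => w) 0 t :=
  ⟨fun _ => hasDerivAt_const _ _, fun _ => hasDerivAt_const _ _⟩

theorem SmoothOfOrderLE.dirD_dirD_field (hf : SmoothOfOrderLE U k f) (hU : IsOpen U) (hk : 1 ≤ k)
    (hz : toJet1 z ∈ U) {X : Jet n → Jet n} {X' : Jet n}
    (hX : HasVelocity (fun t => X (z + t • v)) X' 0) :
    dirD (fun y => dirD f y (X y)) z v =
      dirD (fun y => dirD f y (X z)) z v + dirD f z X' := by
  rw [hf.dirD_dirD_eq hU hk hz hX, hf.dirD_dirD_eq hU hk hz (hasVelocity_const (X z) 0)]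
  simp [hf.dirD_eq hU hk hz]

theorem SmoothOfOrderLE.dirD_dirD_comm (hf : SmoothOfOrderLE U k f) (hU : IsOpen U) (hk : 1 ≤ k)
    (hz : toJet1 z ∈ U) (v w : Jet n) :
    dirD (fun y => dirD f y w) z v = dirD (fun y => dirD f y v) z w := by
  rw [hf.dirD_dirD_eq hU hk hz (hasVelocity_const w 0),
    hf.dirD_dirD_eq hU hk hz (hasVelocity_const v 0)]
  have h : IsSymmSndFDerivAt ℝ (fun y : KJet n k => f (ofKJet y)) (toKJet k z) :=
    (hf.contDiffAt hU hk hz).isSymmSndFDerivAt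
      (by rw [minSmoothness_of_isRCLikeNormedField]; exact WithTop.coe_le_coe.2 le_top)
  have h2 : fderiv ℝ (kfderiv k f) (toKJet k z) (toKJet k v) (toKJet k w) =
    fderiv ℝ (kfderiv k f) (toKJet k z) (toKJet k w) (toKJet k v) := h.eq _ _
  rw [h2]

end VarIF

/-! ### Coordinate derivatives, total derivatives and their commutators. -/

namespace VarIF

variable {n k m : ℕ} {U V : Set (Jet1 n)} {f f' g : Jet n → ℝ} {z v w : Jet n}

/-- The jet direction `∂/∂u_I`. -/
noncomputable def vert (I : Fin n → ℕ) : Jet n := (0, Pi.single I 1)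

/-- The direction of the total derivative `D_i` at the jet `z`. -/
noncomputable def cartan (i : Fin n) (z : Jet n) : Jet n := (Pi.single i 1, fun I => z.2 (I + e i))

/-- The vertical direction obtained by shifting the coordinates of `z` by `e_i`. -/
noncomputable def shift (i : Fin n) (z : Jet n) : Jet n := (0, fun I => z.2 (I + e i))

theorem du_eq_dirD (I : Fin n → ℕ) (f : Jet n → ℝ) (z : Jet n) :
    du I f z = dirD f z (vert I) := by
  have h := deriv_comp_const_add (fun t : ℝ => f (z.1, Function.update z.2 I t)) (z.2 I) 0
  rw [add_zero] at h
  rw [du, dirD, ← h]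
  congr 1
  funext t
  congr 1
  refine Prod.ext (by simp [vert]) (funext fun J => ?_)
  by_cases hJ : J = I
  · subst hJ; simp [vert]
  · simp [vert, hJ]

theorem dx_eq_dirD (i : Fin n) (f : Jet n → ℝ) (z : Jet n) :
    dx i f z = dirD f z (Pi.single i 1, 0) := by
  have h := deriv_comp_const_add (fun t : ℝ => f (Function.update z.1 i t, z.2)) (z.1 i) 0
  rw [add_zero] at h
  rw [dx, dirD, ← h]
  congr 1
  funext t
  congr 1
  refine Prod.ext (funext fun j => ?_) (by simp)
  by_cases hj : j = i
  · subst hj; simp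
  · simp [hj]

theorem SmoothOfOrderLE.du_eq_zero (hf : SmoothOfOrderLE U k f) (hU : IsOpen U) (hk : 1 ≤ k)
    (hz : toJet1 z ∈ U) {I : Fin n → ℕ} (hI : k < order I) : du I f z = 0 := by
  rw [du_eq_dirD, hf.dirD_congr_dir (v := vert I) (w := 0) hU hk hz rfl ?_]
  · simp [dirD]
  · intro J hJ
    have : J ≠ I := by rintro rfl; omega
    simp [vert, this]

theorem SmoothOfOrderLE.dirD_expand (hf : SmoothOfOrderLE U k f) (hU : IsOpen U) (hk : 1 ≤ k)
    (hz : toJet1 z ∈ U) (v : Jet n) :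
    dirD f z v = ∑ i, v.1 i * dx i f z + ∑ I ∈ multiIdx n k, v.2 I * du I f z := by
  have h : dirD f z v = dirD f z
      (∑ i, v.1 i • ((Pi.single i 1, 0) : Jet n) + ∑ I ∈ multiIdx n k, v.2 I • vert I) := by
    refine hf.dirD_congr_dir hU hk hz ?_ ?_
    · simp only [Prod.fst_add, Prod.fst_sum, Prod.smul_fst, vert, smul_zero,
        Finset.sum_const_zero, add_zero]
      exact pi_eq_sum_univ' v.1
    · intro I hI
      simp [Prod.snd_add, Prod.snd_sum, vert, Finset.sum_apply, Pi.single_apply, mem_multiIdx, hI]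
  rw [h, hf.dirD_add hU hk hz, hf.dirD_sum hU hk hz, hf.dirD_sum hU hk hz]
  simp only [hf.dirD_smul hU hk hz, dx_eq_dirD, du_eq_dirD]

theorem SmoothOfOrderLE.totalDeriv_eq (hf : SmoothOfOrderLE U k f) (hU : IsOpen U) (hk : 1 ≤ k)
    (hz : toJet1 z ∈ U) (i : Fin n) : totalDeriv i f z = dirD f z (cartan i z) := by
  rw [hf.dirD_expand hU hk hz, totalDeriv]
  congr 1
  · simp [cartan, Pi.single_apply]
  · refine finsum_eq_sum_of_support_subset _ fun I hI => ?_
    by_contra h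
    refine hI ?_
    have h' := hf.du_eq_zero hU hk hz (I := I) (by simpa [mem_multiIdx] using h)
    simp only [h', mul_zero]

theorem SmoothOfOrderLE.totalDeriv (hf : SmoothOfOrderLE U k f) (hU : IsOpen U) (hk : 1 ≤ k)
    (i : Fin n) : SmoothOfOrderLE U (k + 1) (totalDeriv i f) := by
  refine SmoothOfOrderLE.congr (by omega) (hf.dirD_field hU hk (Nat.le_succ k) (X := cartan i)
    (fun j => smoothOfOrderLE_const (by omega) _) fun I hI => ?_)
    fun z hz => hf.totalDeriv_eq hU hk hz i
  exact smoothOfOrderLE_coord (by rw [order_add, order_e]; omega)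

theorem SmoothOfOrderLE.du (hf : SmoothOfOrderLE U k f) (hU : IsOpen U) (hk : 1 ≤ k)
    (I : Fin n → ℕ) : SmoothOfOrderLE U k (du I f) :=
  (hf.dirD_const hU hk (vert I)).congr hk fun z _ => du_eq_dirD I f z

theorem hasVelocity_cartan (i : Fin n) (z v : Jet n) :
    HasVelocity (fun t : ℝ => cartan i (z + t • v)) (shift i v) 0 :=
  ⟨fun _ => hasDerivAt_const _ _, fun I => (hasVelocity_line z v 0).2 (I + e i)⟩

/-- The direction `cartan i` is affine in the jet with linear part `shift i`, which accounts for the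
second term. -/
theorem SmoothOfOrderLE.dirD_totalDeriv (hf : SmoothOfOrderLE U k f) (hU : IsOpen U) (hk : 1 ≤ k)
    (hz : toJet1 z ∈ U) (i : Fin n) (v : Jet n) :
    dirD (VarIF.totalDeriv i f) z v =
      dirD (fun y => dirD f y v) z (cartan i z) + dirD f z (shift i v) := by
  rw [dirD_congr hU (fun z hz => hf.totalDeriv_eq hU hk hz i) hz,
    hf.dirD_dirD_field hU hk hz (hasVelocity_cartan i z v), hf.dirD_dirD_comm hU hk hz]

theorem SmoothOfOrderLE.totalDeriv_comm (hf : SmoothOfOrderLE U k f) (hU : IsOpen U) (hk : 1 ≤ k)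
    (hz : toJet1 z ∈ U) (i j : Fin n) :
    VarIF.totalDeriv i (VarIF.totalDeriv j f) z = VarIF.totalDeriv j (VarIF.totalDeriv i f) z := by
  rw [(hf.totalDeriv hU hk j).totalDeriv_eq hU (by omega) hz,
    (hf.totalDeriv hU hk i).totalDeriv_eq hU (by omega) hz,
    dirD_congr hU (fun z hz => hf.totalDeriv_eq hU hk hz j) hz,
    dirD_congr hU (fun z hz => hf.totalDeriv_eq hU hk hz i) hz,
    hf.dirD_dirD_field hU hk hz (hasVelocity_cartan j z _),
    hf.dirD_dirD_field hU hk hz (hasVelocity_cartan i z _), hf.dirD_dirD_comm hU hk hz]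
  -- Second derivatives are symmetric; what remains is that the shifts by e_i and e_j commute.
  congr 2
  simp only [shift, cartan]
  refine Prod.ext rfl (funext fun I => ?_)
  simp only [add_right_comm]

theorem SmoothOfOrderLE.du_comm (hf : SmoothOfOrderLE U k f) (hU : IsOpen U) (hk : 1 ≤ k)
    (hz : toJet1 z ∈ U) (I J : Fin n → ℕ) :
    VarIF.du I (VarIF.du J f) z = VarIF.du J (VarIF.du I f) z := by
  have h : ∀ I, VarIF.du I f = fun z => dirD f z (vert I) := fun I => funext (du_eq_dirD I f)
  rw [du_eq_dirD, du_eq_dirD, h, h, hf.dirD_dirD_comm hU hk hz]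

theorem e_le {i : Fin n} {I : Fin n → ℕ} (h : 1 ≤ I i) : e i ≤ I := by
  intro j
  by_cases hj : j = i
  · subst hj; simpa [e] using h
  · simp [e, hj]

theorem add_e_eq_iff {i : Fin n} {I J : Fin n → ℕ} (h : 1 ≤ I i) :
    J + e i = I ↔ J = I - e i := by
  constructor
  · rintro rfl
    simp
  · rintro rfl
    exact tsub_add_cancel_of_le (e_le h)

theorem shift_vert (i : Fin n) (I : Fin n → ℕ) :
    shift i (vert I) = if 1 ≤ I i then vert (I - e i) else 0 := by
  split_ifs with h
  · refine Prod.ext rfl (funext fun J => ?_)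
    simp only [shift, vert, Pi.single_apply, add_e_eq_iff h]
  · refine Prod.ext rfl (funext fun J => ?_)
    have : J + e i ≠ I := by
      rintro rfl
      simp [e] at h
    simp [shift, vert, this]

theorem dirD_zero (f : Jet n → ℝ) (z : Jet n) : dirD f z 0 = 0 := by
  simp [dirD]

/-- The commutator [∂/∂u_I, D_i] = ∂/∂u_{I - e_i}. With the two commutativity statements it is all
that the algebraic proof of the Helmholtz condition needs. -/
theorem SmoothOfOrderLE.du_totalDeriv (hf : SmoothOfOrderLE U k f) (hU : IsOpen U) (hk : 1 ≤ k)
    (hz : toJet1 z ∈ U) (i : Fin n) (I : Fin n → ℕ) :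
    VarIF.du I (VarIF.totalDeriv i f) z = VarIF.totalDeriv i (VarIF.du I f) z +
      if 1 ≤ I i then VarIF.du (I - e i) f z else 0 := by
  rw [du_eq_dirD, hf.dirD_totalDeriv hU hk hz, shift_vert,
    (hf.du hU hk I).totalDeriv_eq hU hk hz]
  congr 1
  · exact dirD_congr hU (fun z _ => (du_eq_dirD I f z).symm) hz _
  · split_ifs
    · rw [du_eq_dirD]
    · exact dirD_zero f z

theorem SmoothOfOrderLE.totalDeriv_congr (hf : SmoothOfOrderLE U k f) (hU : IsOpen U)
    (hk : 1 ≤ k) (h : ∀ z, toJet1 z ∈ U → f' z = f z) (hz : toJet1 z ∈ U) (i : Fin n) :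
    VarIF.totalDeriv i f' z = VarIF.totalDeriv i f z := by
  rw [hf.totalDeriv_eq hU hk hz, (hf.congr hk h).totalDeriv_eq hU hk hz, dirD_congr hU h hz]

theorem du_congr (hU : IsOpen U) (h : ∀ z, toJet1 z ∈ U → f' z = f z) (hz : toJet1 z ∈ U)
    (I : Fin n → ℕ) : du I f' z = du I f z := by
  rw [du_eq_dirD, du_eq_dirD, dirD_congr hU h hz]

end VarIF

/-! ### The Helmholtz condition as an identity for commuting operators. -/

namespace VarIF

variable {n : ℕ}

theorem multiIdx_induction {p : (Fin n → ℕ) → Prop} (h0 : p 0)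
    (hs : ∀ I i, p I → p (I + e i)) (I : Fin n → ℕ) : p I := by
  induction hm : order I generalizing I with
  | zero =>
    have : I = 0 := funext fun i => by
      simpa using (Finset.sum_eq_zero_iff.1 hm) i (Finset.mem_univ i)
    exact this ▸ h0
  | succ m ih =>
    obtain ⟨i, hi⟩ : ∃ i, 1 ≤ I i := by
      by_contra! h
      have : order I = 0 := Finset.sum_eq_zero fun i _ => Nat.lt_one_iff.1 (h i)
      omega
    have hI : I - e i + e i = I := tsub_add_cancel_of_le (e_le hi)
    rw [← hI]
    refine hs _ _ (ih _ ?_)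
    rw [← hI, order_add, order_e] at hm
    omega

section Abstract

variable {M : Type*} [AddCommGroup M] [Module ℝ M] {D : Fin n → Module.End ℝ M}
  {P : (Fin n → ℕ) → Module.End ℝ M}

/-- The monomial `D_1^{I_1} ⋯ D_n^{I_n}` in a family of endomorphisms. -/
def opPow (D : Fin n → Module.End ℝ M) (I : Fin n → ℕ) : Module.End ℝ M :=
  ((List.finRange n).map fun i => D i ^ I i).prod

theorem opPow_zero : opPow D 0 = 1 := by
  simp [opPow]

theorem commute_listProd (hD : ∀ i j, Commute (D i) (D j)) (i : Fin n) (I : Fin n → ℕ)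
    (l : List (Fin n)) : Commute (D i) (l.map fun j => D j ^ I j).prod :=
  Commute.list_prod_right _ _ fun x hx => by
    obtain ⟨j, -, rfl⟩ := List.mem_map.1 hx
    exact (hD i j).pow_right _

theorem opPow_add_e (hD : ∀ i j, Commute (D i) (D j)) (I : Fin n → ℕ) (i : Fin n) :
    opPow D (I + e i) = D i * opPow D I := by
  have key : ∀ l : List (Fin n), l.Nodup → (l.map fun j => D j ^ (I + e i) j).prod =
      (if i ∈ l then D i else 1) * (l.map fun j => D j ^ I j).prod := by
    intro l hl
    induction l with
    | nil => simp
    | cons a l ih =>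
      have hl' := List.nodup_cons.1 hl
      rw [List.map_cons, List.prod_cons, ih hl'.2, List.map_cons, List.prod_cons]
      by_cases h : i = a
      · subst h
        simp [hl'.1, e, pow_succ', mul_assoc]
      · have : (I + e i) a = I a := by simp [e, Ne.symm h]
        rw [this]
        by_cases hi : i ∈ l
        · simp only [hi, if_true, List.mem_cons, or_true]
          rw [← mul_assoc, ← mul_assoc, ((hD i a).pow_right (I a)).eq]
        · simp [hi, h]
  rw [opPow, key _ (List.nodup_finRange n)]
  simp [opPow]

theorem commute_opPow (hD : ∀ i j, Commute (D i) (D j)) (i : Fin n) (I : Fin n → ℕ) :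
    Commute (D i) (opPow D I) :=
  commute_listProd hD i I _

theorem commute_neg_neg_of (hD : ∀ i j, Commute (D i) (D j)) (i j : Fin n) :
    Commute (-D i) (-D j) := (hD i j).neg_left.neg_right

theorem opPow_neg_apply (hD : ∀ i j, Commute (D i) (D j)) (I : Fin n → ℕ) (x : M) :
    opPow (fun i => -D i) I x = (-1 : ℝ) ^ order I • opPow D I x := by
  induction I using multiIdx_induction with
  | h0 => simp [opPow_zero, order_zero]
  | hs I i ih =>
    rw [opPow_add_e (commute_neg_neg_of hD), Module.End.mul_apply, ih, opPow_add_e hD, order_add,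
      order_e, pow_succ, Module.End.mul_apply, LinearMap.neg_apply, map_smul, mul_neg_one, neg_smul]

/-- The symbol `∑_I (∂_I f) ξ^I`. -/
noncomputable def symb (P : (Fin n → ℕ) → Module.End ℝ M) (hP : ∀ f, {I | P I f ≠ 0}.Finite) :
    M →ₗ[ℝ] (Fin n → ℕ) →₀ M where
  toFun f := Finsupp.ofSupportFinite (fun I => P I f) (hP f)
  map_add' f g := Finsupp.ext fun I => map_add (P I) f g
  map_smul' c f := Finsupp.ext fun I => map_smul (P I) c f

/-- The substitution `ξ ↦ -D`. -/
noncomputable def evalNeg (D : Fin n → Module.End ℝ M) : ((Fin n → ℕ) →₀ M) →ₗ[ℝ] M :=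
  Finsupp.lsum ℝ fun I => opPow (fun i => -D i) I

/-- The substitution `ξ ↦ -D` in the derivative with respect to `ξ_i`. -/
noncomputable def evalNegDeriv (D : Fin n → Module.End ℝ M) (i : Fin n) :
    ((Fin n → ℕ) →₀ M) →ₗ[ℝ] M :=
  Finsupp.lsum ℝ fun I => I i • opPow (fun i => -D i) (I - e i)

variable {hP : ∀ f, {I | P I f ≠ 0}.Finite}

theorem symb_apply (f : M) (I : Fin n → ℕ) : symb P hP f I = P I f := rfl

theorem symb_comm (hPP : ∀ I J, Commute (P I) (P J)) (J : Fin n → ℕ) (f : M) :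
    symb P hP (P J f) = Finsupp.mapRange.linearMap (P J) (symb P hP f) := by
  ext I
  exact DFunLike.congr_fun (hPP I J).eq f

/-- On symbols, D_i acts as D_i + ξ_i: on the coefficients and by raising the exponent. -/
theorem symb_D (hPD : ∀ I i f, P I (D i f) = D i (P I f) + if 1 ≤ I i then P (I - e i) f else 0)
    (i : Fin n) (f : M) : symb P hP (D i f) = Finsupp.mapRange.linearMap (D i) (symb P hP f) +
      Finsupp.mapDomain (· + e i) (symb P hP f) := by
  ext I
  rw [Finsupp.add_apply, symb_apply, hPD]
  congr 1
  split_ifs with h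
  · have := Finsupp.mapDomain_apply (add_left_injective (e i)) (symb P hP f) (I - e i)
    simp only [tsub_add_cancel_of_le (e_le h)] at this
    exact this.symm
  · refine (Finsupp.mapDomain_of_notMem_range _ _ ?_).symm
    rintro ⟨J, rfl⟩
    simp [e] at h

theorem evalNeg_mapRange (hD : ∀ i j, Commute (D i) (D j)) (i : Fin n) (s : (Fin n → ℕ) →₀ M) :
    evalNeg D (Finsupp.mapRange.linearMap (D i) s) = D i (evalNeg D s) := by
  refine DFunLike.congr_fun (f := (evalNeg D).comp (Finsupp.mapRange.linearMap (D i)))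
    (g := LinearMap.comp (D i) (evalNeg D)) (Finsupp.lhom_ext fun I m => ?_) s
  have hc : Commute (-D i) (opPow (fun i => -D i) I) := commute_opPow (commute_neg_neg_of hD) i I
  have := DFunLike.congr_fun hc.eq m
  simp [evalNeg] at this ⊢
  exact this.symm

theorem evalNeg_mapDomain (hD : ∀ i j, Commute (D i) (D j)) (i : Fin n) (s : (Fin n → ℕ) →₀ M) :
    evalNeg D (Finsupp.mapDomain (· + e i) s) = -D i (evalNeg D s) := by
  refine DFunLike.congr_fun
    (f := (evalNeg D).comp (Finsupp.lmapDomain M ℝ (· + e i)))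
    (g := -LinearMap.comp (D i) (evalNeg D)) (Finsupp.lhom_ext fun I m => ?_) s
  simp [evalNeg, opPow_add_e (commute_neg_neg_of hD)]

theorem evalNegDeriv_mapRange (hD : ∀ i j, Commute (D i) (D j)) (i j : Fin n)
    (s : (Fin n → ℕ) →₀ M) : evalNegDeriv D i (Finsupp.mapRange.linearMap (D j) s) =
      D j (evalNegDeriv D i s) := by
  refine DFunLike.congr_fun (f := (evalNegDeriv D i).comp (Finsupp.mapRange.linearMap (D j)))
    (g := LinearMap.comp (D j) (evalNegDeriv D i)) (Finsupp.lhom_ext fun I m => ?_) s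
  have hc : Commute (-D j) (opPow (fun i => -D i) (I - e i)) :=
    commute_opPow (commute_neg_neg_of hD) j _
  have := DFunLike.congr_fun hc.eq m
  simp [evalNegDeriv] at this ⊢
  rw [this]

/-- The product rule ∂_{ξ_i}(ξ_j s) = ξ_j ∂_{ξ_i} s + δ_{ij} s, followed by ξ ↦ -D. -/
theorem evalNegDeriv_mapDomain (hD : ∀ i j, Commute (D i) (D j)) (i j : Fin n)
    (s : (Fin n → ℕ) →₀ M) : evalNegDeriv D i (Finsupp.mapDomain (· + e j) s) =
      -D j (evalNegDeriv D i s) + if i = j then evalNeg D s else 0 := by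
  refine DFunLike.congr_fun
    (f := (evalNegDeriv D i).comp (Finsupp.lmapDomain M ℝ (· + e j)))
    (g := -LinearMap.comp (D j) (evalNegDeriv D i) + if i = j then evalNeg D else 0)
    (Finsupp.lhom_ext fun I m => ?_) s |>.trans ?_
  · by_cases h : i = j
    · subst h
      by_cases hI : 1 ≤ I i
      · have h1 : I = (I - e i) + e i := (tsub_add_cancel_of_le (e_le hI)).symm
        have h2 : opPow (fun i => -D i) I = -D i * opPow (fun i => -D i) (I - e i) := by
          conv_lhs => rw [h1]
          exact opPow_add_e (commute_neg_neg_of hD) _ _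
        have h3 : (e i : Fin n → ℕ) i = 1 := by simp [e]
        simp [evalNegDeriv, evalNeg, h2, h3, add_comm]
      · have h3 : (e i : Fin n → ℕ) i = 1 := by simp [e]
        have h4 : I i = 0 := by omega
        simp [evalNegDeriv, evalNeg, h3, h4]
    · have h3 : (e j : Fin n → ℕ) i = 0 := by simp [e, h]
      by_cases hI : 1 ≤ I i
      · have h1 : I + e j - e i = I - e i + e j := by
          rw [tsub_add_eq_add_tsub (e_le hI)]
        simp [evalNegDeriv, h, h3, h1, opPow_add_e (commute_neg_neg_of hD)]
      · have h4 : I i = 0 := by omega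
        simp [evalNegDeriv, h, h3, h4]
  · split_ifs <;> simp

/-- The Euler operator kills total derivatives because D_i + ξ_i vanishes under ξ ↦ -D. -/
theorem evalNeg_symb_D (hD : ∀ i j, Commute (D i) (D j))
    (hPD : ∀ I i f, P I (D i f) = D i (P I f) + if 1 ≤ I i then P (I - e i) f else 0)
    (i : Fin n) (f : M) : evalNeg D (symb P hP (D i f)) = 0 := by
  rw [symb_D hPD, map_add, evalNeg_mapRange hD, evalNeg_mapDomain hD, add_neg_cancel]

/-- In the ξ_i-derivative of (D_j + ξ_j) s only δ_{ij} s survives the substitution. -/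
theorem evalNegDeriv_symb_D (hD : ∀ i j, Commute (D i) (D j))
    (hPD : ∀ I i f, P I (D i f) = D i (P I f) + if 1 ≤ I i then P (I - e i) f else 0)
    (i j : Fin n) (f : M) : evalNegDeriv D i (symb P hP (D j f)) =
      if i = j then evalNeg D (symb P hP f) else 0 := by
  rw [symb_D hPD, map_add, evalNegDeriv_mapRange hD, evalNegDeriv_mapDomain hD,
    add_neg_cancel_left]

/-- The effect of the first-order part of the adjoint linearization on an Euler--Lagrange
expression. -/
theorem evalNegDeriv_symb_evalNeg (hD : ∀ i j, Commute (D i) (D j))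
    (hPD : ∀ I i f, P I (D i f) = D i (P I f) + if 1 ≤ I i then P (I - e i) f else 0)
    (i : Fin n) (s : (Fin n → ℕ) →₀ M) : evalNegDeriv D i (symb P hP (evalNeg D s)) =
      evalNegDeriv D i (symb P hP (s 0)) - evalNeg D (symb P hP (s (e i))) := by
  refine DFunLike.congr_fun
    (f := ((evalNegDeriv D i).comp (symb P hP)).comp (evalNeg D))
    (g := ((evalNegDeriv D i).comp (symb P hP)).comp (Finsupp.lapply 0) -
      ((evalNeg D).comp (symb P hP)).comp (Finsupp.lapply (e i)))
    (Finsupp.lhom_ext fun I m => ?_) s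
  have he : (e i : Fin n → ℕ) ≠ 0 := fun h => by simpa [e] using congrFun h i
  have h1 : evalNeg D (Finsupp.single I m) = opPow (fun i => -D i) I m := by simp [evalNeg]
  simp only [LinearMap.comp_apply, LinearMap.sub_apply, Finsupp.lapply_apply, h1]
  -- Terms of order zero stay as they are, and a term of order one gives an Euler expression when
  -- its index is i. From order two on the result is the Euler operator applied to a total
  -- derivative, hence zero.
  by_cases h0 : I = 0
  · subst h0
    simp [opPow_zero, he.symm]
  · obtain ⟨j, hj⟩ : ∃ j, 1 ≤ I j := by
      by_contra! h
      exact h0 (funext fun j => Nat.lt_one_iff.1 (h j))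
    obtain ⟨J, rfl⟩ : ∃ J, I = J + e j := ⟨I - e j, (tsub_add_cancel_of_le (e_le hj)).symm⟩
    rw [opPow_add_e (commute_neg_neg_of hD), Finsupp.single_apply, if_neg h0,
      Finsupp.single_apply]
    have h2 : (-D j * opPow (fun i => -D i) J) m = -D j (opPow (fun i => -D i) J m) := rfl
    rw [h2, map_neg, map_neg, evalNegDeriv_symb_D hD hPD]
    by_cases hJ : J = 0
    · subst hJ
      have hij : (e j : Fin n → ℕ) = e i ↔ i = j := by
        constructor
        · intro h
          by_contra hne
          simpa [e, hne] using congrFun h i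
        · rintro rfl; rfl
      by_cases h : i = j
      · simp [h, opPow_zero]
      · simp [h, hij]
    · obtain ⟨l, hl⟩ : ∃ j, 1 ≤ J j := by
        by_contra! h
        exact hJ (funext fun j => Nat.lt_one_iff.1 (h j))
      obtain ⟨K, rfl⟩ : ∃ K, J = K + e l := ⟨J - e l, (tsub_add_cancel_of_le (e_le hl)).symm⟩
      rw [opPow_add_e (commute_neg_neg_of hD)]
      have h3 : (-D l * opPow (fun i => -D i) K) m = -D l (opPow (fun i => -D i) K m) := rfl
      have h4 : K + e l + e j ≠ e i := by
        intro h
        have := congrArg order h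
        simp only [order_add, order_e] at this
        omega
      rw [h3, map_neg, map_neg, evalNeg_symb_D hD hPD, if_neg h4]
      simp

/-- Moving ∂/∂u_i through (-D)^I trades one factor -D_i for -∂/∂u, once for each of the I_i
occurrences; ∂/∂u itself commutes with every D_j. -/
theorem apply_evalNeg (hD : ∀ i j, Commute (D i) (D j))
    (hPD : ∀ I i f, P I (D i f) = D i (P I f) + if 1 ≤ I i then P (I - e i) f else 0)
    (i : Fin n) (s : (Fin n → ℕ) →₀ M) : P (e i) (evalNeg D s) =
      evalNeg D (Finsupp.mapRange.linearMap (P (e i)) s) -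
        evalNegDeriv D i (Finsupp.mapRange.linearMap (P 0) s) := by
  refine DFunLike.congr_fun (f := LinearMap.comp (P (e i)) (evalNeg D))
    (g := (evalNeg D).comp (Finsupp.mapRange.linearMap (P (e i))) -
      (evalNegDeriv D i).comp (Finsupp.mapRange.linearMap (P 0)))
    (Finsupp.lhom_ext fun I m => ?_) s
  have h0 : ∀ j m, P 0 (D j m) = D j (P 0 m) := fun j m => by rw [hPD]; simp
  have hei : ∀ j m, P (e i) (D j m) = D j (P (e i) m) + if i = j then P 0 m else 0 := by
    intro j m
    rw [hPD]
    by_cases h : i = j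
    · subst h; simp [e]
    · simp [e, h, Ne.symm h]
  have hN0 : ∀ I m, P 0 (opPow (fun i => -D i) I m) = opPow (fun i => -D i) I (P 0 m) := by
    intro I
    induction I using multiIdx_induction with
    | h0 => simp [opPow_zero]
    | hs I j ih =>
      intro m
      rw [opPow_add_e (commute_neg_neg_of hD)]
      simp [h0, ih]
  simp only [evalNeg, evalNegDeriv, LinearMap.comp_apply, LinearMap.sub_apply,
    Finsupp.mapRange.linearMap_apply, Finsupp.mapRange_single, Finsupp.lsum_single]
  induction I using multiIdx_induction generalizing m with
  | h0 => simp [opPow_zero]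
  | hs I j ih =>
    rw [opPow_add_e (commute_neg_neg_of hD)]
    have h2 : ∀ m, (-D j * opPow (fun i => -D i) I) m = -D j (opPow (fun i => -D i) I m) :=
      fun _ => rfl
    rw [h2, map_neg, hei, ih, map_sub, h2]
    by_cases h : i = j
    · subst h
      rw [if_pos rfl, hN0]
      have h3 : (e i : Fin n → ℕ) i = 1 := by simp [e]
      by_cases hI : 1 ≤ I i
      · have h1 : I = (I - e i) + e i := (tsub_add_cancel_of_le (e_le hI)).symm
        have h4 : opPow (fun i => -D i) I = -D i * opPow (fun i => -D i) (I - e i) := by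
          conv_lhs => rw [h1]
          exact opPow_add_e (commute_neg_neg_of hD) _ _
        simp only [add_tsub_cancel_right, Pi.add_apply, h3, h4]
        simp [add_smul]
        abel
      · have h5 : I i = 0 := by omega
        simp [h3, h5]
        abel
    · have h3 : (e j : Fin n → ℕ) i = 0 := by simp [e, h]
      by_cases hI : 1 ≤ I i
      · have h1 : I + e j - e i = I - e i + e j := by
          rw [tsub_add_eq_add_tsub (e_le hI)]
        simp [h, h3, h1, opPow_add_e (commute_neg_neg_of hD)]
        abel
      · have h4 : I i = 0 := by omega
        simp [h, h3, h4]

/-- The first-order Helmholtz condition for Euler--Lagrange expressions. -/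
theorem helmholtz_abstract (hD : ∀ i j, Commute (D i) (D j))
    (hPD : ∀ I i f, P I (D i f) = D i (P I f) + if 1 ≤ I i then P (I - e i) f else 0)
    (hPP : ∀ I J, Commute (P I) (P J)) (i : Fin n) (L : M) :
    evalNegDeriv D i (symb P hP (evalNeg D (symb P hP L))) +
      P (e i) (evalNeg D (symb P hP L)) = 0 := by
  -- Applied to the symbol of L, both formulas produce the same two terms, one from ∂L/∂u and one
  -- from ∂L/∂u_i, with opposite signs.
  rw [evalNegDeriv_symb_evalNeg hD hPD, apply_evalNeg hD hPD, ← symb_comm hPP, ← symb_comm hPP,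
    symb_apply, symb_apply]
  abel

end Abstract

end VarIF

/-! ### The algebra of differential functions and its Euler operator. -/

namespace VarIF

variable {n k m : ℕ} {U V : Set (Jet1 n)} {f f' g : Jet n → ℝ} {z v w : Jet n}

/-- The algebra of differential functions over `U`, extended by zero. -/
def diffAlg (U : Set (Jet1 n)) : NonUnitalSubalgebra ℝ (Jet n → ℝ) where
  carrier := {f | IsDifferentialFunction U f ∧ ∀ z, toJet1 z ∉ U → f z = 0}
  add_mem' := by
    rintro f g ⟨⟨k, hk, hf⟩, hf0⟩ ⟨⟨l, hl, hg⟩, hg0⟩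
    refine ⟨⟨max k l, hk.trans (le_max_left _ _), (hf.mono_order hk (le_max_left _ _)).add
      (hg.mono_order hl (le_max_right _ _))⟩, fun z hz => ?_⟩
    rw [Pi.add_apply, hf0 z hz, hg0 z hz, add_zero]
  zero_mem' := ⟨⟨1, le_rfl, smoothOfOrderLE_const le_rfl 0⟩, fun _ _ => rfl⟩
  mul_mem' := by
    rintro f g ⟨⟨k, hk, hf⟩, hf0⟩ ⟨⟨l, hl, hg⟩, hg0⟩
    refine ⟨⟨max k l, hk.trans (le_max_left _ _), (hf.mono_order hk (le_max_left _ _)).mul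
      (hg.mono_order hl (le_max_right _ _))⟩, fun z hz => ?_⟩
    rw [Pi.mul_apply, hf0 z hz, zero_mul]
  smul_mem' := by
    rintro c f ⟨⟨k, hk, hf⟩, hf0⟩
    exact ⟨⟨k, hk, hf.const_mul c⟩, fun z hz => by rw [Pi.smul_apply, hf0 z hz, smul_zero]⟩

theorem diffAlg_isDifferentialFunction (F : diffAlg U) :
    IsDifferentialFunction U (F : Jet n → ℝ) := F.2.1

theorem diffAlg_eq_zero (F : diffAlg U) (hz : toJet1 z ∉ U) : (F : Jet n → ℝ) z = 0 := F.2.2 z hz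

open Classical in
/-- The restriction of a differential function to the jets over `U`. -/
noncomputable def toAlg (hf : IsDifferentialFunction U f) : diffAlg U :=
  ⟨fun z => if toJet1 z ∈ U then f z else 0, by
    obtain ⟨k, hk, hf⟩ := hf
    exact ⟨⟨k, hk, hf.congr hk fun z hz => if_pos hz⟩, fun z hz => if_neg hz⟩⟩

theorem toAlg_apply (hf : IsDifferentialFunction U f) (hz : toJet1 z ∈ U) :
    (toAlg hf : Jet n → ℝ) z = f z := if_pos hz

/-- Extension by zero turns identities valid over U into equalities of algebra elements. -/
theorem diffAlg_ext {F H : diffAlg U}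
    (h : ∀ z, toJet1 z ∈ U → (F : Jet n → ℝ) z = (H : Jet n → ℝ) z) : F = H :=
  Subtype.ext (funext fun z => by
    by_cases hz : toJet1 z ∈ U
    · exact h z hz
    · rw [diffAlg_eq_zero F hz, diffAlg_eq_zero H hz])

theorem IsDifferentialFunction.mono (hf : IsDifferentialFunction U f) (h : V ⊆ U) :
    IsDifferentialFunction V f := by
  obtain ⟨k, hk, hf⟩ := hf
  exact ⟨k, hk, hf.mono h⟩

theorem IsDifferentialFunction.totalDeriv (hf : IsDifferentialFunction U f) (hU : IsOpen U)
    (i : Fin n) : IsDifferentialFunction U (totalDeriv i f) := by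
  obtain ⟨k, hk, hf⟩ := hf
  exact ⟨k + 1, by omega, hf.totalDeriv hU hk i⟩

theorem IsDifferentialFunction.du (hf : IsDifferentialFunction U f) (hU : IsOpen U)
    (I : Fin n → ℕ) : IsDifferentialFunction U (du I f) := by
  obtain ⟨k, hk, hf⟩ := hf
  exact ⟨k, hk, hf.du hU hk I⟩

theorem exists_common_order (hf : IsDifferentialFunction U f) (hg : IsDifferentialFunction U g) :
    ∃ k, 1 ≤ k ∧ SmoothOfOrderLE U k f ∧ SmoothOfOrderLE U k g := by
  obtain ⟨k, hk, hf⟩ := hf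
  obtain ⟨l, hl, hg⟩ := hg
  exact ⟨max k l, hk.trans (le_max_left _ _), hf.mono_order hk (le_max_left _ _),
    hg.mono_order hl (le_max_right _ _)⟩

theorem dirD_add_of (hf : IsDifferentialFunction U f) (hg : IsDifferentialFunction U g)
    (hU : IsOpen U) (hz : toJet1 z ∈ U) (v : Jet n) :
    dirD (f + g) z v = dirD f z v + dirD g z v := by
  obtain ⟨k, hk, hf, hg⟩ := exists_common_order hf hg
  exact hf.dirD_fun_add hg hU hk hz v

theorem dirD_mul_of (hf : IsDifferentialFunction U f) (hg : IsDifferentialFunction U g)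
    (hU : IsOpen U) (hz : toJet1 z ∈ U) (v : Jet n) :
    dirD (f * g) z v = dirD f z v * g z + f z * dirD g z v := by
  obtain ⟨k, hk, hf, hg⟩ := exists_common_order hf hg
  exact hf.dirD_fun_mul hg hU hk hz v

theorem IsDifferentialFunction.totalDeriv_eq (hf : IsDifferentialFunction U f) (hU : IsOpen U)
    (hz : toJet1 z ∈ U) (i : Fin n) : VarIF.totalDeriv i f z = dirD f z (cartan i z) := by
  obtain ⟨k, hk, hf⟩ := hf
  exact hf.totalDeriv_eq hU hk hz i

/-- The total derivative as an endomorphism of the algebra of differential functions. -/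
noncomputable def algD (hU : IsOpen U) (i : Fin n) : Module.End ℝ (diffAlg U) where
  toFun F := toAlg ((diffAlg_isDifferentialFunction F).totalDeriv hU i)
  map_add' F H := diffAlg_ext fun z hz => by
    rw [toAlg_apply _ hz, (diffAlg_isDifferentialFunction (F + H)).totalDeriv_eq hU hz]
    refine (dirD_add_of (diffAlg_isDifferentialFunction F) (diffAlg_isDifferentialFunction H)
      hU hz _).trans ?_
    rw [NonUnitalSubalgebra.coe_add, Pi.add_apply, toAlg_apply _ hz,
      toAlg_apply _ hz, (diffAlg_isDifferentialFunction F).totalDeriv_eq hU hz,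
      (diffAlg_isDifferentialFunction H).totalDeriv_eq hU hz]
  map_smul' c F := diffAlg_ext fun z hz => by
    rw [toAlg_apply _ hz, (diffAlg_isDifferentialFunction (c • F)).totalDeriv_eq hU hz, NonUnitalSubalgebra.coe_smul,
      NonUnitalSubalgebra.coe_smul, Pi.smul_apply, RingHom.id_apply, toAlg_apply _ hz,
      (diffAlg_isDifferentialFunction F).totalDeriv_eq hU hz]
    exact dirD_fun_const_mul c _ z _

/-- The derivative `∂/∂u_I` as an endomorphism of the algebra of differential functions. -/
noncomputable def algP (hU : IsOpen U) (I : Fin n → ℕ) : Module.End ℝ (diffAlg U) where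
  toFun F := toAlg ((diffAlg_isDifferentialFunction F).du hU I)
  map_add' F H := diffAlg_ext fun z hz => by
    rw [toAlg_apply _ hz, du_eq_dirD]
    refine (dirD_add_of (diffAlg_isDifferentialFunction F) (diffAlg_isDifferentialFunction H)
      hU hz _).trans ?_
    rw [NonUnitalSubalgebra.coe_add, Pi.add_apply, toAlg_apply _ hz,
      toAlg_apply _ hz, du_eq_dirD, du_eq_dirD]
  map_smul' c F := diffAlg_ext fun z hz => by
    rw [toAlg_apply _ hz, du_eq_dirD, NonUnitalSubalgebra.coe_smul,
      NonUnitalSubalgebra.coe_smul, Pi.smul_apply, RingHom.id_apply, toAlg_apply _ hz,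
      du_eq_dirD]
    exact dirD_fun_const_mul c _ z _

theorem algD_apply (hU : IsOpen U) (i : Fin n) (F : diffAlg U) (hz : toJet1 z ∈ U) :
    (algD hU i F : Jet n → ℝ) z = totalDeriv i F z :=
  toAlg_apply ((diffAlg_isDifferentialFunction F).totalDeriv hU i) hz

theorem algP_apply (hU : IsOpen U) (I : Fin n → ℕ) (F : diffAlg U) (hz : toJet1 z ∈ U) :
    (algP hU I F : Jet n → ℝ) z = du I F z :=
  toAlg_apply ((diffAlg_isDifferentialFunction F).du hU I) hz

theorem algD_of_eq (hU : IsOpen U) (i : Fin n) (F : diffAlg U)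
    (h : ∀ z, toJet1 z ∈ U → (F : Jet n → ℝ) z = f z) (hz : toJet1 z ∈ U) :
    (algD hU i F : Jet n → ℝ) z = totalDeriv i f z := by
  rw [algD_apply hU i F hz]
  obtain ⟨k, hk, hF⟩ := (diffAlg_isDifferentialFunction F)
  exact (hF.totalDeriv_congr hU hk (fun z hz => (h z hz).symm) hz i).symm

theorem algP_of_eq (hU : IsOpen U) (I : Fin n → ℕ) (F : diffAlg U)
    (h : ∀ z, toJet1 z ∈ U → (F : Jet n → ℝ) z = f z) (hz : toJet1 z ∈ U) :
    (algP hU I F : Jet n → ℝ) z = du I f z := by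
  rw [algP_apply hU I F hz, du_congr hU h hz]

theorem algD_comm (hU : IsOpen U) (i j : Fin n) : Commute (algD hU i) (algD hU j) := by
  refine LinearMap.ext fun F => diffAlg_ext fun z hz => ?_
  obtain ⟨k, hk, hF⟩ := (diffAlg_isDifferentialFunction F)
  have h : ∀ i j, ((algD hU i * algD hU j) F : Jet n → ℝ) z =
      totalDeriv i (totalDeriv j F) z := fun i j =>
    algD_of_eq hU i _ (fun z hz => algD_apply hU j F hz) hz
  rw [h, h, hF.totalDeriv_comm hU hk hz]

theorem algP_comm (hU : IsOpen U) (I J : Fin n → ℕ) : Commute (algP hU I) (algP hU J) := by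
  refine LinearMap.ext fun F => diffAlg_ext fun z hz => ?_
  obtain ⟨k, hk, hF⟩ := (diffAlg_isDifferentialFunction F)
  have h : ∀ i j, ((algP hU i * algP hU j) F : Jet n → ℝ) z =
      du i (du j F) z := fun i j =>
    algP_of_eq hU i _ (fun z hz => algP_apply hU j F hz) hz
  rw [h, h, hF.du_comm hU hk hz]

theorem algP_algD (hU : IsOpen U) (I : Fin n → ℕ) (i : Fin n) (F : diffAlg U) :
    algP hU I (algD hU i F) =
      algD hU i (algP hU I F) + if 1 ≤ I i then algP hU (I - e i) F else 0 := by
  refine diffAlg_ext fun z hz => ?_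
  obtain ⟨k, hk, hF⟩ := (diffAlg_isDifferentialFunction F)
  rw [algP_of_eq hU I _ (fun z hz => algD_apply hU i F hz) hz, NonUnitalSubalgebra.coe_add,
    Pi.add_apply, algD_of_eq hU i _ (fun z hz => algP_apply hU I F hz) hz,
    hF.du_totalDeriv hU hk hz]
  congr 1
  split_ifs
  · rw [algP_apply hU _ F hz]
  · rfl

theorem algP_finite (hU : IsOpen U) (F : diffAlg U) : {I | algP hU I F ≠ 0}.Finite := by
  obtain ⟨k, hk, hF⟩ := (diffAlg_isDifferentialFunction F)
  refine (multiIdx n k).finite_toSet.subset fun I hI => ?_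
  by_contra h
  refine hI (diffAlg_ext fun z hz => ?_)
  rw [algP_apply hU _ F hz, hF.du_eq_zero hU hk hz (by simpa [mem_multiIdx] using h)]
  rfl

theorem algD_mul (hU : IsOpen U) (i : Fin n) (F H : diffAlg U) :
    algD hU i (F * H) = algD hU i F * H + F * algD hU i H := by
  refine diffAlg_ext fun z hz => ?_
  rw [algD_apply hU i _ hz, (diffAlg_isDifferentialFunction (F * H)).totalDeriv_eq hU hz, NonUnitalSubalgebra.coe_mul,
    dirD_mul_of (diffAlg_isDifferentialFunction F) (diffAlg_isDifferentialFunction H) hU hz, NonUnitalSubalgebra.coe_add, Pi.add_apply,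
    NonUnitalSubalgebra.coe_mul, NonUnitalSubalgebra.coe_mul, Pi.mul_apply, Pi.mul_apply,
    algD_apply hU i _ hz, algD_apply hU i _ hz, (diffAlg_isDifferentialFunction F).totalDeriv_eq hU hz,
    (diffAlg_isDifferentialFunction H).totalDeriv_eq hU hz]

theorem algP_mul (hU : IsOpen U) (I : Fin n → ℕ) (F H : diffAlg U) :
    algP hU I (F * H) = algP hU I F * H + F * algP hU I H := by
  refine diffAlg_ext fun z hz => ?_
  rw [algP_apply hU I _ hz, du_eq_dirD, NonUnitalSubalgebra.coe_mul,
    dirD_mul_of (diffAlg_isDifferentialFunction F) (diffAlg_isDifferentialFunction H) hU hz, NonUnitalSubalgebra.coe_add, Pi.add_apply,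
    NonUnitalSubalgebra.coe_mul, NonUnitalSubalgebra.coe_mul, Pi.mul_apply, Pi.mul_apply,
    algP_apply hU I _ hz, algP_apply hU I _ hz, du_eq_dirD, du_eq_dirD]

theorem opPow_algD_of_eq (hU : IsOpen U) (I : Fin n → ℕ) (F : diffAlg U)
    (h : ∀ z, toJet1 z ∈ U → (F : Jet n → ℝ) z = f z) (hz : toJet1 z ∈ U) :
    (opPow (algD hU) I F : Jet n → ℝ) z = iterD I f z := by
  have hpow : ∀ (i : Fin n) (m : ℕ) (F : diffAlg U) (f : Jet n → ℝ),
      (∀ z, toJet1 z ∈ U → (F : Jet n → ℝ) z = f z) → ∀ z, toJet1 z ∈ U →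
      ((algD hU i ^ m) F : Jet n → ℝ) z = (totalDeriv i)^[m] f z := by
    intro i m F f h
    induction m with
    | zero => simpa using h
    | succ m ih =>
      intro z hz
      rw [pow_succ', Function.iterate_succ_apply']
      exact algD_of_eq hU i _ ih hz
  have hlist : ∀ (l : List (Fin n)) (z : Jet n), toJet1 z ∈ U →
      ((l.map fun i => algD hU i ^ I i).prod F : Jet n → ℝ) z =
        l.foldr (fun i g => (totalDeriv i)^[I i] g) f z := by
    intro l
    induction l with
    | nil => exact h
    | cons i l ih =>
      intro z hz
      rw [List.map_cons, List.prod_cons, List.foldr_cons]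
      exact hpow i (I i) _ _ ih z hz
  exact hlist _ z hz

theorem iterD_zero (f : Jet n → ℝ) : iterD 0 f = f := by
  have : ∀ l : List (Fin n),
      l.foldr (fun i g => (totalDeriv i)^[(0 : Fin n → ℕ) i] g) f = f := by
    intro l
    induction l with
    | nil => rfl
    | cons i l _ => simp
  exact this _

theorem IsDifferentialFunction.iterD_add_e (hf : IsDifferentialFunction U f) (hU : IsOpen U)
    (hz : toJet1 z ∈ U) (I : Fin n → ℕ) (i : Fin n) :
    VarIF.iterD (I + e i) f z = VarIF.totalDeriv i (VarIF.iterD I f) z := by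
  have h := fun z (hz : toJet1 z ∈ U) => toAlg_apply hf hz
  rw [← opPow_algD_of_eq hU (I + e i) _ h hz, opPow_add_e (algD_comm hU)]
  exact algD_of_eq hU i _ (fun z hz => opPow_algD_of_eq hU I _ h hz) hz

/-- Evaluation at a jet. -/
def evalAt (U : Set (Jet1 n)) (z : Jet n) : diffAlg U →ₗ[ℝ] ℝ where
  toFun F := (F : Jet n → ℝ) z
  map_add' _ _ := rfl
  map_smul' _ _ := rfl

/-- The Euler--Lagrange operator on the algebra of differential functions. -/
noncomputable def algE (hU : IsOpen U) (F : diffAlg U) : diffAlg U :=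
  evalNeg (algD hU) (symb (algP hU) (algP_finite hU) F)

theorem algE_apply (hU : IsOpen U) (F : diffAlg U)
    (h : ∀ z, toJet1 z ∈ U → (F : Jet n → ℝ) z = f z) (hz : toJet1 z ∈ U) :
    (algE hU F : Jet n → ℝ) z = euler f z := by
  have key : ∀ I, evalAt U z (opPow (fun i => -algD hU i) I (algP hU I F)) =
      (-1) ^ order I * iterD I (du I f) z := by
    intro I
    rw [opPow_neg_apply (algD_comm hU), map_smul, smul_eq_mul,
      ← opPow_algD_of_eq hU I (algP hU I F) (fun z hz => algP_of_eq hU I F h hz) hz]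
    rfl
  change evalAt U z (algE hU F) = _
  rw [algE, evalNeg, Finsupp.lsum_apply, Finsupp.sum, map_sum, euler]
  refine ((finsum_eq_sum_of_support_subset _ fun I hI => ?_).trans
    (Finset.sum_congr rfl fun I _ => (key I).symm)).symm
  by_contra h0
  have h0 : algP hU I F = 0 := by simpa [symb_apply] using h0
  refine hI ?_
  simp only [← key, h0, map_zero]

theorem exists_algE_eq (hU : IsOpen U) (h : IsEulerLagrange U f) (F : diffAlg U)
    (hF : ∀ z, toJet1 z ∈ U → (F : Jet n → ℝ) z = f z) : ∃ L, algE hU L = F := by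
  obtain ⟨L, hL, hL'⟩ := h
  exact ⟨toAlg hL, diffAlg_ext fun z hz => by
    rw [algE_apply hU _ (fun z hz => toAlg_apply hL hz) hz, hL' z hz, hF z hz]⟩

theorem helmholtz (hU : IsOpen U) (h : IsEulerLagrange U f) (F : diffAlg U)
    (hF : ∀ z, toJet1 z ∈ U → (F : Jet n → ℝ) z = f z) (i : Fin n) :
    evalNegDeriv (algD hU) i (symb (algP hU) (algP_finite hU) F) + algP hU (e i) F = 0 := by
  obtain ⟨L, rfl⟩ := exists_algE_eq hU h F hF
  exact helmholtz_abstract (algD_comm hU) (algP_algD hU) (algP_comm hU) i L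

/-- Substitution I = J + e_i; indices with I_i = 0 have weight zero. -/
theorem sum_multiIdx_succ {M : Type*} [AddCommMonoid M] (i : Fin n) (g : (Fin n → ℕ) → M) :
    ∑ I ∈ multiIdx n (k + 1), I i • g I = ∑ J ∈ multiIdx n k, (J i + 1) • g (J + e i) := by
  have h1 : (multiIdx n k).image (· + e i) ⊆ multiIdx n (k + 1) := by
    intro I hI
    obtain ⟨J, hJ, rfl⟩ := Finset.mem_image.1 hI
    rw [mem_multiIdx] at hJ ⊢
    rw [order_add, order_e]
    omega
  rw [← Finset.sum_subset h1, Finset.sum_image fun a _ b _ h => add_right_cancel h]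
  · simp [e]
  · intro I hI hI'
    by_cases h : 1 ≤ I i
    · have h2 : I - e i + e i = I := tsub_add_cancel_of_le (e_le h)
      refine absurd ?_ hI'
      rw [← h2]
      refine Finset.mem_image_of_mem (· + e i) ?_
      rw [← h2, mem_multiIdx, order_add, order_e] at hI
      rw [mem_multiIdx]
      omega
    · rw [Nat.lt_one_iff.1 (not_le.1 h), zero_smul]

theorem e_ne_zero (i : Fin n) : (e i : Fin n → ℕ) ≠ 0 := fun h => by
  simpa [e] using congrFun h i

theorem e_injective : Function.Injective (e : Fin n → Fin n → ℕ) := by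
  intro i j h
  by_contra hne
  simpa [e, hne] using congrFun h i

theorem mem_multiIdx_one {I : Fin n → ℕ} : I ∈ multiIdx n 1 ↔ I = 0 ∨ ∃ j, e j = I := by
  rw [mem_multiIdx]
  constructor
  · intro hI
    by_cases h0 : I = 0
    · exact Or.inl h0
    · obtain ⟨j, hj⟩ : ∃ j, 1 ≤ I j := by
        by_contra! h
        exact h0 (funext fun j => Nat.lt_one_iff.1 (h j))
      refine Or.inr ⟨j, ?_⟩
      have h1 := tsub_add_cancel_of_le (e_le hj)
      rw [← h1, order_add, order_e] at hI
      have h2 : I - e j = 0 := funext fun a =>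
        (Finset.sum_eq_zero_iff.1 (show order (I - e j) = 0 by omega)) a (Finset.mem_univ a)
      rw [h2, zero_add] at h1
      exact h1
  · rintro (rfl | ⟨j, rfl⟩)
    · simp [order_zero]
    · simp [order_e]

theorem sum_multiIdx_one {M : Type*} [AddCommMonoid M] (g : (Fin n → ℕ) → M) :
    ∑ I ∈ multiIdx n 1, g I = g 0 + ∑ j, g (e j) := by
  have h : multiIdx n 1 = insert 0 (Finset.univ.image e) := by
    ext I
    simp [mem_multiIdx_one]
  rw [h, Finset.sum_insert, Finset.sum_image fun _ _ _ _ h => e_injective h]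
  simp [e_ne_zero]

/-- The coefficient `1 + δ_{ij}`. -/
def symCoeff (i j : Fin n) : ℕ := e j i + 1

/-- Euler's relation |I| g_I = Σ_i I_i g_I with |I| = 2, reindexed by I = J + e_i. The weight 1 +
δ_{ij} is J_i + 1 at J = e_j. -/
theorem sum_order_two (g : (Fin n → ℕ) → ℝ) (h0 : g 0 = 0) (h1 : ∀ i, g (e i) = 0) :
    2 * ∑ I ∈ multiIdx n 2, g I = ∑ i, ∑ j, symCoeff i j * g (e j + e i) := by
  have h : ∀ I ∈ multiIdx n 2, 2 * g I = ∑ i, I i • g I := by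
    intro I hI
    rw [← Finset.sum_smul, nsmul_eq_mul]
    have hI := mem_multiIdx.1 hI
    change 2 * g I = (order I : ℝ) * g I
    by_cases h2 : order I = 2
    · rw [h2]; norm_num
    · have h3 : g I = 0 := by
        rcases mem_multiIdx_one.1 (mem_multiIdx.2 (show order I ≤ 1 by omega)) with rfl | ⟨j, rfl⟩
        · exact h0
        · exact h1 j
      rw [h3]; simp
  rw [Finset.mul_sum, Finset.sum_congr rfl h, Finset.sum_comm]
  refine Finset.sum_congr rfl fun i _ => ?_
  rw [sum_multiIdx_succ, sum_multiIdx_one]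
  simp [h1, symCoeff]

theorem evalNegDeriv_of_order_two {M : Type*} [AddCommGroup M] [Module ℝ M]
    (D : Fin n → Module.End ℝ M) (hD : ∀ i j, Commute (D i) (D j)) (s : (Fin n → ℕ) →₀ M)
    (hs : ∀ I, 2 < order I → s I = 0)
    (i : Fin n) : evalNegDeriv D i s = s (e i) - ∑ j, symCoeff i j • D j (s (e j + e i)) := by
  have h1 : evalNegDeriv D i s =
      ∑ I ∈ multiIdx n 2, I i • opPow (fun i => -D i) (I - e i) (s I) := by
    rw [evalNegDeriv, Finsupp.lsum_apply, Finsupp.sum]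
    refine Finset.sum_subset (fun I hI => ?_) fun I _ hI => ?_
    · rw [mem_multiIdx]
      by_contra! h
      exact (Finsupp.mem_support_iff.1 hI) (hs I h)
    · rw [Finsupp.notMem_support_iff.1 hI, map_zero]
  rw [h1, sum_multiIdx_succ i (fun I => opPow (fun i => -D i) (I - e i) (s I)), sum_multiIdx_one]
  have h2 : ∀ j, opPow (fun i => -D i) (e j) = -D j := fun j => by
    have := opPow_add_e (commute_neg_neg_of hD) 0 j
    rwa [zero_add, opPow_zero, mul_one] at this
  simp [h2, opPow_zero, symCoeff, sub_eq_add_neg]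

end VarIF

/-! ### Helmholtz conditions for quasilinear second-order expressions. -/

namespace VarIF

variable {n k m : ℕ} {U V : Set (Jet1 n)} {f f' g : Jet n → ℝ} {z v w : Jet n}

/-- The first-order jet `q`, completed to a jet by zeros. -/
noncomputable def ofJet1 (q : Jet1 n) : Jet n :=
  (q.1, fun I => (if I = 0 then q.2.1 else 0) + ∑ i, if I = e i then q.2.2 i else 0)

theorem toJet1_ofJet1 (q : Jet1 n) : toJet1 (ofJet1 q) = q := by
  refine Prod.ext rfl (Prod.ext ?_ (funext fun i => ?_))
  · simp [toJet1, ofJet1, (e_ne_zero _).symm]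
  · simp [toJet1, ofJet1, e_ne_zero, e_injective.eq_iff]

theorem ofJet1_apply_of_lt (q : Jet1 n) {I : Fin n → ℕ} (hI : 1 < order I) :
    (ofJet1 q).2 I = 0 := by
  have h0 : I ≠ 0 := by rintro rfl; simp [order_zero] at hI
  have h1 : ∀ i, I ≠ e i := by rintro i rfl; simp [order_e] at hI
  simp [ofJet1, h0, h1]

theorem toJet1_add (z v : Jet n) : toJet1 (z + v) = toJet1 z + toJet1 v := rfl

theorem toJet1_smul (c : ℝ) (v : Jet n) : toJet1 (c • v) = c • toJet1 v := rfl

theorem toJet1_eq_zero (hx : v.1 = 0) (h : ∀ I, order I ≤ 1 → v.2 I = 0) : toJet1 v = 0 :=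
  (toJet1_congr (z' := 0) hx h).trans rfl

theorem toJet1_vert {I : Fin n → ℕ} (hI : 1 < order I) : toJet1 (vert I) = 0 :=
  toJet1_eq_zero rfl fun J hJ => by
    have : J ≠ I := by rintro rfl; omega
    simp [vert, this]

theorem dirD_toJet1_comp {A : Jet1 n → ℝ} (hA : ContDiffOn ℝ ∞ A U) (hU : IsOpen U)
    (hz : toJet1 z ∈ U) (v : Jet n) :
    dirD (fun z => A (toJet1 z)) z v = fderiv ℝ A (toJet1 z) (toJet1 v) := by
  have h1 : HasFDerivAt A (fderiv ℝ A (toJet1 z)) (toJet1 (z + (0 : ℝ) • v)) := by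
    rw [zero_smul, add_zero]
    exact ((hA.contDiffAt (hU.mem_nhds hz)).differentiableAt (by simp)).hasFDerivAt
  exact (h1.comp_hasDerivAt (0 : ℝ) (hasVelocity_line z v 0).toJet1).deriv

/-- `G = ∑ A^{ij} u_{ij} + B` over `U`, with smooth coefficients and a symmetric matrix `A`. -/
structure IsSymmQuasilinear (U : Set (Jet1 n)) (A : Fin n → Fin n → Jet1 n → ℝ) (B : Jet1 n → ℝ)
    (G : Jet n → ℝ) : Prop where
  smooth_A : ∀ i j, ContDiffOn ℝ ∞ (A i j) U
  smooth_B : ContDiffOn ℝ ∞ B U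
  symm : ∀ i j, A i j = A j i
  eq : ∀ z, toJet1 z ∈ U →
    G z = ∑ i, ∑ j, A i j (toJet1 z) * z.2 (e i + e j) + B (toJet1 z)

theorem IsQuasilinearSecondOrder.exists_symm {G : Jet n → ℝ} (h : IsQuasilinearSecondOrder U G) :
    ∃ A B, IsSymmQuasilinear U A B G := by
  obtain ⟨A, B, hA, hB, hG⟩ := h
  refine ⟨fun i j q => 2⁻¹ * (A i j q + A j i q), B,
    fun i j => contDiffOn_const.mul ((hA i j).add (hA j i)), hB,
    fun i j => funext fun q => by rw [add_comm], fun z hz => ?_⟩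
  rw [hG z hz]
  congr 1
  have h : ∑ i, ∑ j, A j i (toJet1 z) * z.2 (e i + e j) =
      ∑ i, ∑ j, A i j (toJet1 z) * z.2 (e i + e j) := by
    rw [Finset.sum_comm]
    simp only [add_comm]
  simp only [mul_add, add_mul, Finset.sum_add_distrib, mul_assoc, ← Finset.mul_sum, h]
  ring

variable {A : Fin n → Fin n → Jet1 n → ℝ} {B : Jet1 n → ℝ} {G : Jet n → ℝ}

theorem IsSymmQuasilinear.mono (hG : IsSymmQuasilinear U A B G) (h : V ⊆ U) :
    IsSymmQuasilinear V A B G :=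
  ⟨fun i j => (hG.smooth_A i j).mono h, hG.smooth_B.mono h, hG.symm, fun z hz => hG.eq z (h hz)⟩

theorem order_e_add_e (i j : Fin n) : order (e i + e j) = 2 := by
  rw [order_add, order_e, order_e]

theorem IsSymmQuasilinear.smooth (hG : IsSymmQuasilinear U A B G) : SmoothOfOrderLE U 2 G := by
  refine SmoothOfOrderLE.congr (by norm_num) (SmoothOfOrderLE.add (k := 2)
    (SmoothOfOrderLE.sum _ fun i _ => SmoothOfOrderLE.sum _ fun j _ =>
    SmoothOfOrderLE.mul (.toJet1_comp (hG.smooth_A i j) (by norm_num))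
    (smoothOfOrderLE_coord (order_e_add_e i j).le)) (.toJet1_comp hG.smooth_B (by norm_num))) hG.eq

theorem IsSymmQuasilinear.dirD_eq (hG : IsSymmQuasilinear U A B G) (hU : IsOpen U)
    (hz : toJet1 z ∈ U) (v : Jet n) :
    dirD G z v = ∑ i, ∑ j, (fderiv ℝ (A i j) (toJet1 z) (toJet1 v) * z.2 (e i + e j) +
      A i j (toJet1 z) * v.2 (e i + e j)) + fderiv ℝ B (toJet1 z) (toJet1 v) := by
  have hA : ∀ i j, SmoothOfOrderLE U 2 fun z => A i j (toJet1 z) := fun i j =>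
    .toJet1_comp (hG.smooth_A i j) (by norm_num)
  have hm : ∀ i j, SmoothOfOrderLE U 2 fun z => A i j (toJet1 z) * z.2 (e i + e j) := fun i j =>
    (hA i j).mul (smoothOfOrderLE_coord (order_e_add_e i j).le)
  have hs : ∀ i, SmoothOfOrderLE U 2 fun z => ∑ j, A i j (toJet1 z) * z.2 (e i + e j) := fun i =>
    SmoothOfOrderLE.sum _ fun j _ => hm i j
  rw [dirD_congr hU hG.eq hz, SmoothOfOrderLE.dirD_fun_add (k := 2)
    (SmoothOfOrderLE.sum _ fun i _ => hs i) (.toJet1_comp hG.smooth_B (by norm_num)) hU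
    (by norm_num) hz, dirD_toJet1_comp hG.smooth_B hU hz,
    dirD_fun_sum hU (k := 2) (by norm_num) hz _ fun i _ => hs i]
  congr 1
  refine Finset.sum_congr rfl fun i _ => ?_
  rw [dirD_fun_sum hU (k := 2) (by norm_num) hz _ fun j _ => hm i j]
  refine Finset.sum_congr rfl fun j _ => ?_
  rw [(hA i j).dirD_fun_mul (smoothOfOrderLE_coord (order_e_add_e i j).le) hU (by norm_num) hz,
    dirD_toJet1_comp (hG.smooth_A i j) hU hz, dirD_coord]

theorem symCoeff_mul_ite (a b i j : Fin n) : (symCoeff a b : ℝ) *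
      (if e i + e j = (e b + e a : Fin n → ℕ) then 1 else 0) =
    (if i = a ∧ j = b then 1 else 0) + if i = b ∧ j = a then 1 else 0 := by
  have h : (e i + e j = (e b + e a : Fin n → ℕ)) ↔ (i = a ∧ j = b) ∨ (i = b ∧ j = a) := by
    constructor
    · intro h
      by_cases hi : i = a
      · subst hi
        rw [add_comm (e b)] at h
        exact Or.inl ⟨rfl, e_injective (add_left_cancel h)⟩
      · by_cases hi' : i = b
        · subst hi'
          exact Or.inr ⟨rfl, e_injective (add_left_cancel h)⟩
        · have := congrFun h i
          simp [e, hi, hi'] at this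
    · rintro (⟨rfl, rfl⟩ | ⟨rfl, rfl⟩)
      · exact add_comm _ _
      · rfl
  have hc : (symCoeff a b : ℝ) = if a = b then 2 else 1 := by
    by_cases hab : a = b
    · subst hab; norm_num [symCoeff, e]
    · simp [symCoeff, e, hab]
  simp only [h, hc]
  by_cases hab : a = b
  · subst hab
    by_cases hi : i = a ∧ j = a <;> simp [hi]
    norm_num
  · by_cases h1 : i = a ∧ j = b
    · obtain ⟨rfl, rfl⟩ := h1
      simp [hab]
    · simp [hab, h1]

theorem vert_apply_e_add_e (a b i j : Fin n) : (symCoeff a b : ℝ) *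
      (vert (e b + e a) : Jet n).2 (e i + e j) =
    (if i = a ∧ j = b then 1 else 0) + if i = b ∧ j = a then 1 else 0 := by
  rw [← symCoeff_mul_ite]
  simp only [vert, Pi.single_apply]

theorem symCoeff_mul_sum_vert (c : Fin n → Fin n → ℝ) (a b : Fin n) :
    symCoeff a b * ∑ i, ∑ j, c i j * (vert (e b + e a) : Jet n).2 (e i + e j) =
      c a b + c b a := by
  simp only [Finset.mul_sum, mul_left_comm (symCoeff a b : ℝ),
    vert_apply_e_add_e, mul_add, mul_ite, mul_one, mul_zero, Finset.sum_add_distrib, ite_and]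
  simp only [Finset.sum_ite_irrel, Finset.sum_ite_eq', Finset.mem_univ, if_true,
    Finset.sum_const_zero]

/-- The coordinate u_{ab} occurs twice in the double sum if a ≠ b and once if a = b; the weight 1 +
δ_{ab} evens this out. -/
theorem IsSymmQuasilinear.symCoeff_mul_du (hG : IsSymmQuasilinear U A B G) (hU : IsOpen U)
    (hz : toJet1 z ∈ U) (a b : Fin n) :
    symCoeff a b * du (e b + e a) G z = 2 * A a b (toJet1 z) := by
  rw [du_eq_dirD, hG.dirD_eq hU hz, toJet1_vert (by rw [order_e_add_e]; norm_num)]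
  simp only [map_zero, zero_mul, zero_add, add_zero]
  rw [symCoeff_mul_sum_vert, hG.symm b a]
  ring

/-- The first-order Helmholtz condition for second-order expressions. -/
theorem helmholtz_order_two (hU : IsOpen U) (h : IsEulerLagrange U f) (hf : SmoothOfOrderLE U 2 f)
    (hz : toJet1 z ∈ U) (i : Fin n) :
    2 * du (e i) f z = ∑ j, symCoeff i j * totalDeriv j (du (e j + e i) f) z := by
  have hd : IsDifferentialFunction U f := ⟨2, by norm_num, hf⟩
  have hF : ∀ z, toJet1 z ∈ U → (toAlg hd : Jet n → ℝ) z = f z := fun _ => toAlg_apply hd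
  have h1 := helmholtz hU h (toAlg hd) hF i
  rw [evalNegDeriv_of_order_two _ (algD_comm hU)] at h1
  · have h2 := congrArg (evalAt U z) h1
    have h3 : ∀ I, evalAt U z (algP hU I (toAlg hd)) = du I f z := fun I => algP_of_eq hU I _ hF hz
    have h4 : ∀ j I, evalAt U z (algD hU j (algP hU I (toAlg hd))) = totalDeriv j (du I f) z :=
      fun j I => algD_of_eq hU j _ (fun z hz => algP_of_eq hU I _ hF hz) hz
    simp only [symb_apply, map_add, map_sub, map_sum, map_nsmul, h3, h4, map_zero,
      nsmul_eq_mul] at h2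
    linarith
  · intro I hI
    refine diffAlg_ext fun z hz => ?_
    rw [symb_apply, algP_of_eq hU I _ hF hz, hf.du_eq_zero hU (by norm_num) hz hI]
    rfl

theorem IsSymmQuasilinear.du_e_eq (hG : IsSymmQuasilinear U A B G) (hU : IsOpen U)
    (h : IsEulerLagrange U G) (hz : toJet1 z ∈ U) (i : Fin n) :
    du (e i) G z = ∑ j, totalDeriv j (fun z => A i j (toJet1 z)) z := by
  have h1 := helmholtz_order_two hU h hG.smooth hz i
  have h2 : ∀ j, symCoeff i j * totalDeriv j (du (e j + e i) G) z =
      2 * totalDeriv j (fun z => A i j (toJet1 z)) z := by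
    intro j
    have hA : SmoothOfOrderLE U 2 fun z => A i j (toJet1 z) :=
      .toJet1_comp (hG.smooth_A i j) (by norm_num)
    rw [(hG.smooth.du hU (by norm_num) _).totalDeriv_eq hU (by norm_num) hz,
      hA.totalDeriv_eq hU (by norm_num) hz, ← dirD_fun_const_mul, ← dirD_fun_const_mul]
    exact dirD_congr hU (fun z hz => hG.symCoeff_mul_du hU hz i j) hz _
  rw [Finset.sum_congr rfl fun j _ => h2 j, ← Finset.mul_sum] at h1
  linarith

theorem toJet1_vert_e (i : Fin n) : toJet1 (vert (e i)) = (0, 0, Pi.single i 1) := by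
  refine Prod.ext rfl (Prod.ext ?_ (funext fun j => ?_))
  · simp [toJet1, vert, (e_ne_zero i).symm]
  · simp [toJet1, vert, Pi.single_apply, e_injective.eq_iff]

theorem toJet1_cartan (i : Fin n) (z : Jet n) :
    toJet1 (cartan i z) = (Pi.single i 1, z.2 (e i), fun j => z.2 (e j + e i)) := by
  refine Prod.ext rfl (Prod.ext ?_ rfl)
  simp [toJet1, cartan]

theorem totalDeriv_toJet1_comp {A : Jet1 n → ℝ} (hA : ContDiffOn ℝ ∞ A U) (hU : IsOpen U)
    (hz : toJet1 z ∈ U) (i : Fin n) : totalDeriv i (fun z => A (toJet1 z)) z =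
      fderiv ℝ A (toJet1 z) (Pi.single i 1, z.2 (e i), fun j => z.2 (e j + e i)) := by
  rw [(SmoothOfOrderLE.toJet1_comp hA le_rfl).totalDeriv_eq hU le_rfl hz,
    dirD_toJet1_comp hA hU hz, toJet1_cartan]

theorem IsSymmQuasilinear.helmholtz_eq (hG : IsSymmQuasilinear U A B G) (hU : IsOpen U)
    (h : IsEulerLagrange U G) (hz : toJet1 z ∈ U) (i : Fin n) :
    ∑ k, ∑ l, fderiv ℝ (A k l) (toJet1 z) (0, 0, Pi.single i 1) * z.2 (e k + e l) +
        fderiv ℝ B (toJet1 z) (0, 0, Pi.single i 1) =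
      ∑ j, fderiv ℝ (A i j) (toJet1 z) (Pi.single j 1, z.2 (e j), fun l => z.2 (e l + e j)) := by
  have h1 := hG.du_e_eq hU h hz i
  have h2 : ∀ k l : Fin n, (vert (e i) : Jet n).2 (e k + e l) = 0 := by
    intro k l
    have : (e k + e l : Fin n → ℕ) ≠ e i := fun h => by
      have := congrArg order h
      rw [order_e_add_e, order_e] at this
      omega
    simp [vert, this]
  rw [du_eq_dirD, hG.dirD_eq hU hz, toJet1_vert_e] at h1
  simp only [h2, mul_zero, add_zero] at h1
  rw [h1]
  exact Finset.sum_congr rfl fun j _ => totalDeriv_toJet1_comp (hG.smooth_A i j) hU hz j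

/-- The part of the Helmholtz condition free of second-order coordinates, obtained at the jet over q
whose coordinates of order above one are zero. -/
theorem IsSymmQuasilinear.fderiv_B (hG : IsSymmQuasilinear U A B G) (hU : IsOpen U)
    (h : IsEulerLagrange U G) {q : Jet1 n} (hq : q ∈ U) (i : Fin n) :
    fderiv ℝ B q (0, 0, Pi.single i 1) =
      ∑ j, fderiv ℝ (A i j) q (Pi.single j 1, q.2.2 j, 0) := by
  have h1 := hG.helmholtz_eq hU h (z := ofJet1 q) (by rwa [toJet1_ofJet1]) i
  have h2 : ∀ k l : Fin n, (ofJet1 q).2 (e k + e l) = 0 := fun k l =>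
    ofJet1_apply_of_lt q (by rw [order_e_add_e]; norm_num)
  have h3 : ∀ j, (ofJet1 q).2 (e j) = q.2.2 j := fun j => by
    conv_rhs => rw [← toJet1_ofJet1 q]
    rfl
  rw [toJet1_ofJet1] at h1
  simp only [h2, h3, mul_zero, Finset.sum_const_zero, zero_add] at h1
  exact h1

theorem clm_apply_split (T : Jet1 n →L[ℝ] ℝ) (x : Fin n → ℝ) (u : ℝ) (p : Fin n → ℝ) :
    T (x, u, p) = T (x, u, 0) + ∑ l, T (0, 0, Pi.single l 1) * p l := by
  simp only [mul_comm (T _), ← smul_eq_mul, ← map_smul, ← map_sum, ← map_add]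
  congr 1
  refine Prod.ext ?_ (Prod.ext ?_ ?_)
  · simp [Prod.fst_sum]
  · simp [Prod.fst_sum, Prod.snd_sum]
  · simp only [Prod.snd_add, Prod.snd_sum, Prod.smul_snd, zero_add]
    exact pi_eq_sum_univ' _

/-- The part of the Helmholtz condition linear in the second-order coordinates, isolated by
switching on the single coordinate u_{ab}. This symmetry is what makes the rows of -A closed
one-forms in p. -/
theorem IsSymmQuasilinear.fderiv_A (hG : IsSymmQuasilinear U A B G) (hU : IsOpen U)
    (h : IsEulerLagrange U G) {q : Jet1 n} (hq : q ∈ U) (i a b : Fin n) :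
    fderiv ℝ (A a b) q (0, 0, Pi.single i 1) = fderiv ℝ (A i b) q (0, 0, Pi.single a 1) := by
  have key : ∀ i a b : Fin n, 2 * fderiv ℝ (A a b) q (0, 0, Pi.single i 1) =
      fderiv ℝ (A i b) q (0, 0, Pi.single a 1) + fderiv ℝ (A i a) q (0, 0, Pi.single b 1) := by
    intro i a b
    have h2 : ∀ k l : Fin n, (ofJet1 q).2 (e k + e l) = 0 := fun k l =>
      ofJet1_apply_of_lt q (by rw [order_e_add_e]; norm_num)
    have h3 : ∀ j, (ofJet1 q).2 (e j) = q.2.2 j := fun j => by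
      conv_rhs => rw [← toJet1_ofJet1 q]
      rfl
    have h4 : ∀ j, (vert (e b + e a) : Jet n).2 (e j) = 0 := fun j => by
      have := congrArg (fun q : Jet1 n => q.2.2 j)
        (toJet1_vert (I := e b + e a) (by rw [order_e_add_e]; norm_num))
      exact this
    have h5 : toJet1 (ofJet1 q + vert (e b + e a)) = q := by
      rw [toJet1_add, toJet1_ofJet1, toJet1_vert (by rw [order_e_add_e]; norm_num), add_zero]
    have h1 := hG.helmholtz_eq hU h (z := ofJet1 q + vert (e b + e a)) (by rwa [h5]) i
    rw [h5, hG.fderiv_B hU h hq] at h1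
    simp only [Prod.snd_add, Pi.add_apply, h2, h3, h4, zero_add, add_zero] at h1
    have h6 : ∀ j, fderiv ℝ (A i j) q (Pi.single j 1, q.2.2 j,
          fun l => (vert (e b + e a) : Jet n).2 (e l + e j)) =
        fderiv ℝ (A i j) q (Pi.single j 1, q.2.2 j, 0) +
          ∑ l, fderiv ℝ (A i j) q (0, 0, Pi.single l 1) *
            (vert (e b + e a) : Jet n).2 (e j + e l) := by
      intro j
      rw [clm_apply_split]
      simp only [add_comm (e j)]
    simp only [h6, Finset.sum_add_distrib] at h1
    rw [add_comm] at h1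
    have h7 := congrArg (fun t : ℝ => symCoeff a b * t) (add_left_cancel h1)
    simp only [symCoeff_mul_sum_vert] at h7
    rw [hG.symm b a] at h7
    linarith
  -- With x, y the two sides of the goal and w the third derivative, 2x = y + w and 2y = x + w, so x
  -- = y.
  have h1 := key i a b
  have h2 := key a i b
  rw [hG.symm a i] at h2
  linarith

end VarIF

/-! ### Integrating factors on formal solutions. -/

namespace VarIF

variable {n k m : ℕ} {U V : Set (Jet1 n)} {f f' g : Jet n → ℝ} {z v w : Jet n}
  {A : Fin n → Fin n → Jet1 n → ℝ} {B : Jet1 n → ℝ} {G W : Jet n → ℝ}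

section FormalSolutions

/-- The differential functions all of whose total derivatives vanish at the jet `z`. -/
noncomputable def formalIdeal (hU : IsOpen U) (z : Jet n) : Submodule ℝ (diffAlg U) where
  carrier := {F | ∀ J, evalAt U z (opPow (algD hU) J F) = 0}
  add_mem' h1 h2 J := by rw [map_add, map_add, h1 J, h2 J, add_zero]
  zero_mem' J := by rw [map_zero, map_zero]
  smul_mem' c F h J := by rw [map_smul, map_smul, h J, smul_zero]

theorem eval_eq_zero_of_mem_formalIdeal {hU : IsOpen U} {F : diffAlg U}
    (h : F ∈ formalIdeal hU z) : evalAt U z F = 0 := by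
  have := h 0
  rwa [opPow_zero] at this

theorem algD_mem_formalIdeal {hU : IsOpen U} {F : diffAlg U} (h : F ∈ formalIdeal hU z)
    (i : Fin n) : algD hU i F ∈ formalIdeal hU z := by
  intro J
  have h1 := h (J + e i)
  rwa [opPow_add_e (algD_comm hU), (commute_opPow (algD_comm hU) i J).eq] at h1

/-- Both factors vary in the induction, since the Leibniz rule differentiates either one. -/
theorem mul_mem_formalIdeal {hU : IsOpen U} {F : diffAlg U} (H : diffAlg U)
    (h : F ∈ formalIdeal hU z) : H * F ∈ formalIdeal hU z := by
  intro J
  induction J using multiIdx_induction generalizing F H with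
  | h0 =>
    have := eval_eq_zero_of_mem_formalIdeal h
    rw [opPow_zero]
    change (H : Jet n → ℝ) z * (F : Jet n → ℝ) z = 0
    change (F : Jet n → ℝ) z = 0 at this
    rw [this, mul_zero]
  | hs J i ih =>
    rw [opPow_add_e (algD_comm hU), (commute_opPow (algD_comm hU) i J).eq, Module.End.mul_apply,
      algD_mul, map_add, map_add, ih _ h, ih _ (algD_mem_formalIdeal h i), add_zero]

theorem opPow_neg_mem_formalIdeal {hU : IsOpen U} {F : diffAlg U} (h : F ∈ formalIdeal hU z)
    (I : Fin n → ℕ) : opPow (fun i => -algD hU i) I F ∈ formalIdeal hU z := by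
  induction I using multiIdx_induction with
  | h0 => rwa [opPow_zero]
  | hs I i ih =>
    rw [opPow_add_e (commute_neg_neg_of (algD_comm hU))]
    exact Submodule.neg_mem _ (algD_mem_formalIdeal ih i)

theorem IsFormalSolution.mem_formalIdeal (hU : IsOpen U) (hz : toJet1 z ∈ U)
    (h : IsFormalSolution f z) (F : diffAlg U)
    (hF : ∀ z, toJet1 z ∈ U → (F : Jet n → ℝ) z = f z) : F ∈ formalIdeal hU z :=
  fun J => (opPow_algD_of_eq hU J F hF hz).trans (h J)

/-- On formal solutions of `G = 0`, the contraction of `A` with the total gradient of a variational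
integrating factor vanishes. -/
theorem IsSymmQuasilinear.sum_mul_totalDeriv_eq_zero (hG : IsSymmQuasilinear U A B G)
    (hU : IsOpen U) (hEL : IsEulerLagrange U G) (hW : IsDifferentialFunction U W)
    (hWG : IsEulerLagrange U fun z => W z * G z) (hz : toJet1 z ∈ U) (hs : IsFormalSolution G z)
    (i : Fin n) : ∑ j, A i j (toJet1 z) * totalDeriv j W z = 0 := by
  have hGd : IsDifferentialFunction U G := ⟨2, by norm_num, hG.smooth⟩
  set G' : diffAlg U := toAlg hGd with hG'
  set W' : diffAlg U := toAlg hW with hW'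
  have hG'z : ∀ z, toJet1 z ∈ U → (G' : Jet n → ℝ) z = G z := fun _ => toAlg_apply hGd
  have hW'z : ∀ z, toJet1 z ∈ U → (W' : Jet n → ℝ) z = W z := fun _ => toAlg_apply hW
  have hmem := hs.mem_formalIdeal hU hz G' hG'z
  have h1 := helmholtz hU hWG (W' * G') (fun z hz => by
    change (W' : Jet n → ℝ) z * (G' : Jet n → ℝ) z = _
    rw [hW'z z hz, hG'z z hz]) i
  -- Leibniz rule for ∂(WG)/∂u_I. The summand with the undifferentiated factor G vanishes on formal
  -- solutions even after further total derivatives.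
  have hsymb : symb (algP hU) (algP_finite hU) (W' * G') =
      Finsupp.mapRange.linearMap (LinearMap.mulLeft ℝ W') (symb (algP hU) (algP_finite hU) G') +
      Finsupp.mapRange.linearMap (LinearMap.mulRight ℝ G')
        (symb (algP hU) (algP_finite hU) W') := by
    ext1 I
    exact (algP_mul hU I W' G').trans (add_comm _ _)
  have h2 : evalNegDeriv (algD hU) i (Finsupp.mapRange.linearMap (LinearMap.mulRight ℝ G')
      (symb (algP hU) (algP_finite hU) W')) ∈ formalIdeal hU z := by
    rw [evalNegDeriv, Finsupp.lsum_apply]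
    refine Submodule.sum_mem _ fun I _ => ?_
    exact Submodule.smul_of_tower_mem _ (I i) (opPow_neg_mem_formalIdeal (mul_mem_formalIdeal _ hmem) _)
  have hfG : ∀ I, (algP hU I G' : Jet n → ℝ) z = du I G z := fun I => algP_of_eq hU I _ hG'z hz
  have hfDG : ∀ j I, (algD hU j (algP hU I G') : Jet n → ℝ) z = totalDeriv j (du I G) z :=
    fun j I => algD_of_eq hU j _ (fun z hz => algP_of_eq hU I _ hG'z hz) hz
  have hfDW : ∀ j, (algD hU j W' : Jet n → ℝ) z = totalDeriv j W z :=
    fun j => algD_of_eq hU j _ hW'z hz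
  have hG0 : (G' : Jet n → ℝ) z = 0 := eval_eq_zero_of_mem_formalIdeal hmem
  rw [hsymb, map_add, evalNegDeriv_of_order_two _ (algD_comm hU), algP_mul] at h1
  · have h3 := congrArg (evalAt U z) h1
    rw [map_add, map_add, eval_eq_zero_of_mem_formalIdeal h2, map_sub, map_sum, map_zero] at h3
    simp only [map_nsmul, Finsupp.mapRange.linearMap_apply, Finsupp.mapRange_apply, symb_apply,
      LinearMap.mulLeft_apply, algD_mul, map_add] at h3
    have hev : ∀ F H : diffAlg U, evalAt U z (F * H) =
        (F : Jet n → ℝ) z * (H : Jet n → ℝ) z := fun _ _ => rfl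
    simp only [hev, hfG, hfDG, hfDW, hG0, hW'z z hz, mul_zero, zero_add, add_zero,
      nsmul_eq_mul] at h3
    have h4 := helmholtz_order_two hU hEL hG.smooth hz i
    -- The Helmholtz condition for G itself removes every term in which D_j does not fall on W.
    have h5 : ∑ j, (symCoeff i j : ℝ) * (totalDeriv j W z * du (e j + e i) G z +
        W z * totalDeriv j (du (e j + e i) G) z) =
        2 * ∑ j, A i j (toJet1 z) * totalDeriv j W z + W z * (2 * du (e i) G z) := by
      rw [h4, Finset.mul_sum, Finset.mul_sum, ← Finset.sum_add_distrib]
      refine Finset.sum_congr rfl fun j _ => ?_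
      have := hG.symCoeff_mul_du hU hz i j
      linear_combination totalDeriv j W z * this
    rw [h5] at h3
    linarith
  · intro I hI
    refine diffAlg_ext fun z hz => ?_
    change (W' : Jet n → ℝ) z * (algP hU I G' : Jet n → ℝ) z = 0
    rw [algP_of_eq hU I _ hG'z hz, hG.smooth.du_eq_zero hU (by norm_num) hz hI, mul_zero]

end FormalSolutions

/-! ### First-order Lagrangians and their Hessian. -/

section FirstOrder

variable {L : Jet1 n → ℝ}

theorem contDiffOn_fderiv_apply (hL : ContDiffOn ℝ ∞ L V) (hV : IsOpen V) (v : Jet1 n) :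
    ContDiffOn ℝ ∞ (fun q => fderiv ℝ L q v) V :=
  (hL.fderiv_of_isOpen hV (by simp)).clm_apply contDiffOn_const

theorem du_toJet1_comp (hL : ContDiffOn ℝ ∞ L V) (hV : IsOpen V) (hz : toJet1 z ∈ V)
    (I : Fin n → ℕ) :
    du I (fun z => L (toJet1 z)) z = fderiv ℝ L (toJet1 z) (toJet1 (vert I)) := by
  rw [du_eq_dirD, dirD_toJet1_comp hL hV hz]

theorem toJet1_vert_zero : toJet1 (vert 0 : Jet n) = (0, 1, 0) := by
  refine Prod.ext rfl (Prod.ext ?_ (funext fun j => ?_))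
  · simp [toJet1, vert]
  · simp [toJet1, vert, e_ne_zero]

theorem euler_toJet1_comp (hL : ContDiffOn ℝ ∞ L V) (hV : IsOpen V) (hz : toJet1 z ∈ V) :
    euler (fun z => L (toJet1 z)) z = fderiv ℝ L (toJet1 z) (0, 1, 0) -
      ∑ j, fderiv ℝ (fun q => fderiv ℝ L q (0, 0, Pi.single j 1)) (toJet1 z)
        (Pi.single j 1, z.2 (e j), fun l => z.2 (e l + e j)) := by
  have hs : SmoothOfOrderLE V 1 fun z => L (toJet1 z) := .toJet1_comp hL le_rfl
  have h1 : euler (fun z => L (toJet1 z)) z = ∑ I ∈ multiIdx n 1,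
      (-1) ^ order I * iterD I (du I fun z => L (toJet1 z)) z := by
    refine finsum_eq_sum_of_support_subset _ fun I hI => ?_
    by_contra h
    have h0 : ∀ z, toJet1 z ∈ V → ((0 : diffAlg V) : Jet n → ℝ) z =
        du I (fun z => L (toJet1 z)) z := fun z hz =>
      (hs.du_eq_zero hV le_rfl hz (by simpa [mem_multiIdx] using h)).symm
    refine hI ?_
    have h2 := opPow_algD_of_eq hV I 0 h0 hz
    rw [map_zero] at h2
    simp only [← h2, NonUnitalSubalgebra.coe_zero, Pi.zero_apply, mul_zero]
  rw [h1, sum_multiIdx_one, iterD_zero, order_zero, pow_zero, one_mul, du_toJet1_comp hL hV hz,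
    toJet1_vert_zero, sub_eq_add_neg, ← Finset.sum_neg_distrib]
  congr 1
  refine Finset.sum_congr rfl fun j _ => ?_
  have hd : IsDifferentialFunction V (du (e j) fun z => L (toJet1 z)) :=
    ⟨1, le_rfl, hs.du hV le_rfl _⟩
  have h2 := hd.iterD_add_e hV hz 0 j
  rw [zero_add, iterD_zero] at h2
  have hj := contDiffOn_fderiv_apply hL hV (0, 0, Pi.single j 1)
  rw [order_e, pow_one, neg_one_mul, h2, ← totalDeriv_toJet1_comp hj hV hz]
  congr 1
  refine (SmoothOfOrderLE.toJet1_comp hj le_rfl).totalDeriv_congr hV le_rfl (fun z hz => ?_) hz j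
  rw [du_toJet1_comp hL hV hz, toJet1_vert_e]

theorem euler_toJet1_comp_eq (hL : ContDiffOn ℝ ∞ L V) (hV : IsOpen V) (hz : toJet1 z ∈ V) :
    euler (fun z => L (toJet1 z)) z = fderiv ℝ L (toJet1 z) (0, 1, 0) -
      ∑ j, fderiv ℝ (fun q => fderiv ℝ L q (0, 0, Pi.single j 1)) (toJet1 z)
        (Pi.single j 1, (toJet1 z).2.2 j, 0) -
      ∑ j, ∑ l, fderiv ℝ (fun q => fderiv ℝ L q (0, 0, Pi.single j 1)) (toJet1 z)
        (0, 0, Pi.single l 1) * z.2 (e j + e l) := by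
  rw [euler_toJet1_comp hL hV hz, sub_sub, ← Finset.sum_add_distrib]
  congr 1
  refine Finset.sum_congr rfl fun j _ => ?_
  rw [clm_apply_split]
  simp only [add_comm (e j)]
  rfl

theorem dp_eq_fderiv (hL : ContDiffOn ℝ ∞ L V) (hV : IsOpen V) {q : Jet1 n} (hq : q ∈ V)
    (i : Fin n) : dp i L q = fderiv ℝ L q (0, 0, Pi.single i 1) := by
  have h1 : HasFDerivAt L (fderiv ℝ L q)
      (q.1, q.2.1, Function.update q.2.2 i (q.2.2 i)) := by
    rw [Function.update_eq_self]
    exact ((hL.contDiffAt (hV.mem_nhds hq)).differentiableAt (by simp)).hasFDerivAt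
  have h2 : HasDerivAt (fun t : ℝ => ((q.1, q.2.1, Function.update q.2.2 i t) : Jet1 n))
      (0, 0, Pi.single i 1) (q.2.2 i) :=
    (hasDerivAt_const _ _).prodMk ((hasDerivAt_const _ _).prodMk (hasDerivAt_update _ _ _))
  exact (h1.comp_hasDerivAt _ h2).deriv

theorem hessian_apply (hL : ContDiffOn ℝ ∞ L V) (hV : IsOpen V) {q : Jet1 n} (hq : q ∈ V)
    (i j : Fin n) : hessian L q i j =
      fderiv ℝ (fun q => fderiv ℝ L q (0, 0, Pi.single j 1)) q (0, 0, Pi.single i 1) := by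
  have hj := contDiffOn_fderiv_apply hL hV (0, 0, Pi.single j 1)
  have hd : ContDiffOn ℝ ∞ (dp j L) V := hj.congr fun q hq => dp_eq_fderiv hL hV hq j
  rw [hessian, Matrix.of_apply, dp_eq_fderiv hd hV hq]
  congr 1
  refine Filter.EventuallyEq.fderiv_eq ?_
  filter_upwards [hV.mem_nhds hq] with q hq using dp_eq_fderiv hL hV hq j

theorem hessian_symm (hL : ContDiffOn ℝ ∞ L V) (hV : IsOpen V) {q : Jet1 n} (hq : q ∈ V)
    (i j : Fin n) : hessian L q i j = hessian L q j i := by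
  rw [hessian_apply hL hV hq, hessian_apply hL hV hq]
  have hc := hL.contDiffAt (hV.mem_nhds hq)
  have hs : IsSymmSndFDerivAt ℝ L q := hc.isSymmSndFDerivAt
    (by rw [minSmoothness_of_isRCLikeNormedField]; exact WithTop.coe_le_coe.2 le_top)
  have hd : DifferentiableAt ℝ (fderiv ℝ L) q :=
    (hc.fderiv_right (m := ∞) (by simp)).differentiableAt (by simp)
  have h : ∀ v w : Jet1 n, fderiv ℝ (fun q => fderiv ℝ L q v) q w =
      fderiv ℝ (fderiv ℝ L) q w v := by
    intro v w
    rw [fderiv_clm_apply hd (differentiableAt_const v)]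
    simp
  rw [h, h, hs.eq]

/-- E_u(L) contains the second-order coordinates with coefficients -L_{u_i u_j}. Subtracting its
values at two jets over q that differ only in u_{ab} isolates one coefficient. -/
theorem IsFirstOrderLagrangian.hessian_eq (hL : IsFirstOrderLagrangian V L G) (hV : IsOpen V)
    (hG : IsSymmQuasilinear V A B G) {q : Jet1 n} (hq : q ∈ V) (a b : Fin n) :
    hessian L q a b = -A a b q := by
  have h2 : ∀ k l : Fin n, (ofJet1 q).2 (e k + e l) = 0 := fun k l =>
    ofJet1_apply_of_lt q (by rw [order_e_add_e]; norm_num)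
  have h5 : toJet1 (ofJet1 q + vert (e b + e a)) = q := by
    rw [toJet1_add, toJet1_ofJet1, toJet1_vert (by rw [order_e_add_e]; norm_num), add_zero]
  have e1 := hL.2 (ofJet1 q) (by rwa [toJet1_ofJet1])
  have e2 := hL.2 (ofJet1 q + vert (e b + e a)) (by rwa [h5])
  rw [euler_toJet1_comp_eq hL.1 hV (by rwa [toJet1_ofJet1]), hG.eq _ (by rwa [toJet1_ofJet1]),
    toJet1_ofJet1] at e1
  rw [euler_toJet1_comp_eq hL.1 hV (by rwa [h5]), hG.eq _ (by rwa [h5]), h5] at e2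
  simp only [Prod.snd_add, Pi.add_apply, h2, zero_add, mul_zero, Finset.sum_const_zero] at e1 e2
  have e3 : ∑ j, ∑ l, fderiv ℝ (fun q => fderiv ℝ L q (0, 0, Pi.single j 1)) q
        (0, 0, Pi.single l 1) * (vert (e b + e a) : Jet n).2 (e j + e l) =
      ∑ j, ∑ l, hessian L q j l * (vert (e b + e a) : Jet n).2 (e j + e l) := by
    refine Finset.sum_congr rfl fun j _ => Finset.sum_congr rfl fun l _ => ?_
    rw [hessian_symm hL.1 hV hq, hessian_apply hL.1 hV hq]
  rw [e3] at e2
  have e4 : ∑ j, ∑ l, hessian L q j l * (vert (e b + e a) : Jet n).2 (e j + e l) =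
    -∑ j, ∑ l, A j l q * (vert (e b + e a) : Jet n).2 (e j + e l) := by linarith
  have e5 := congrArg (fun t : ℝ => symCoeff a b * t) e4
  simp only [mul_neg, symCoeff_mul_sum_vert] at e5
  have e6 := symCoeff_mul_sum_vert (fun j l => hessian L q j l) a b
  rw [hessian_symm hL.1 hV hq b a, e5, hG.symm b a] at e6
  linarith

theorem isFirstOrderLagrangian_of (hV : IsOpen V) (hG : IsSymmQuasilinear V A B G)
    (hL : ContDiffOn ℝ ∞ L V)
    (h1 : ∀ q ∈ V, ∀ j l, fderiv ℝ (fun q => fderiv ℝ L q (0, 0, Pi.single j 1)) q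
      (0, 0, Pi.single l 1) = -A j l q)
    (h2 : ∀ q ∈ V, fderiv ℝ L q (0, 1, 0) -
      ∑ j, fderiv ℝ (fun q => fderiv ℝ L q (0, 0, Pi.single j 1)) q (Pi.single j 1, q.2.2 j, 0) =
        B q) : IsFirstOrderLagrangian V L G := by
  refine ⟨hL, fun z hz => ?_⟩
  rw [euler_toJet1_comp_eq hL hV hz, hG.eq z hz, ← h2 _ hz]
  simp only [h1 _ hz, neg_mul, Finset.sum_neg_distrib]
  ring

end FirstOrder

end VarIF

/-! ### A Poincaré lemma along fibres, smooth in parameters. -/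

namespace VarIF

section ParametricIntegral

variable {E F : Type} [NormedAddCommGroup E] [NormedSpace ℝ E] [NormedAddCommGroup F]
  [NormedSpace ℝ F] {f : E × ℝ → F} {S : Set (E × ℝ)} {Ω : Set E}

open MeasureTheory

theorem continuousOn_slice {E F : Type*} [TopologicalSpace E] [TopologicalSpace F]
    {f : E × ℝ → F} {S : Set (E × ℝ)} (hf : ContinuousOn f S) {x : E}
    (hx : ∀ t ∈ Set.Icc (0 : ℝ) 1, (x, t) ∈ S) :
    ContinuousOn (fun t => f (x, t)) (Set.Icc 0 1) :=
  hf.comp (by fun_prop) hx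

theorem hasFDerivAt_integral_param (hS : IsOpen S) (hf : ContDiffOn ℝ 1 f S) {x : E}
    (hx : ∀ t ∈ Set.Icc (0 : ℝ) 1, (x, t) ∈ S) :
    HasFDerivAt (fun x => ∫ t in (0 : ℝ)..1, f (x, t))
      (∫ t in (0 : ℝ)..1, (fderiv ℝ f (x, t)).comp (ContinuousLinearMap.inl ℝ E ℝ)) x := by
  set f1 : E × ℝ → E →L[ℝ] F := fun y => (fderiv ℝ f y).comp (ContinuousLinearMap.inl ℝ E ℝ)
    with hf1
  have hf1c : ContinuousOn f1 S :=
    (hf.continuousOn_fderiv_of_isOpen hS le_rfl).clm_comp continuousOn_const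
  have hIoc : Set.uIoc (0 : ℝ) 1 ⊆ Set.Icc 0 1 := by
    rw [Set.uIoc_of_le zero_le_one]
    exact Set.Ioc_subset_Icc_self
  obtain ⟨M, hM⟩ := (isCompact_Icc (a := (0 : ℝ)) (b := 1)).exists_bound_of_continuousOn
    (continuousOn_slice hf1c hx)
  -- Compactness of [0, 1] makes both conditions hold for all t on a single neighbourhood of x. The
  -- bound M + 1 instead of M leaves room for a strict, hence open, inequality.
  have hev : ∀ᶠ y in nhds x, ∀ t ∈ Set.Icc (0 : ℝ) 1, (y, t) ∈ S ∧ ‖f1 (y, t)‖ < M + 1 := by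
    refine isCompact_Icc.eventually_forall_of_forall_eventually fun t ht => ?_
    refine (hS.eventually_mem (hx t ht)).and ?_
    have hc : ContinuousAt f1 (x, t) := hf1c.continuousAt (hS.mem_nhds (hx t ht))
    exact hc.norm.eventually_lt continuousAt_const (by linarith [hM t ht])
  have hmeas : ∀ {F' : Type} [NormedAddCommGroup F'] {g : ℝ → F'},
      ContinuousOn g (Set.Icc 0 1) →
      AEStronglyMeasurable g (volume.restrict (Set.uIoc (0 : ℝ) 1)) := fun hg =>
    (hg.aestronglyMeasurable_of_isCompact isCompact_Icc measurableSet_Icc).mono_measure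
      (Measure.restrict_mono hIoc le_rfl)
  refine intervalIntegral.hasFDerivAt_integral_of_dominated_of_fderiv_le (F := fun x t => f (x, t))
    (F' := fun x t => f1 (x, t)) (bound := fun _ => M + 1) hev ?_ ?_ ?_ ?_ ?_ ?_
  · filter_upwards [hev] with y hy
    exact hmeas (continuousOn_slice hf.continuousOn fun t ht => (hy t ht).1)
  · refine ContinuousOn.intervalIntegrable ?_
    rw [Set.uIcc_of_le zero_le_one]
    exact continuousOn_slice hf.continuousOn hx
  · exact hmeas (continuousOn_slice hf1c hx)
  · exact .of_forall fun t ht y hy => (hy t (hIoc ht)).2.le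
  · exact intervalIntegrable_const
  · refine .of_forall fun t ht y hy => ?_
    have hd : HasFDerivAt f (fderiv ℝ f (y, t)) (y, t) :=
      ((hf.contDiffAt (hS.mem_nhds (hy t (hIoc ht)).1)).differentiableAt one_ne_zero).hasFDerivAt
    exact hd.comp y (hasFDerivAt_prodMk_left y t)

/-- The induction runs over all target spaces, because the derivative is again a parametric
integral, with values in linear maps. -/
theorem contDiffOn_integral_param_nat (m : ℕ) : ∀ {F : Type} [NormedAddCommGroup F]
    [NormedSpace ℝ F] {f : E × ℝ → F}, IsOpen S → ContDiffOn ℝ ∞ f S → IsOpen Ω →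
    (∀ x ∈ Ω, ∀ t ∈ Set.Icc (0 : ℝ) 1, (x, t) ∈ S) →
    ContDiffOn ℝ m (fun x => ∫ t in (0 : ℝ)..1, f (x, t)) Ω := by
  induction m with
  | zero =>
    intro F _ _ f hS hf hΩ hx
    refine contDiffOn_zero.2 fun x hxΩ => ?_
    exact (hasFDerivAt_integral_param hS (hf.of_le (by simp))
      (hx x hxΩ)).continuousAt.continuousWithinAt
  | succ m ih =>
    intro F _ _ f hS hf hΩ hx
    have hd : ∀ x ∈ Ω, HasFDerivAt (fun x => ∫ t in (0 : ℝ)..1, f (x, t)) _ x := fun x hxΩ =>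
      hasFDerivAt_integral_param hS (hf.of_le (by simp)) (hx x hxΩ)
    rw [Nat.cast_succ, contDiffOn_succ_iff_fderiv_of_isOpen hΩ]
    refine ⟨fun x hxΩ => (hd x hxΩ).differentiableAt.differentiableWithinAt, by simp, ?_⟩
    have h1 : ContDiffOn ℝ ∞
        (fun y => (fderiv ℝ f y).comp (ContinuousLinearMap.inl ℝ E ℝ)) S :=
      (hf.fderiv_of_isOpen hS (by simp)).clm_comp contDiffOn_const
    exact (ih hS h1 hΩ hx).congr fun x hxΩ => (hd x hxΩ).fderiv

/-- Smoothness of integrals depending on a parameter. -/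
theorem contDiffOn_integral_param (hS : IsOpen S) (hf : ContDiffOn ℝ ∞ f S) (hΩ : IsOpen Ω)
    (hx : ∀ x ∈ Ω, ∀ t ∈ Set.Icc (0 : ℝ) 1, (x, t) ∈ S) :
    ContDiffOn ℝ ∞ (fun x => ∫ t in (0 : ℝ)..1, f (x, t)) Ω :=
  contDiffOn_infty.2 fun m => contDiffOn_integral_param_nat m hS hf hΩ hx

/-- To be compared with `hasDerivAt_fiber_space`: the two derivatives differ only in the order of
the arguments of θ', and closedness allows that exchange. -/
theorem hasDerivAt_fiber_time {R : E →L[ℝ] E} {b q v : E} {t : ℝ} {θ : E → E →L[ℝ] ℝ}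
    {θ' : E →L[ℝ] E →L[ℝ] ℝ} (hθ : HasFDerivAt θ θ' (q - (1 - t) • R (q - b))) :
    HasDerivAt (fun t : ℝ => t * θ (q - (1 - t) • R (q - b)) v)
      (θ (q - (1 - t) • R (q - b)) v + t * θ' (R (q - b)) v) t := by
  have h1 : HasDerivAt (fun s : ℝ => q - (1 - s) • R (q - b)) (R (q - b)) t := by
    have := (((hasDerivAt_id t).const_sub 1).smul_const (R (q - b))).const_sub q
    simpa using this
  have h2 : HasDerivAt (fun s : ℝ => θ (q - (1 - s) • R (q - b))) (θ' (R (q - b))) t :=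
    HasFDerivAt.comp_hasDerivAt (f := fun s : ℝ => q - (1 - s) • R (q - b)) t hθ h1
  have h3 := (hasDerivAt_id t).fun_mul (h2.clm_apply (hasDerivAt_const t v))
  simpa using h3

theorem hasDerivAt_fiber_space {R : E →L[ℝ] E} {b q v : E} {t : ℝ} {θ : E → E →L[ℝ] ℝ}
    {θ' : E →L[ℝ] E →L[ℝ] ℝ} (hθ : HasFDerivAt θ θ' (q - (1 - t) • R (q - b))) (hv : R v = v) :
    HasDerivAt (fun s : ℝ => θ (q + s • v - (1 - t) • R (q + s • v - b)) (R (q + s • v - b)))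
      (θ (q - (1 - t) • R (q - b)) v + t * θ' v (R (q - b))) 0 := by
  have e0 : ∀ s : ℝ, R (q + s • v - b) = R (q - b) + s • v := by
    intro s
    rw [add_sub_right_comm, map_add, map_smul, hv]
  have h1 : HasDerivAt (fun s : ℝ => q + s • v - (1 - t) • R (q + s • v - b)) (t • v) 0 := by
    have e1 : (fun s : ℝ => q + s • v - (1 - t) • R (q + s • v - b)) =
        fun s : ℝ => q - (1 - t) • R (q - b) + s • (t • v) := by
      funext s
      rw [e0]
      module
    rw [e1]
    simpa using ((hasDerivAt_id (0 : ℝ)).smul_const (t • v)).const_add (q - (1 - t) • R (q - b))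
  have h2 : HasDerivAt (fun s : ℝ => R (q + s • v - b)) v 0 := by
    simp only [e0]
    simpa using ((hasDerivAt_id (0 : ℝ)).smul_const v).const_add (R (q - b))
  have h3 : HasDerivAt (fun s : ℝ => θ (q + s • v - (1 - t) • R (q + s • v - b)))
      (θ' (t • v)) 0 :=
    HasFDerivAt.comp_hasDerivAt (f := fun s : ℝ => q + s • v - (1 - t) • R (q + s • v - b))
      (0 : ℝ) (by simpa using hθ) h1
  have h4 := h3.clm_apply h2
  simpa [add_comm] using h4

/-- A Poincaré lemma along the fibres of a linear projection, smooth in the parameters. -/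
theorem exists_fiber_primitive (hΩ : IsOpen Ω) (R : E →L[ℝ] E) (b : E) {θ : E → E →L[ℝ] ℝ}
    (hθ : ContDiffOn ℝ ∞ θ Ω) (hR : ∀ v, R (R v) = R v)
    (hstar : ∀ q ∈ Ω, ∀ t ∈ Set.Icc (0 : ℝ) 1, q - (1 - t) • R (q - b) ∈ Ω)
    (hcl : ∀ q ∈ Ω, ∀ v w, R v = v → R w = w → fderiv ℝ θ q v w = fderiv ℝ θ q w v) :
    ∃ M : E → ℝ, ContDiffOn ℝ ∞ M Ω ∧ ∀ q ∈ Ω, ∀ v, R v = v → fderiv ℝ M q v = θ q v := by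
  have hhs : ContDiff ℝ ∞ fun y : E × ℝ => y.1 - (1 - y.2) • R (y.1 - b) := by fun_prop
  obtain ⟨S, hS⟩ : ∃ S, S = (fun y : E × ℝ => y.1 - (1 - y.2) • R (y.1 - b)) ⁻¹' Ω := ⟨_, rfl⟩
  -- The integrand of the homotopy formula. The path runs inside the fibre from q - R(q - b) at t =
  -- 0 to q at t = 1.
  obtain ⟨f, hf⟩ : ∃ f : E × ℝ → ℝ,
      f = fun y => θ (y.1 - (1 - y.2) • R (y.1 - b)) (R (y.1 - b)) := ⟨_, rfl⟩
  have hSo : IsOpen S := hS ▸ hΩ.preimage hhs.continuous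
  have hfs : ContDiffOn ℝ ∞ f S := by
    have h1 : ContDiffOn ℝ ∞ (fun y : E × ℝ => θ (y.1 - (1 - y.2) • R (y.1 - b))) S :=
      hθ.comp hhs.contDiffOn fun _ hy => by rwa [hS] at hy
    rw [hf]
    exact h1.clm_apply (by fun_prop)
  have hΩS : ∀ q ∈ Ω, ∀ t ∈ Set.Icc (0 : ℝ) 1, (q, t) ∈ S := fun q hq t ht => by
    rw [hS]
    exact hstar q hq t ht
  refine ⟨fun q => ∫ t in (0 : ℝ)..1, f (q, t), contDiffOn_integral_param hSo hfs hΩ hΩS,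
    fun q hq v hv => ?_⟩
  have hcont : ContinuousOn
      (fun t => (fderiv ℝ f (q, t)).comp (ContinuousLinearMap.inl ℝ E ℝ)) (Set.Icc 0 1) :=
    continuousOn_slice (f := fun y => (fderiv ℝ f y).comp (ContinuousLinearMap.inl ℝ E ℝ))
      ((hfs.continuousOn_fderiv_of_isOpen hSo (by simp)).clm_comp continuousOn_const) (hΩS q hq)
  rw [(hasFDerivAt_integral_param hSo (hfs.of_le (by simp)) (hΩS q hq)).fderiv,
    ContinuousLinearMap.intervalIntegral_apply (ContinuousOn.intervalIntegrable (by
      rwa [Set.uIcc_of_le zero_le_one]))]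
  have hder : ∀ t ∈ Set.Icc (0 : ℝ) 1,
      HasDerivAt (fun t : ℝ => t * θ (q - (1 - t) • R (q - b)) v)
      (((fderiv ℝ f (q, t)).comp (ContinuousLinearMap.inl ℝ E ℝ)) v) t := by
    intro t ht
    have hθd := ((hθ.contDiffAt (hΩ.mem_nhds (hstar q hq t ht))).differentiableAt
      (by simp)).hasFDerivAt
    have hfd : HasFDerivAt f (fderiv ℝ f (q, t)) (q, t) :=
      ((hfs.contDiffAt (hSo.mem_nhds (hΩS q hq t ht))).differentiableAt (by simp)).hasFDerivAt
    have h4 : HasDerivAt (fun s : ℝ => ((q + s • v, t) : E × ℝ)) (v, 0) 0 := by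
      have := ((hasDerivAt_id (0 : ℝ)).smul_const v).const_add q
      simpa using this.prodMk (hasDerivAt_const (0 : ℝ) t)
    have h5 : HasDerivAt (fun s : ℝ => f (q + s • v, t)) (fderiv ℝ f (q, t) (v, 0)) 0 :=
      HasFDerivAt.comp_hasDerivAt (f := fun s : ℝ => ((q + s • v, t) : E × ℝ)) (0 : ℝ)
        (by simpa using hfd) h4
    have h8 := hasDerivAt_fiber_space hθd hv
    have h9 : fderiv ℝ f (q, t) (v, 0) = _ := h5.unique (by rw [hf]; exact h8)
    have h11 : ((fderiv ℝ f (q, t)).comp (ContinuousLinearMap.inl ℝ E ℝ)) v =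
        fderiv ℝ f (q, t) (v, 0) := rfl
    rw [h11, h9, hcl _ (hstar q hq t ht) v (R (q - b)) hv (hR _)]
    exact hasDerivAt_fiber_time hθd
  -- The directional derivative of the integrand is the t-derivative of t θ(…) v, whose boundary
  -- values are 0 at t = 0 and θ q v at t = 1.
  have hFTC := intervalIntegral.integral_eq_sub_of_hasDerivAt (a := (0 : ℝ)) (b := 1)
    (fun t ht => hder t (by rwa [Set.uIcc_of_le zero_le_one] at ht)) (by
      refine ContinuousOn.intervalIntegrable ?_
      rw [Set.uIcc_of_le zero_le_one]
      exact hcont.clm_apply continuousOn_const)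
  rw [hFTC]
  simp

end ParametricIntegral

end VarIF

/-! ### Construction of a first-order Lagrangian. -/

namespace VarIF

variable {n : ℕ} {U V : Set (Jet1 n)} {A : Fin n → Fin n → Jet1 n → ℝ} {B : Jet1 n → ℝ}
  {G : Jet n → ℝ}

section FirstOrderLagrangian

variable {X : Set (Fin n → ℝ)} {Y : Set ℝ} {P : Set (Fin n → ℝ)}

theorem IsEulerLagrange.mono (h : IsEulerLagrange U G) (hVU : V ⊆ U) : IsEulerLagrange V G := by
  obtain ⟨L, hL, hL'⟩ := h
  exact ⟨L, hL.mono hVU, fun z hz => hL' z (hVU hz)⟩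

/-- The functional `(x, u, p) ↦ p_i`. -/
noncomputable def momentum (i : Fin n) : Jet1 n →L[ℝ] ℝ :=
  (ContinuousLinearMap.proj i).comp
    ((ContinuousLinearMap.snd ℝ ℝ (Fin n → ℝ)).comp (ContinuousLinearMap.snd ℝ _ _))

theorem momentum_apply (i : Fin n) (q : Jet1 n) : momentum i q = q.2.2 i := rfl

theorem clm_apply_momentum (T : Jet1 n →L[ℝ] ℝ) (p : Fin n → ℝ) :
    T (0, 0, p) = ∑ l, T (0, 0, Pi.single l 1) * p l := by
  rw [clm_apply_split]
  have : ((0, 0, 0) : Jet1 n) = 0 := rfl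
  rw [this, map_zero, zero_add]

/-- The fibrewise Poincaré lemma for Σ c_i dp_i. Convexity of P makes the fibres star-shaped about
p₀; x and u are mere parameters. -/
theorem exists_momentum_primitive (hX : IsOpen X) (hY : IsOpen Y) (hP : IsOpen P)
    (hPc : Convex ℝ P) {p₀ : Fin n → ℝ} (hp₀ : p₀ ∈ P) {c : Fin n → Jet1 n → ℝ}
    (hc : ∀ i, ContDiffOn ℝ ∞ (c i) (X ×ˢ (Y ×ˢ P)))
    (hsymm : ∀ q ∈ X ×ˢ (Y ×ˢ P), ∀ i k,
      fderiv ℝ (c i) q (0, 0, Pi.single k 1) = fderiv ℝ (c k) q (0, 0, Pi.single i 1)) :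
    ∃ M : Jet1 n → ℝ, ContDiffOn ℝ ∞ M (X ×ˢ (Y ×ˢ P)) ∧
      ∀ q ∈ X ×ˢ (Y ×ˢ P), ∀ j, fderiv ℝ M q (0, 0, Pi.single j 1) = c j q := by
  have hΩ : IsOpen (X ×ˢ (Y ×ˢ P)) := hX.prod (hY.prod hP)
  set R : Jet1 n →L[ℝ] Jet1 n := (0 : Jet1 n →L[ℝ] (Fin n → ℝ)).prod ((0 : Jet1 n →L[ℝ] ℝ).prod
    ((ContinuousLinearMap.snd ℝ ℝ (Fin n → ℝ)).comp (ContinuousLinearMap.snd ℝ _ _))) with hR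
  have hRv : ∀ v, R v = (0, 0, v.2.2) := fun v => rfl
  have hd : ∀ q ∈ X ×ˢ (Y ×ˢ P), ∀ v w,
      fderiv ℝ (fun q => ∑ i, c i q • momentum i) q v w = ∑ i, fderiv ℝ (c i) q v * w.2.2 i := by
    intro q hq v w
    have h1 : ∀ i, HasFDerivAt (c i) (fderiv ℝ (c i) q) q := fun i =>
      (((hc i).contDiffAt (hΩ.mem_nhds hq)).differentiableAt (by simp)).hasFDerivAt
    have h2 := HasFDerivAt.fun_sum fun i (_ : i ∈ Finset.univ) =>
      (h1 i).smul_const (momentum i : Jet1 n →L[ℝ] ℝ)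
    rw [h2.fderiv]
    simp [momentum_apply]
  have hstar : ∀ q ∈ X ×ˢ (Y ×ˢ P), ∀ t ∈ Set.Icc (0 : ℝ) 1,
      q - (1 - t) • R (q - ((0, 0, p₀) : Jet1 n)) ∈ X ×ˢ (Y ×ˢ P) := by
    rintro ⟨x, u, p⟩ ⟨hx, hu, hp⟩ t ⟨ht0, ht1⟩
    refine ⟨?_, ?_, ?_⟩
    · simpa [hRv] using hx
    · simpa [hRv] using hu
    · have : p - (1 - t) • (p - p₀) = t • p + (1 - t) • p₀ := by module
      simp only [hRv, Prod.snd_sub, Prod.smul_snd, this]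
      exact hPc hp hp₀ ht0 (by linarith) (by ring)
  have hcl : ∀ q ∈ X ×ˢ (Y ×ˢ P), ∀ v w, R v = v → R w = w →
      fderiv ℝ (fun q => ∑ i, c i q • momentum i) q v w =
        fderiv ℝ (fun q => ∑ i, c i q • momentum i) q w v := by
    intro q hq v w hv hw
    rw [hd q hq, hd q hq, ← hv, ← hw, hRv, hRv]
    have hs : ∀ (p : Fin n → ℝ) i, fderiv ℝ (c i) q (0, 0, p) = _ := fun p i =>
      clm_apply_momentum (fderiv ℝ (c i) q) p
    simp only [hs v.2.2, hs w.2.2, Finset.sum_mul]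
    rw [Finset.sum_comm]
    refine Finset.sum_congr rfl fun i _ => Finset.sum_congr rfl fun k _ => ?_
    rw [hsymm q hq k i]
    ring
  obtain ⟨M, hM, hM'⟩ := exists_fiber_primitive hΩ R (0, 0, p₀)
    (θ := fun q => ∑ i, c i q • momentum i)
    (ContDiffOn.sum fun i _ => (hc i).smul contDiffOn_const) (fun v => rfl) hstar hcl
  refine ⟨M, hM, fun q hq j => ?_⟩
  rw [hM' q hq _ rfl]
  simp [momentum_apply, Pi.single_apply]

/-- The fibres are one-dimensional, so closedness is automatic. -/
theorem exists_value_primitive (hX : IsOpen X) (hY : IsOpen Y) (hYc : Convex ℝ Y) (hP : IsOpen P)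
    {u₀ : ℝ} (hu₀ : u₀ ∈ Y) {C : Jet1 n → ℝ} (hC : ContDiffOn ℝ ∞ C (X ×ˢ (Y ×ˢ P))) :
    ∃ K : Jet1 n → ℝ, ContDiffOn ℝ ∞ K (X ×ˢ (Y ×ˢ P)) ∧
      ∀ q ∈ X ×ˢ (Y ×ˢ P), fderiv ℝ K q (0, 1, 0) = C q := by
  have hΩ : IsOpen (X ×ˢ (Y ×ˢ P)) := hX.prod (hY.prod hP)
  set T : Jet1 n →L[ℝ] ℝ :=
    (ContinuousLinearMap.fst ℝ ℝ (Fin n → ℝ)).comp (ContinuousLinearMap.snd ℝ _ _) with hT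
  set R : Jet1 n →L[ℝ] Jet1 n := (0 : Jet1 n →L[ℝ] (Fin n → ℝ)).prod (T.prod
    (0 : Jet1 n →L[ℝ] (Fin n → ℝ))) with hR
  have hRv : ∀ v, R v = (0, v.2.1, 0) := fun v => rfl
  have hd : ∀ q ∈ X ×ˢ (Y ×ˢ P), ∀ v w,
      fderiv ℝ (fun q => C q • T) q v w = fderiv ℝ C q v * w.2.1 := by
    intro q hq v w
    have h1 : HasFDerivAt C (fderiv ℝ C q) q :=
      ((hC.contDiffAt (hΩ.mem_nhds hq)).differentiableAt (by simp)).hasFDerivAt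
    rw [(h1.smul_const T).fderiv]
    rfl
  have hstar : ∀ q ∈ X ×ˢ (Y ×ˢ P), ∀ t ∈ Set.Icc (0 : ℝ) 1,
      q - (1 - t) • R (q - ((0, u₀, 0) : Jet1 n)) ∈ X ×ˢ (Y ×ˢ P) := by
    rintro ⟨x, u, p⟩ ⟨hx, hu, hp⟩ t ⟨ht0, ht1⟩
    refine ⟨?_, ?_, ?_⟩
    · simpa [hRv] using hx
    · have : u - (1 - t) • (u - u₀) = t • u + (1 - t) • u₀ := by module
      simp only [hRv, Prod.snd_sub, Prod.smul_snd, Prod.fst_sub, Prod.smul_fst, this]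
      exact hYc hu hu₀ ht0 (by linarith) (by ring)
    · simpa [hRv] using hp
  have hcl : ∀ q ∈ X ×ˢ (Y ×ˢ P), ∀ v w, R v = v → R w = w →
      fderiv ℝ (fun q => C q • T) q v w = fderiv ℝ (fun q => C q • T) q w v := by
    intro q hq v w hv hw
    have h1 : ∀ v : Jet1 n, R v = v → v = v.2.1 • ((0, 1, 0) : Jet1 n) := by
      intro v hv
      rw [hRv] at hv
      conv_lhs => rw [← hv]
      simp
    rw [hd q hq, hd q hq]
    conv_lhs => rw [h1 v hv]
    conv_rhs => rw [h1 w hw]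
    simp only [map_smul, smul_eq_mul]
    ring
  obtain ⟨M, hM, hM'⟩ := exists_fiber_primitive hΩ R (0, u₀, 0)
    (θ := fun q => C q • T) (hC.smul contDiffOn_const) (fun v => rfl) hstar hcl
  refine ⟨M, hM, fun q hq => ?_⟩
  rw [hM' q hq _ rfl]
  simp [hT]

theorem fderiv_fderiv_comm {C : Jet1 n → ℝ} (hC : ContDiffOn ℝ ∞ C V) (hV : IsOpen V)
    {q : Jet1 n} (hq : q ∈ V) (v w : Jet1 n) :
    fderiv ℝ (fun q => fderiv ℝ C q v) q w = fderiv ℝ (fun q => fderiv ℝ C q w) q v := by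
  have hc := hC.contDiffAt (hV.mem_nhds hq)
  have hs : IsSymmSndFDerivAt ℝ C q := hc.isSymmSndFDerivAt
    (by rw [minSmoothness_of_isRCLikeNormedField]; exact WithTop.coe_le_coe.2 le_top)
  have hd : DifferentiableAt ℝ (fderiv ℝ C) q :=
    (hc.fderiv_right (m := ∞) (by simp)).differentiableAt (by simp)
  have h : ∀ v w : Jet1 n, fderiv ℝ (fun q => fderiv ℝ C q v) q w =
      fderiv ℝ (fderiv ℝ C) q w v := by
    intro v w
    rw [fderiv_clm_apply hd (differentiableAt_const v)]
    simp
  rw [h, h, hs.eq]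

theorem fderiv_congr_of_eqOn {C C' : Jet1 n → ℝ} (hV : IsOpen V) (h : ∀ q ∈ V, C q = C' q)
    {q : Jet1 n} (hq : q ∈ V) : fderiv ℝ C q = fderiv ℝ C' q := by
  refine Filter.EventuallyEq.fderiv_eq ?_
  filter_upwards [hV.mem_nhds hq] with q hq using h q hq

/-- A quasilinear Euler--Lagrange expression has a first-order Lagrangian over boxes with convex
fibres. -/
theorem exists_isFirstOrderLagrangian (hX : IsOpen X) (hY : IsOpen Y) (hYc : Convex ℝ Y)
    (hP : IsOpen P) (hPc : Convex ℝ P) (hG : IsSymmQuasilinear (X ×ˢ (Y ×ˢ P)) A B G)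
    (hEL : IsEulerLagrange (X ×ˢ (Y ×ˢ P)) G) :
    ∃ L : Jet1 n → ℝ, IsFirstOrderLagrangian (X ×ˢ (Y ×ˢ P)) L G := by
  have hΩ : IsOpen (X ×ˢ (Y ×ˢ P)) := hX.prod (hY.prod hP)
  rcases Y.eq_empty_or_nonempty with rfl | ⟨u₀, hu₀⟩
  · exact ⟨0, contDiffOn_const, fun z hz => by simp at hz⟩
  rcases P.eq_empty_or_nonempty with rfl | ⟨p₀, hp₀⟩
  · exact ⟨0, contDiffOn_const, fun z hz => by simp at hz⟩
  -- First integration: for fixed j the form -Σ_i A^{ij} dp_i is closed by `fderiv_A`.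
  have hN : ∀ j, ∃ N : Jet1 n → ℝ, ContDiffOn ℝ ∞ N (X ×ˢ (Y ×ˢ P)) ∧
      ∀ q ∈ X ×ˢ (Y ×ˢ P), ∀ i, fderiv ℝ N q (0, 0, Pi.single i 1) = -A i j q := by
    intro j
    refine exists_momentum_primitive hX hY hP hPc hp₀ (c := fun i q => -A i j q)
      (fun i => (hG.smooth_A i j).neg) fun q hq i k => ?_
    simp only [fderiv_fun_neg, neg_apply]
    rw [hG.fderiv_A hΩ hEL hq]
  choose N hN hN' using hN
  -- Second integration: Σ_j N_j dp_j is closed because A is symmetric.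
  obtain ⟨M, hM, hM'⟩ := exists_momentum_primitive hX hY hP hPc hp₀ hN fun q hq i k => by
    rw [hN' i q hq, hN' k q hq, hG.symm]
  have hNx : ∀ j (v : Jet1 n), ContDiffOn ℝ ∞ (fun q => fderiv ℝ (N j) q v) (X ×ˢ (Y ×ˢ P)) :=
    fun j v => contDiffOn_fderiv_apply (hN j) hΩ v
  have hMu := contDiffOn_fderiv_apply hM hΩ (0, 1, 0)
  -- The defect G - E_u(M), in which the second-order terms have already cancelled.
  set C : Jet1 n → ℝ := fun q => B q - fderiv ℝ M q (0, 1, 0) +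
    ∑ j, fderiv ℝ (N j) q (Pi.single j 1, q.2.2 j, 0) with hCdef
  have hNt : ∀ j, ContDiffOn ℝ ∞ (fun q : Jet1 n => fderiv ℝ (N j) q (Pi.single j 1, q.2.2 j, 0))
      (X ×ˢ (Y ×ˢ P)) := fun j =>
    ((hN j).fderiv_of_isOpen hΩ (by simp)).clm_apply (by fun_prop)
  have hC : ContDiffOn ℝ ∞ C (X ×ˢ (Y ×ˢ P)) :=
    (hG.smooth_B.sub hMu).add (ContDiffOn.sum fun j _ => hNt j)
  -- The defect does not depend on p: exchanging derivatives turns ∂N_j/∂u_k into -A^{kj} and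
  -- ∂M/∂u_k into N_k, and `fderiv_B` cancels the rest.
  have hCp : ∀ q ∈ X ×ˢ (Y ×ˢ P), ∀ k, fderiv ℝ C q (0, 0, Pi.single k 1) = 0 := by
    intro q hq k
    have hdiff : ∀ {F : Jet1 n → ℝ}, ContDiffOn ℝ ∞ F (X ×ˢ (Y ×ˢ P)) →
        DifferentiableAt ℝ F q := fun hF =>
      (hF.contDiffAt (hΩ.mem_nhds hq)).differentiableAt (by simp)
    have h1 : ∀ j, fderiv ℝ (fun q : Jet1 n => fderiv ℝ (N j) q (Pi.single j 1, q.2.2 j, 0)) q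
        (0, 0, Pi.single k 1) = -fderiv ℝ (A k j) q (Pi.single j 1, q.2.2 j, 0) +
          fderiv ℝ (N j) q (0, (Pi.single k 1 : Fin n → ℝ) j, 0) := by
      intro j
      have e1 : ∀ q : Jet1 n, fderiv ℝ (N j) q (Pi.single j 1, q.2.2 j, 0) =
          fderiv ℝ (N j) q (Pi.single j 1, 0, 0) + momentum j q * fderiv ℝ (N j) q (0, 1, 0) := by
        intro q
        rw [← smul_eq_mul, ← map_smul, ← map_add]
        congr 1
        simp [momentum_apply]
      have e2 : ∀ v : Jet1 n, fderiv ℝ (fun q => fderiv ℝ (N j) q v) q (0, 0, Pi.single k 1) =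
          -fderiv ℝ (A k j) q v := by
        intro v
        rw [fderiv_fderiv_comm (hN j) hΩ hq,
          fderiv_congr_of_eqOn hΩ (fun q hq => hN' j q hq k) hq]
        simp only [fderiv_fun_neg, neg_apply]
      have e3 : fderiv ℝ (A k j) q (Pi.single j 1, q.2.2 j, 0) =
          fderiv ℝ (A k j) q (Pi.single j 1, 0, 0) +
            momentum j q * fderiv ℝ (A k j) q (0, 1, 0) := by
        rw [← smul_eq_mul, ← map_smul, ← map_add]
        congr 1
        simp [momentum_apply]
      have e4 : fderiv ℝ (N j) q (0, (Pi.single k 1 : Fin n → ℝ) j, 0) =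
          (Pi.single k 1 : Fin n → ℝ) j * fderiv ℝ (N j) q (0, 1, 0) := by
        rw [← smul_eq_mul, ← map_smul]
        congr 1
        simp
      simp only [e1]
      rw [fderiv_fun_add (hdiff (hNx j _)) ((momentum j).differentiableAt.fun_mul (hdiff (hNx j _))),
        fderiv_fun_mul (momentum j).differentiableAt (hdiff (hNx j _)), e3, e4]
      simp only [add_apply, smul_apply, e2,
        ContinuousLinearMap.fderiv, smul_eq_mul, momentum_apply]
      ring
    have h2 : fderiv ℝ (fun q => fderiv ℝ M q (0, 1, 0)) q (0, 0, Pi.single k 1) =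
        fderiv ℝ (N k) q (0, 1, 0) := by
      rw [fderiv_fderiv_comm hM hΩ hq, fderiv_congr_of_eqOn hΩ (fun q hq => hM' q hq k) hq]
    have h3 : ∑ j, fderiv ℝ (N j) q (0, (Pi.single k 1 : Fin n → ℝ) j, 0) =
        fderiv ℝ (N k) q (0, 1, 0) := by
      rw [Finset.sum_eq_single k]
      · simp
      · intro j _ hj
        have : ((0, (Pi.single k 1 : Fin n → ℝ) j, 0) : Jet1 n) = 0 := by simp [hj]
        rw [this, map_zero]
      · simp
    rw [hCdef, fderiv_fun_add ((hdiff hG.smooth_B).fun_sub (hdiff hMu))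
      (DifferentiableAt.fun_sum fun j _ => hdiff (hNt j)),
      fderiv_fun_sub (hdiff hG.smooth_B) (hdiff hMu),
      fderiv_fun_sum fun j _ => hdiff (hNt j)]
    simp only [add_apply, sub_apply,
      sum_apply, h1, h2, Finset.sum_add_distrib, h3,
      hG.fderiv_B hΩ hEL hq k, Finset.sum_neg_distrib]
    ring
  obtain ⟨K, hK, hK'⟩ := exists_value_primitive hX hY hYc hP hu₀ hC
  -- K may depend on p. Freezing p at p₀ removes this, so that adding K ∘ S leaves the Hessian
  -- alone, and the u-derivative remains C because C is independent of p.
  set S : Jet1 n → Jet1 n := fun q => (q.1, q.2.1, p₀) with hS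
  have hSm : ∀ q ∈ X ×ˢ (Y ×ˢ P), S q ∈ X ×ˢ (Y ×ˢ P) := fun q hq => ⟨hq.1, hq.2.1, hp₀⟩
  have hSs : ContDiff ℝ ∞ S := by fun_prop
  have hSd : ∀ q (v : Jet1 n), fderiv ℝ S q v = (v.1, v.2.1, 0) := by
    intro q v
    have h : HasFDerivAt S ((ContinuousLinearMap.fst ℝ _ _).prod
        (((ContinuousLinearMap.fst ℝ _ _).comp (ContinuousLinearMap.snd ℝ _ _)).prod 0)) q :=
      hasFDerivAt_fst.prodMk ((hasFDerivAt_fst.comp q hasFDerivAt_snd).prodMk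
        (hasFDerivAt_const _ _))
    rw [h.fderiv]
    rfl
  have hCS : ∀ q ∈ X ×ˢ (Y ×ˢ P), C (S q) = C q := by
    rintro ⟨x, u, p⟩ hq
    have hi : ∀ p : Fin n → ℝ, HasFDerivAt (fun p : Fin n → ℝ => ((x, u, p) : Jet1 n))
        ((0 : (Fin n → ℝ) →L[ℝ] (Fin n → ℝ)).prod
          ((0 : (Fin n → ℝ) →L[ℝ] ℝ).prod (ContinuousLinearMap.id ℝ _))) p := fun p =>
      (hasFDerivAt_const x p).prodMk ((hasFDerivAt_const u p).prodMk (hasFDerivAt_id p))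
    have hcomp : ∀ p ∈ P, HasFDerivAt (𝕜 := ℝ) (fun p : Fin n → ℝ => C (x, u, p)) 0 p := by
      intro p hp
      have hm : ((x, u, p) : Jet1 n) ∈ X ×ˢ (Y ×ˢ P) := ⟨hq.1, hq.2.1, hp⟩
      have hd := ((hC.contDiffAt (hΩ.mem_nhds hm)).differentiableAt (by simp)).hasFDerivAt
      have hz : (fderiv ℝ C (x, u, p)).comp ((0 : (Fin n → ℝ) →L[ℝ] (Fin n → ℝ)).prod
          ((0 : (Fin n → ℝ) →L[ℝ] ℝ).prod (ContinuousLinearMap.id ℝ _))) = 0 := by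
        refine ContinuousLinearMap.ext fun v => ?_
        change fderiv ℝ C (x, u, p) (0, 0, v) = 0
        rw [clm_apply_momentum]
        exact Finset.sum_eq_zero fun k _ => by rw [hCp _ hm k, zero_mul]
      have h := hd.comp p (hi p)
      rw [hz] at h
      exact h
    refine hP.is_const_of_fderiv_eq_zero (𝕜 := ℝ) hPc.isPreconnected
      (f := fun p : Fin n → ℝ => C (x, u, p))
      (fun p hp => (hcomp p hp).differentiableAt.differentiableWithinAt)
      (fun p hp => (hcomp p hp).fderiv) hp₀ hq.2.2
  have hKS : ContDiffOn ℝ ∞ (fun q => K (S q)) (X ×ˢ (Y ×ˢ P)) := hK.comp hSs.contDiffOn hSm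
  have hKd : ∀ q ∈ X ×ˢ (Y ×ˢ P), ∀ v : Jet1 n,
      fderiv ℝ (fun q => K (S q)) q v = fderiv ℝ K (S q) (v.1, v.2.1, 0) := by
    intro q hq v
    have h1 := ((hK.contDiffAt (hΩ.mem_nhds (hSm q hq))).differentiableAt (by simp)).hasFDerivAt
    have h2 := (hSs.differentiable (by simp) q).hasFDerivAt
    have h3 : fderiv ℝ (fun q => K (S q)) q = _ := (h1.comp q h2).fderiv
    rw [h3, ContinuousLinearMap.comp_apply, hSd]
  have hLd : ∀ q ∈ X ×ˢ (Y ×ˢ P), ∀ v, fderiv ℝ (fun q => M q + K (S q)) q v =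
      fderiv ℝ M q v + fderiv ℝ K (S q) (v.1, v.2.1, 0) := by
    intro q hq v
    rw [fderiv_fun_add ((hM.contDiffAt (hΩ.mem_nhds hq)).differentiableAt (by simp))
      ((hKS.contDiffAt (hΩ.mem_nhds hq)).differentiableAt (by simp)),
      add_apply, hKd q hq]
  have hLp : ∀ q ∈ X ×ˢ (Y ×ˢ P), ∀ j,
      fderiv ℝ (fun q => M q + K (S q)) q (0, 0, Pi.single j 1) = N j q := by
    intro q hq j
    have : ((0, 0, 0) : Jet1 n) = 0 := rfl
    rw [hLd q hq, hM' q hq, this, map_zero, add_zero]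
  refine ⟨fun q => M q + K (S q), isFirstOrderLagrangian_of hΩ hG (hM.add hKS) ?_ ?_⟩
  · intro q hq j l
    rw [fderiv_congr_of_eqOn hΩ (fun q hq => hLp q hq j) hq, hN' j q hq, hG.symm]
  · intro q hq
    rw [hLd q hq, hK' _ (hSm q hq), hCS q hq, Finset.sum_congr rfl fun j _ => by
      rw [fderiv_congr_of_eqOn hΩ (fun q hq => hLp q hq j) hq]]
    simp only [hCdef]
    ring

end FirstOrderLagrangian

end VarIF

/-! ### Algebra of the quadratic symbol. -/

namespace VarIF

variable {n k m : ℕ} {U V : Set (Jet1 n)} {f f' g : Jet n → ℝ} {z v w : Jet n}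
  {A : Fin n → Fin n → Jet1 n → ℝ} {B : Jet1 n → ℝ} {G W : Jet n → ℝ}

section Symbol

/-- The multi-indices of order exactly `m`. -/
def homIdx (n m : ℕ) : Finset (Fin n → ℕ) := (multiIdx n m).filter fun I => order I = m

theorem mem_homIdx {I : Fin n → ℕ} : I ∈ homIdx n m ↔ order I = m := by
  simp only [homIdx, Finset.mem_filter, mem_multiIdx, and_iff_right_iff_imp]
  exact fun h => h.le

/-- The monomial `ξ^I`. -/
noncomputable def mono (I : Fin n → ℕ) : MvPolynomial (Fin n) ℝ :=
  MvPolynomial.monomial (Finsupp.equivFunOnFinite.symm I) 1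

theorem mono_add (I J : Fin n → ℕ) : mono (I + J) = mono I * mono J := by
  have h : Finsupp.equivFunOnFinite.symm (I + J) =
      Finsupp.equivFunOnFinite.symm I + Finsupp.equivFunOnFinite.symm J := by
    ext i; simp
  rw [mono, mono, mono, h, MvPolynomial.monomial_mul, one_mul]

theorem mono_e (i : Fin n) : mono (e i) = MvPolynomial.X i := by
  have h : Finsupp.equivFunOnFinite.symm (e i) = Finsupp.single i 1 := by
    ext j; simp [e]
  rw [mono, h]
  rfl

theorem coeff_mono (I J : Fin n → ℕ) :
    (mono I).coeff (Finsupp.equivFunOnFinite.symm J) = if I = J then 1 else 0 := by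
  rw [mono, MvPolynomial.coeff_monomial]
  simp only [EmbeddingLike.apply_eq_iff_eq]

/-- The quadratic form `∑ a_{ij} ξ_i ξ_j`. -/
noncomputable def quadForm (a : Fin n → Fin n → ℝ) : MvPolynomial (Fin n) ℝ :=
  ∑ i, ∑ j, MvPolynomial.C (a i j) * mono (e i + e j)

theorem eval_quadForm (a : Fin n → Fin n → ℝ) (ξ : Fin n → ℝ) :
    MvPolynomial.eval ξ (quadForm a) = ∑ i, ∑ j, a i j * (ξ i * ξ j) := by
  simp [quadForm, mono_add, mono_e]

/-- The contraction of a family of jet coordinates by the quadratic form `a`. -/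
noncomputable def contract (a : Fin n → Fin n → ℝ) (y : (Fin n → ℕ) → ℝ) (K : Fin n → ℕ) : ℝ :=
  ∑ i, ∑ j, a i j * y (K + (e i + e j))

/-- The matrix of the contraction from order `m + 2` to order `m`. -/
noncomputable def contractMatrix (m : ℕ) (a : Fin n → Fin n → ℝ) :
    Matrix (homIdx n m) (homIdx n (m + 2)) ℝ :=
  Matrix.of fun K I => ∑ i, ∑ j, a i j * if (I : Fin n → ℕ) = K + (e i + e j) then 1 else 0

theorem order_add_e_add_e (K : Fin n → ℕ) (i j : Fin n) :
    order (K + (e i + e j)) = order K + 2 := by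
  rw [order_add, order_e_add_e]

theorem sum_homIdx_ite {M : Type*} [AddCommMonoid M] {K : Fin n → ℕ} (hK : K ∈ homIdx n m)
    (i j : Fin n) (y : (Fin n → ℕ) → M) :
    ∑ I : homIdx n (m + 2), (if (I : Fin n → ℕ) = K + (e i + e j) then y I else 0) =
      y (K + (e i + e j)) := by
  have hI : K + (e i + e j) ∈ homIdx n (m + 2) := by
    rw [mem_homIdx, order_add_e_add_e, mem_homIdx.1 hK]
  rw [Finset.sum_eq_single ⟨_, hI⟩]
  · simp
  · rintro I - h
    rw [if_neg fun h' => h (Subtype.ext h')]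
  · simp

theorem sum_contractMatrix_mul (a : Fin n → Fin n → ℝ) (y : (Fin n → ℕ) → ℝ) (K : homIdx n m) :
    ∑ I, contractMatrix m a K I * y I = contract a y K := by
  simp only [contractMatrix, Matrix.of_apply, Finset.sum_mul, contract]
  rw [Finset.sum_comm]
  refine Finset.sum_congr rfl fun i _ => ?_
  rw [Finset.sum_comm]
  refine Finset.sum_congr rfl fun j _ => ?_
  simp only [mul_assoc, ← Finset.mul_sum, ite_mul, one_mul, zero_mul]
  rw [sum_homIdx_ite K.2]

/-- The transpose of the contraction matrix is multiplication by the quadratic form on homogeneous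
polynomials of degree m. -/
theorem quadForm_mul_sum_mono (a : Fin n → Fin n → ℝ) (y : homIdx n m → ℝ) :
    quadForm a * ∑ K, MvPolynomial.C (y K) * mono (K : Fin n → ℕ) =
      ∑ I : homIdx n (m + 2), MvPolynomial.C (∑ K, contractMatrix m a K I * y K) * mono I := by
  simp only [map_sum, Finset.sum_mul, Finset.mul_sum, quadForm, contractMatrix, Matrix.of_apply]
  rw [Finset.sum_comm (s := Finset.univ (α := homIdx n (m + 2)))]
  refine Finset.sum_congr rfl fun K _ => ?_
  rw [Finset.sum_comm (s := Finset.univ (α := homIdx n (m + 2)))]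
  refine Finset.sum_congr rfl fun i _ => ?_
  rw [Finset.sum_comm (s := Finset.univ (α := homIdx n (m + 2)))]
  refine Finset.sum_congr rfl fun j _ => ?_
  have h := sum_homIdx_ite K.2 i j
    fun I => MvPolynomial.C (a i j) * MvPolynomial.C (y K) * mono I
  rw [mono_add] at h
  rw [mul_mul_mul_comm, mul_comm (mono (e i + e j)), ← h]
  refine Finset.sum_congr rfl fun I _ => ?_
  split_ifs <;> simp

/-- Over ℝ the kernel of M Mᵀ is that of Mᵀ, and Mᵀ is multiplication by a nonzero element of a
domain. Thus contraction is surjective, whatever the signature or rank of a nonzero form. -/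
theorem det_contractMatrix_ne_zero {a : Fin n → Fin n → ℝ} (ha : quadForm a ≠ 0) (m : ℕ) :
    (contractMatrix m a * (contractMatrix m a).transpose).det ≠ 0 := by
  intro h
  obtain ⟨y, hy, hMy⟩ := Matrix.exists_mulVec_eq_zero_iff.2 h
  rw [← Matrix.conjTranspose_eq_transpose_of_trivial,
    Matrix.self_mul_conjTranspose_mulVec_eq_zero] at hMy
  apply hy
  have h1 : quadForm a * ∑ K, MvPolynomial.C (y K) * mono (K : Fin n → ℕ) = 0 := by
    rw [quadForm_mul_sum_mono]
    refine Finset.sum_eq_zero fun I _ => ?_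
    have := congrFun hMy I
    simp only [Matrix.mulVec, dotProduct, Matrix.conjTranspose_apply, star_trivial,
      Pi.zero_apply] at this
    rw [this, map_zero, zero_mul]
  have h2 := (mul_eq_zero.1 h1).resolve_left ha
  funext K
  have h3 := congrArg (MvPolynomial.coeff (Finsupp.equivFunOnFinite.symm (K : Fin n → ℕ))) h2
  rw [MvPolynomial.coeff_sum, MvPolynomial.coeff_zero, Finset.sum_eq_single K] at h3
  · simpa only [MvPolynomial.coeff_C_mul, coeff_mono, if_true, mul_one, Pi.zero_apply] using h3
  · rintro L - hL
    rw [MvPolynomial.coeff_C_mul, coeff_mono, if_neg fun h => hL (Subtype.ext h), mul_zero]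
  · exact fun h => absurd (Finset.mem_univ K) h

/-- A right inverse of the contraction. -/
noncomputable def contractInv (m : ℕ) (a : Fin n → Fin n → ℝ) :
    Matrix (homIdx n (m + 2)) (homIdx n m) ℝ :=
  (contractMatrix m a).transpose * (contractMatrix m a * (contractMatrix m a).transpose)⁻¹

theorem contractMatrix_mul_contractInv {a : Fin n → Fin n → ℝ} (ha : quadForm a ≠ 0) (m : ℕ) :
    contractMatrix m a * contractInv m a = 1 := by
  rw [contractInv, ← Matrix.mul_assoc, Matrix.mul_nonsing_inv]
  exact (det_contractMatrix_ne_zero ha m).isUnit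

theorem contDiffOn_det {ι E : Type*} [Fintype ι] [DecidableEq ι] [NormedAddCommGroup E]
    [NormedSpace ℝ E] {s : Set E} {M : E → Matrix ι ι ℝ}
    (hM : ∀ i j, ContDiffOn ℝ ∞ (fun q => M q i j) s) : ContDiffOn ℝ ∞ (fun q => (M q).det) s := by
  simp only [Matrix.det_apply']
  exact ContDiffOn.sum fun σ _ => contDiffOn_const.mul (contDiffOn_prod fun i _ => hM _ _)

theorem contDiffOn_inv_apply {ι E : Type*} [Fintype ι] [DecidableEq ι] [NormedAddCommGroup E]
    [NormedSpace ℝ E] {s : Set E} {M : E → Matrix ι ι ℝ}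
    (hM : ∀ i j, ContDiffOn ℝ ∞ (fun q => M q i j) s) (h : ∀ q ∈ s, (M q).det ≠ 0) (i j : ι) :
    ContDiffOn ℝ ∞ (fun q => (M q)⁻¹ i j) s := by
  simp only [Matrix.inv_def, Matrix.smul_apply, smul_eq_mul, Ring.inverse_eq_inv',
    Matrix.adjugate_apply]
  refine ((contDiffOn_det hM).inv h).mul (contDiffOn_det fun a b => ?_)
  simp only [Matrix.updateRow_apply]
  split_ifs
  · exact contDiffOn_const
  · exact hM a b

/-- The right inverse is rational in the entries of A, so corrections built from it depend smoothly
on the jet. -/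
theorem contDiffOn_contractInv (hA : ∀ i j, ContDiffOn ℝ ∞ (A i j) V)
    (h : ∀ q ∈ V, quadForm (fun i j => A i j q) ≠ 0) (m : ℕ) (I : homIdx n (m + 2))
    (K : homIdx n m) :
    ContDiffOn ℝ ∞ (fun q => contractInv m (fun i j => A i j q) I K) V := by
  have h1 : ∀ (K : homIdx n m) I,
      ContDiffOn ℝ ∞ (fun q => contractMatrix m (fun i j => A i j q) K I) V := fun K I => by
    simp only [contractMatrix, Matrix.of_apply]
    exact ContDiffOn.sum fun i _ => ContDiffOn.sum fun j _ => (hA i j).mul contDiffOn_const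
  simp only [contractInv]
  simp only [Matrix.mul_apply, Matrix.transpose_apply]
  refine ContDiffOn.sum fun J _ => (h1 _ _).mul (contDiffOn_inv_apply (fun a b => ?_)
    (fun q hq => det_contractMatrix_ne_zero (h q hq) m) _ _)
  simp only [Matrix.mul_apply, Matrix.transpose_apply]
  exact ContDiffOn.sum fun J _ => (h1 _ _).mul (h1 _ _)

/-- Two distinct variables are coprime. This is where n ≥ 2 is essential: in one variable ξ² divides
ξ · ξ but not ξ. -/
theorem quadForm_dvd_of_dvd_X_mul (hn : 2 ≤ n) {a : Fin n → Fin n → ℝ} (ha : quadForm a ≠ 0)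
    {σ : MvPolynomial (Fin n) ℝ} (h : ∀ i, quadForm a ∣ MvPolynomial.X i * σ) : quadForm a ∣ σ := by
  obtain ⟨τ, hτ⟩ := h ⟨0, by omega⟩
  obtain ⟨τ', hτ'⟩ := h ⟨1, by omega⟩
  set x : MvPolynomial (Fin n) ℝ := MvPolynomial.X ⟨0, by omega⟩ with hx
  set y : MvPolynomial (Fin n) ℝ := MvPolynomial.X ⟨1, by omega⟩ with hy
  have h1 : y * τ = x * τ' := mul_left_cancel₀ ha (by linear_combination x * hτ' - y * hτ)
  have hp : Prime x := MvPolynomial.X_prime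
  have hxy : ¬ x ∣ y := by
    rw [hx, hy, MvPolynomial.X_dvd_X]
    simp
  obtain ⟨ρ, rfl⟩ := (hp.dvd_or_dvd (Dvd.intro _ h1.symm)).resolve_left hxy
  exact ⟨ρ, mul_left_cancel₀ hp.ne_zero (by linear_combination hτ)⟩

theorem linearMap_quadForm_mul_mono (ℓ : MvPolynomial (Fin n) ℝ →ₗ[ℝ] ℝ)
    (a : Fin n → Fin n → ℝ) (K : Fin n → ℕ) :
    ℓ (quadForm a * mono K) = contract a (fun I => ℓ (mono I)) K := by
  simp only [quadForm, contract, Finset.sum_mul, map_sum, MvPolynomial.C_mul', smul_mul_assoc,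
    ← mono_add, map_smul, smul_eq_mul, add_comm K]

/-- A linear form on order `m` coordinates annihilates the kernel of the contraction if all its
shifts annihilate the kernel of the contraction one order higher. -/
theorem sum_mul_eq_zero_of_contract (hn : 2 ≤ n) {a : Fin n → Fin n → ℝ} (ha : quadForm a ≠ 0)
    (c : (Fin n → ℕ) → ℝ)
    (hc : ∀ η : (Fin n → ℕ) → ℝ, (∀ K, contract a η K = 0) →
      ∀ i, ∑ I ∈ homIdx n m, c I * η (I + e i) = 0)
    {θ : (Fin n → ℕ) → ℝ} (hθ : ∀ K, order K + 2 = m → contract a θ K = 0) :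
    ∑ I ∈ homIdx n m, c I * θ I = 0 := by
  set σ : MvPolynomial (Fin n) ℝ := ∑ I ∈ homIdx n m, c I • mono I with hσ
  have h1 : ∀ i, quadForm a ∣ MvPolynomial.X i * σ := by
    intro i
    -- Duality: an element outside the ideal (Q) is detected by a linear functional vanishing on
    -- (Q), and the values of such a functional on monomials form a family killed by the
    -- contraction.
    by_contra h
    rw [← Ideal.mem_span_singleton] at h
    obtain ⟨ℓ, hℓ, hker⟩ := Submodule.exists_le_ker_of_notMem
      (p := (Ideal.span {quadForm a}).restrictScalars ℝ) (v := MvPolynomial.X i * σ) h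
    apply hℓ
    have h2 := hc (fun I => ℓ (mono I)) (fun K => by
      rw [← linearMap_quadForm_mul_mono]
      exact hker (Ideal.mul_mem_right _ _ (Ideal.mem_span_singleton_self _))) i
    simpa only [hσ, Finset.mul_sum, mul_smul_comm, map_sum, map_smul, smul_eq_mul, ← mono_e,
      ← mono_add, add_comm (e i)] using h2
  obtain ⟨τ, hτ⟩ := quadForm_dvd_of_dvd_X_mul hn ha h1
  -- The functional with values θ_I on monomials of degree m and zero on all others. It kills (Q) by
  -- the hypothesis on θ.
  set ℓ : MvPolynomial (Fin n) ℝ →ₗ[ℝ] ℝ := ∑ I ∈ homIdx n m,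
    θ I • MvPolynomial.lcoeff ℝ (Finsupp.equivFunOnFinite.symm I) with hℓ
  have hmono : ∀ J, ℓ (mono J) = if order J = m then θ J else 0 := by
    intro J
    simp only [hℓ, LinearMap.sum_apply, LinearMap.smul_apply, MvPolynomial.lcoeff_apply, coeff_mono,
      smul_eq_mul, mul_ite, mul_one, mul_zero, Finset.sum_ite_eq, mem_homIdx]
  have hz : ℓ ∘ₗ LinearMap.mulLeft ℝ (quadForm a) = 0 := by
    refine MvPolynomial.linearMap_ext fun s => LinearMap.ext_ring ?_
    have h2 := linearMap_quadForm_mul_mono ℓ a (Finsupp.equivFunOnFinite s)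
    simp only [hmono] at h2
    change ℓ (quadForm a * MvPolynomial.monomial s 1) = 0
    have h3 : mono (Finsupp.equivFunOnFinite s) = MvPolynomial.monomial s 1 := by
      rw [mono, Equiv.symm_apply_apply]
    rw [← h3, h2, contract]
    simp only [order_add_e_add_e]
    split_ifs with h
    · exact hθ _ h
    · simp
  have h4 : ℓ σ = 0 := by
    rw [hτ]
    exact LinearMap.congr_fun hz τ
  rw [hσ, map_sum] at h4
  rw [← h4]
  refine Finset.sum_congr rfl fun I hI => ?_
  rw [map_smul, hmono, if_pos (mem_homIdx.1 hI), smul_eq_mul]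

end Symbol

end VarIF

/-! ### Projection of jets onto formal solutions. -/

namespace VarIF

variable {n k m : ℕ} {U V : Set (Jet1 n)} {f f' g : Jet n → ℝ} {z z' v w : Jet n}
  {A : Fin n → Fin n → Jet1 n → ℝ} {B : Jet1 n → ℝ} {G W : Jet n → ℝ}

section Projection

/-- The jets `z` and `z'` have the same `k`-jet. -/
def EqUpTo (k : ℕ) (z z' : Jet n) : Prop := z.1 = z'.1 ∧ ∀ I, order I ≤ k → z.2 I = z'.2 I

theorem EqUpTo.refl (k : ℕ) (z : Jet n) : EqUpTo k z z := ⟨rfl, fun _ _ => rfl⟩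

theorem EqUpTo.symm (h : EqUpTo k z z') : EqUpTo k z' z := ⟨h.1.symm, fun I hI => (h.2 I hI).symm⟩

theorem EqUpTo.trans (h : EqUpTo k z z') (h' : EqUpTo k z' w) : EqUpTo k z w :=
  ⟨h.1.trans h'.1, fun I hI => (h.2 I hI).trans (h'.2 I hI)⟩

theorem EqUpTo.mono (h : EqUpTo k z z') (hm : m ≤ k) : EqUpTo m z z' :=
  ⟨h.1, fun I hI => h.2 I (hI.trans hm)⟩

theorem EqUpTo.toJet1_eq (h : EqUpTo k z z') (hk : 1 ≤ k) : toJet1 z = toJet1 z' :=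
  toJet1_congr h.1 fun I hI => h.2 I (hI.trans hk)

theorem EqUpTo.toKJet_eq (h : EqUpTo k z z') : toKJet k z = toKJet k z' :=
  Prod.ext h.1 (funext fun I => h.2 I (mem_multiIdx.1 I.2))

theorem SmoothOfOrderLE.eq_of_eqUpTo (hf : SmoothOfOrderLE U k f) (h : EqUpTo k z z')
    (hz : toJet1 z ∈ U) : f z = f z' :=
  hf.1 z z' hz h.1 h.2

theorem SmoothOfOrderLE.dirD_eq_of_eqUpTo (hf : SmoothOfOrderLE U k f) (hU : IsOpen U)
    (hk : 1 ≤ k) (h : EqUpTo k z z') (hz : toJet1 z ∈ U) (v : Jet n) :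
    dirD f z v = dirD f z' v := by
  rw [hf.dirD_eq hU hk hz, hf.dirD_eq hU hk (h.toJet1_eq hk ▸ hz), h.toKJet_eq]

theorem SmoothOfOrderLE.comp_jet (hf : SmoothOfOrderLE U k f) (hk : 1 ≤ k) (hm : 1 ≤ m)
    {Φ : Jet n → Jet n} (h1 : ∀ z, (Φ z).1 = z.1)
    (h2 : ∀ I, order I ≤ k → SmoothOfOrderLE U m fun z => (Φ z).2 I)
    (hU : ∀ z, toJet1 z ∈ U → toJet1 (Φ z) ∈ U) : SmoothOfOrderLE U m fun z => f (Φ z) := by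
  refine SmoothOfOrderLE.congr hm (SmoothOfOrderLE.comp (U := U) (k := m)
    (X := fun z => toKJet k (Φ z)) hf.2 hm (fun z hz => ?_) ?_ fun z hz => ?_)
    fun z hz => hf.eq (hU z hz)
  · refine Prod.ext ?_ (funext fun I => ?_)
    · change (Φ z).1 = (Φ _).1
      rw [h1, h1]
      rfl
    · exact (h2 I (mem_multiIdx.1 I.2)).eq hz
  · refine ContDiffOn.prodMk ?_ (contDiffOn_pi.2 fun I => (h2 I (mem_multiIdx.1 I.2)).2)
    simp only [h1]
    exact contDiff_fst.contDiffOn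
  · exact (toKJet_mem_kdom hk).2 (hU z hz)

theorem IsSymmQuasilinear.smooth_iterD (hG : IsSymmQuasilinear V A B G) (hV : IsOpen V)
    (K : Fin n → ℕ) : SmoothOfOrderLE V (order K + 2) (iterD K G) := by
  have hd : IsDifferentialFunction V G := ⟨2, by norm_num, hG.smooth⟩
  induction K using multiIdx_induction with
  | h0 => simpa only [iterD_zero, order_zero] using hG.smooth
  | hs K i ih =>
    have h := (ih.totalDeriv hV (by omega) i).congr (by omega)
      fun z hz => hd.iterD_add_e hV hz K i
    have ho : order (K + e i) + 2 = order K + 2 + 1 := by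
      rw [order_add, order_e]
    rwa [ho]

/-- The total derivative `D^K G` is affine in the coordinates of highest order. -/
theorem IsSymmQuasilinear.iterD_sub (hG : IsSymmQuasilinear V A B G) (hV : IsOpen V)
    (K : Fin n → ℕ) (h : EqUpTo (order K + 1) z z') (hz : toJet1 z ∈ V) :
    iterD K G z' - iterD K G z =
      contract (fun i j => A i j (toJet1 z)) (fun I => z'.2 I - z.2 I) K := by
  have hd : IsDifferentialFunction V G := ⟨2, by norm_num, hG.smooth⟩
  induction K using multiIdx_induction generalizing z z' with
  | h0 =>
    have h1 : toJet1 z' = toJet1 z := (h.toJet1_eq (by omega)).symm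
    rw [iterD_zero, hG.eq z hz, hG.eq z' (h1 ▸ hz), h1, add_sub_add_right_eq_sub]
    simp only [contract, zero_add, mul_sub, Finset.sum_sub_distrib]
  | hs K i ih =>
    have h' : EqUpTo (order K + 2) z z' := h.mono (by rw [order_add, order_e])
    have h1 : toJet1 z' = toJet1 z := (h.toJet1_eq (by omega)).symm
    have hF := hG.smooth_iterD hV K
    have hk : 1 ≤ order K + 2 := by omega
    rw [hd.iterD_add_e hV hz, hd.iterD_add_e hV (h1 ▸ hz), hF.totalDeriv_eq hV hk hz,
      hF.totalDeriv_eq hV hk (h1 ▸ hz), ← hF.dirD_eq_of_eqUpTo hV hk h' hz,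
      ← hF.dirD_sub hV hk hz]
    -- Since the jets agree up to order |K| + 2, this difference is vertical and begins in order |K|
    -- + 2, so the induction hypothesis computes the derivative of D^K G along it.
    set u : Jet n := cartan i z' - cartan i z with hu
    have hu1 : u.1 = 0 := sub_self _
    have hu2 : ∀ I, order I ≤ order K + 1 → u.2 I = 0 := fun I hI =>
      sub_eq_zero.2 (h'.2 _ (by rw [order_add, order_e]; omega)).symm
    have hline : ∀ t : ℝ, iterD K G (z + t • u) =
        iterD K G z + t * contract (fun i j => A i j (toJet1 z)) u.2 K := by
      intro t
      rw [← sub_eq_iff_eq_add', ih (z := z) (z' := z + t • u) ⟨by simp [hu1], fun I hI => by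
        simp [hu2 I hI]⟩ hz]
      simp only [contract, Finset.mul_sum, Prod.snd_add, Prod.smul_snd, Pi.add_apply,
        Pi.smul_apply, smul_eq_mul, add_sub_cancel_left]
      exact Finset.sum_congr rfl fun _ _ => Finset.sum_congr rfl fun _ _ => by ring
    have : dirD (iterD K G) z u = contract (fun i j => A i j (toJet1 z)) u.2 K := by
      simp only [dirD, hline]
      simp
    rw [this]
    simp only [contract, add_right_comm K (e i)]
    rfl

/-- The correction of the coordinates of order `m + 2` making the total derivatives of `G` of
order `m` vanish. -/
noncomputable def correct (A : Fin n → Fin n → Jet1 n → ℝ) (G : Jet n → ℝ) (m : ℕ) (z : Jet n) :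
    Jet n :=
  (z.1, fun I => z.2 I - if h : I ∈ homIdx n (m + 2) then
    ∑ K : homIdx n m, contractInv m (fun i j => A i j (toJet1 z)) ⟨I, h⟩ K * iterD K G z else 0)

theorem correct_apply_of_ne {I : Fin n → ℕ} (h : order I ≠ m + 2) :
    (correct A G m z).2 I = z.2 I := by
  simp [correct, mem_homIdx, h]

theorem eqUpTo_correct (A : Fin n → Fin n → Jet1 n → ℝ) (G : Jet n → ℝ) (m : ℕ) (z : Jet n) :
    EqUpTo (m + 1) (correct A G m z) z :=
  ⟨rfl, fun _ hI => correct_apply_of_ne (by omega)⟩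

theorem correct_eq_self (h : ∀ K, order K = m → iterD K G z = 0) : correct A G m z = z := by
  refine Prod.ext rfl (funext fun I => ?_)
  have : ∀ K : homIdx n m, iterD (K : Fin n → ℕ) G z = 0 := fun K => h K (mem_homIdx.1 K.2)
  simp [correct, this]

/-- By `iterD_sub` the correction changes D^K G by the contraction of minus a right inverse applied
to the values of D^K G, that is, by -D^K G. -/
theorem IsSymmQuasilinear.iterD_correct (hG : IsSymmQuasilinear V A B G) (hV : IsOpen V)
    (ha : ∀ q ∈ V, quadForm (fun i j => A i j q) ≠ 0) (hz : toJet1 z ∈ V) {K : Fin n → ℕ}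
    (hK : order K = m) : iterD K G (correct A G m z) = 0 := by
  have h1 := hG.iterD_sub hV K (z := z) (z' := correct A G m z)
    (by rw [hK]; exact (eqUpTo_correct A G m z).symm) hz
  rw [← sub_add_cancel (iterD K G (correct A G m z)) (iterD K G z), h1]
  set a : Fin n → Fin n → ℝ := fun i j => A i j (toJet1 z) with hadef
  have h2 := sum_contractMatrix_mul a (fun I => (correct A G m z).2 I - z.2 I)
    ⟨K, mem_homIdx.2 hK⟩
  rw [← h2]
  have h3 : ∀ I : homIdx n (m + 2), (correct A G m z).2 I - z.2 I =
      -(contractInv m a).mulVec (fun K : homIdx n m => iterD K G z) I := fun I => by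
    simp [correct, Matrix.mulVec, dotProduct, hadef]
  simp only [h3, mul_neg, Finset.sum_neg_distrib]
  have h4 := congrFun (Matrix.mulVec_mulVec (fun K : homIdx n m => iterD K G z)
    (contractMatrix m a) (contractInv m a)) ⟨K, mem_homIdx.2 hK⟩
  rw [contractMatrix_mul_contractInv (ha _ hz), Matrix.one_mulVec] at h4
  rw [Matrix.mulVec, dotProduct] at h4
  rw [h4, neg_add_cancel]

/-- The correction of the coordinates of orders `2, …, m + 1`. -/
noncomputable def level (A : Fin n → Fin n → Jet1 n → ℝ) (G : Jet n → ℝ) : ℕ → Jet n → Jet n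
  | 0 => id
  | m + 1 => fun z => correct A G m (level A G m z)

theorem level_succ (z : Jet n) : level A G (m + 1) z = correct A G m (level A G m z) := rfl

/-- Later corrections act in ever higher orders, so each coordinate stabilizes. -/
theorem eqUpTo_level {m' : ℕ} (h : m ≤ m') : EqUpTo (m + 1) (level A G m' z) (level A G m z) := by
  induction m', h using Nat.le_induction with
  | base => exact .refl _ _
  | succ m' h ih =>
    exact ((eqUpTo_correct A G m' (level A G m' z)).mono (by omega)).trans ih

theorem toJet1_level (z : Jet n) : toJet1 (level A G m z) = toJet1 z :=
  (eqUpTo_level (Nat.zero_le m)).toJet1_eq le_rfl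

theorem level_eq_self (h : ∀ K, order K < m → iterD K G z = 0) : level A G m z = z := by
  induction m with
  | zero => rfl
  | succ m ih =>
    rw [level_succ, ih fun K hK => h K (by omega), correct_eq_self fun K hK => h K (by omega)]

theorem IsSymmQuasilinear.iterD_level (hG : IsSymmQuasilinear V A B G) (hV : IsOpen V)
    (ha : ∀ q ∈ V, quadForm (fun i j => A i j q) ≠ 0) (hz : toJet1 z ∈ V) {K : Fin n → ℕ}
    (hK : order K < m) : iterD K G (level A G m z) = 0 := by
  have h1 : iterD K G (level A G (order K + 1) z) = 0 := by
    rw [level_succ]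
    exact hG.iterD_correct hV ha (by rwa [toJet1_level]) rfl
  rw [(hG.smooth_iterD hV K).eq_of_eqUpTo (eqUpTo_level hK) (by rwa [toJet1_level]), h1]

/-- A projection onto the formal solutions of `G = 0`. -/
noncomputable def proj (A : Fin n → Fin n → Jet1 n → ℝ) (G : Jet n → ℝ) (z : Jet n) : Jet n :=
  (z.1, fun I => (level A G (order I) z).2 I)

/-- A coordinate of order r ≥ 1 is final from level r - 1 on, so reading it at level r, as `proj`
does, gives its limit. -/
theorem eqUpTo_proj (m : ℕ) (z : Jet n) : EqUpTo (m + 1) (proj A G z) (level A G m z) := by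
  refine ⟨(eqUpTo_level (A := A) (G := G) (z := z) (Nat.zero_le m)).1.symm, fun I hI => ?_⟩
  rcases le_total (order I) m with h | h
  · exact ((eqUpTo_level h).2 I (by omega)).symm
  · exact (eqUpTo_level h).2 I hI

theorem toJet1_proj (z : Jet n) : toJet1 (proj A G z) = toJet1 z :=
  (eqUpTo_proj 0 z).toJet1_eq le_rfl

theorem eqUpTo_proj_self (h : ∀ K, order K < m → iterD K G z = 0) :
    EqUpTo (m + 1) (proj A G z) z := by
  have := eqUpTo_proj (A := A) (G := G) m z
  rwa [level_eq_self h] at this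

theorem IsSymmQuasilinear.isFormalSolution_proj (hG : IsSymmQuasilinear V A B G) (hV : IsOpen V)
    (ha : ∀ q ∈ V, quadForm (fun i j => A i j q) ≠ 0) (hz : toJet1 z ∈ V) :
    IsFormalSolution G (proj A G z) := fun K => by
  rw [(hG.smooth_iterD hV K).eq_of_eqUpTo (eqUpTo_proj (order K + 1) z) (by rwa [toJet1_proj])]
  exact hG.iterD_level hV ha hz (Nat.lt_succ_self _)

/-- Level m uses D^K G with |K| < m, of order at most m + 1; hence the bound on k. -/
theorem IsSymmQuasilinear.smooth_level (hG : IsSymmQuasilinear V A B G) (hV : IsOpen V)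
    (ha : ∀ q ∈ V, quadForm (fun i j => A i j q) ≠ 0) (hm : m + 1 ≤ k) {I : Fin n → ℕ}
    (hI : order I ≤ k) : SmoothOfOrderLE V k fun z => (level A G m z).2 I := by
  induction m generalizing I with
  | zero => exact smoothOfOrderLE_coord hI
  | succ m ih =>
    have ih' := fun {I : Fin n → ℕ} (hI : order I ≤ k) => ih (by omega) hI
    simp only [level_succ, correct]
    split_ifs with h
    · refine (ih' hI).sub (.sum _ fun K _ => ?_)
      simp only [toJet1_level]
      refine .mul (.toJet1_comp (contDiffOn_contractInv hG.smooth_A ha m _ _) (by omega)) ?_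
      have hK : order (K : Fin n → ℕ) = m := mem_homIdx.1 K.2
      exact (hG.smooth_iterD hV K).comp_jet (by omega) (by omega)
        (fun z => (eqUpTo_level (Nat.zero_le m)).1) (fun I hI => ih' (by omega))
        fun z hz => by rwa [toJet1_level]
    · simpa only [sub_zero] using ih' hI

/-- Every term of the correction has a factor D^K G that vanishes to first order at t. -/
theorem IsSymmQuasilinear.hasVelocity_correct (hG : IsSymmQuasilinear V A B G) (hV : IsOpen V)
    (ha : ∀ q ∈ V, quadForm (fun i j => A i j q) ≠ 0) {γ : ℝ → Jet n} {t : ℝ}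
    (hγ : HasVelocity γ v t) (hz : toJet1 (γ t) ∈ V)
    (h : ∀ K, order K = m → iterD K G (γ t) = 0)
    (h' : ∀ K, order K = m → dirD (iterD K G) (γ t) v = 0) :
    HasVelocity (fun s => correct A G m (γ s)) v t := by
  refine ⟨hγ.1, fun I => ?_⟩
  by_cases hI : I ∈ homIdx n (m + 2)
  · simp only [correct, hI, dite_true]
    have h1 : ∀ K : homIdx n m, HasDerivAt (fun s =>
        contractInv m (fun i j => A i j (toJet1 (γ s))) ⟨I, hI⟩ K * iterD K G (γ s)) 0 t := by
      intro K
      have hK : order (K : Fin n → ℕ) = m := mem_homIdx.1 K.2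
      have h2 := (SmoothOfOrderLE.toJet1_comp
        (contDiffOn_contractInv hG.smooth_A ha m ⟨I, hI⟩ K) le_rfl).hasDerivAt hV le_rfl hγ hz
      have h3 := (hG.smooth_iterD hV K).hasDerivAt hV (by omega) hγ hz
      rw [h' K hK] at h3
      have h4 := h2.fun_mul h3
      rwa [h K hK, mul_zero, mul_zero, add_zero] at h4
    have h5 := (hγ.2 I).fun_sub (HasDerivAt.fun_sum fun K (_ : K ∈ Finset.univ) => h1 K)
    simpa only [Finset.sum_const_zero, sub_zero] using h5
  · simpa only [correct, hI, dite_false, sub_zero] using hγ.2 I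

/-- In the direction of D_i the derivative of D^K G is D^{K + e_i} G, which is zero at a formal
solution, so no correction changes the velocity. -/
theorem IsSymmQuasilinear.hasVelocity_proj (hG : IsSymmQuasilinear V A B G) (hV : IsOpen V)
    (ha : ∀ q ∈ V, quadForm (fun i j => A i j q) ≠ 0) {γ : ℝ → Jet n} {t : ℝ} {i : Fin n}
    (hγ : HasVelocity γ (cartan i (γ t)) t) (hz : toJet1 (γ t) ∈ V)
    (h : IsFormalSolution G (γ t)) :
    HasVelocity (fun s => proj A G (γ s)) (cartan i (γ t)) t := by
  have hd : IsDifferentialFunction V G := ⟨2, by norm_num, hG.smooth⟩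
  have hl : ∀ m, HasVelocity (fun s => level A G m (γ s)) (cartan i (γ t)) t := by
    intro m
    induction m with
    | zero => exact hγ
    | succ m ih =>
      have hs : level A G m (γ t) = γ t := level_eq_self fun K _ => h K
      refine hG.hasVelocity_correct hV ha ih (by rwa [hs]) (fun K _ => by rw [hs, h K])
        fun K _ => ?_
      rw [hs, ← (hG.smooth_iterD hV K).totalDeriv_eq hV (by omega) hz, ← hd.iterD_add_e hV hz]
      exact h _
  exact ⟨hγ.1, fun I => (hl (order I)).2 I⟩

theorem IsFormalSolution.proj_eq_self (h : IsFormalSolution G z) : proj A G z = z :=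
  Prod.ext rfl (funext fun _ => by simp only [proj, level_eq_self fun K _ => h K])

/-- The total derivatives are tangent to the set of formal solutions. -/
theorem IsSymmQuasilinear.totalDeriv_eq_of_eqOn (hG : IsSymmQuasilinear V A B G) (hV : IsOpen V)
    (ha : ∀ q ∈ V, quadForm (fun i j => A i j q) ≠ 0) (hf : IsDifferentialFunction V f)
    (hf' : IsDifferentialFunction V f')
    (h : ∀ z, toJet1 z ∈ V → IsFormalSolution G z → f z = f' z) (hz : toJet1 z ∈ V)
    (hs : IsFormalSolution G z) (i : Fin n) : totalDeriv i f z = totalDeriv i f' z := by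
  obtain ⟨k, hk, hf⟩ := hf
  obtain ⟨k', hk', hf'⟩ := hf'
  -- The line in the direction of D_i need not consist of formal solutions. Its projection does, has
  -- the same velocity at z, and carries f = f'.
  set γ : ℝ → Jet n := fun t => z + t • cartan i z with hγdef
  have h0 : γ 0 = z := by simp [hγdef]
  have hp0 : proj A G (γ 0) = z := by rw [h0, hs.proj_eq_self]
  have hγ : HasVelocity γ (cartan i (γ 0)) 0 := by
    rw [h0]
    exact hasVelocity_line z _ 0
  have hp := hG.hasVelocity_proj hV ha hγ (by rwa [h0]) (by rwa [h0])
  have h1 := hf.hasDerivAt hV hk hp (by rwa [hp0])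
  have h2 := hf'.hasDerivAt hV hk' hp (by rwa [hp0])
  rw [hp0, h0, ← hf.totalDeriv_eq hV hk hz] at h1
  rw [hp0, h0, ← hf'.totalDeriv_eq hV hk' hz] at h2
  refine h1.unique (h2.congr_of_eventuallyEq ?_)
  filter_upwards [hγ.eventually hV (by rwa [h0])] with s hs
  exact h _ (by rwa [toJet1_proj]) (hG.isFormalSolution_proj hV ha hs)

end Projection

end VarIF

/-! ### Functions whose total derivatives vanish on formal solutions. -/

namespace VarIF

variable {n k m : ℕ} {U V : Set (Jet1 n)} {f f' g : Jet n → ℝ} {z z' v w θ : Jet n}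
  {A : Fin n → Fin n → Jet1 n → ℝ} {B : Jet1 n → ℝ} {G W : Jet n → ℝ}

section FirstIntegrals

theorem SmoothOfOrderLE.dirD_of_top (hf : SmoothOfOrderLE U m f) (hU : IsOpen U) (hm : 1 ≤ m)
    (hz : toJet1 z ∈ U) (h1 : θ.1 = 0) (h2 : ∀ I, order I < m → θ.2 I = 0) :
    dirD f z θ = ∑ I ∈ homIdx n m, VarIF.du I f z * θ.2 I := by
  rw [hf.dirD_expand hU hm hz, h1]
  simp only [Pi.zero_apply, zero_mul, Finset.sum_const_zero, zero_add]
  rw [homIdx, Finset.sum_filter]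
  refine Finset.sum_congr rfl fun I hI => ?_
  split_ifs with h
  · exact mul_comm _ _
  · rw [h2 I (lt_of_le_of_ne (mem_multiIdx.1 hI) h), zero_mul]

theorem IsSymmQuasilinear.iterD_add (hG : IsSymmQuasilinear V A B G) (hV : IsOpen V)
    (hz : toJet1 z ∈ V) (h1 : θ.1 = 0) {K : Fin n → ℕ}
    (h2 : ∀ I, order I ≤ order K + 1 → θ.2 I = 0) :
    iterD K G (z + θ) = iterD K G z + contract (fun i j => A i j (toJet1 z)) θ.2 K := by
  rw [← sub_eq_iff_eq_add', hG.iterD_sub hV K (z := z) (z' := z + θ)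
    ⟨by simp [h1], fun I hI => by simp [h2 I hI]⟩ hz]
  simp

theorem contract_eq_zero {a : Fin n → Fin n → ℝ} {y : (Fin n → ℕ) → ℝ} {K : Fin n → ℕ}
    (h : ∀ I, order I = order K + 2 → y I = 0) : contract a y K = 0 := by
  simp only [contract, h _ (order_add_e_add_e K _ _), mul_zero, Finset.sum_const_zero]

/-- If all total derivatives of `f` vanish on formal solutions, then `f` is stationary in the
directions of highest order tangent to the set of formal solutions. -/
theorem IsSymmQuasilinear.dirD_eq_zero_of_contract (hn : 2 ≤ n) (hG : IsSymmQuasilinear V A B G)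
    (hV : IsOpen V) (ha : ∀ q ∈ V, quadForm (fun i j => A i j q) ≠ 0)
    (hf : SmoothOfOrderLE V (m + 1) f)
    (hD : ∀ z, toJet1 z ∈ V → IsFormalSolution G z → ∀ i, totalDeriv i f z = 0)
    (hz : toJet1 z ∈ V) (hs : ∀ K, order K < m → iterD K G z = 0) (h1 : θ.1 = 0)
    (h2 : ∀ I, order I < m + 1 → θ.2 I = 0)
    (hθ : ∀ K, order K + 2 = m + 1 → contract (fun i j => A i j (toJet1 z)) θ.2 K = 0) :
    dirD f z θ = 0 := by
  have hm : 1 ≤ m + 1 := by omega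
  have hE : EqUpTo (m + 1) (proj A G z) z := eqUpTo_proj_self hs
  have hs₀ : IsFormalSolution G (proj A G z) := hG.isFormalSolution_proj hV ha hz
  set z₀ := proj A G z with hz₀def
  have hz₁ : toJet1 z₀ = toJet1 z := toJet1_proj z
  have hz₀ : toJet1 z₀ ∈ V := hz₁ ▸ hz
  rw [← hf.dirD_eq_of_eqUpTo hV hm hE hz₀, hf.dirD_of_top hV hm hz₀ h1 h2]
  refine sum_mul_eq_zero_of_contract hn (ha _ hz) (fun I => du I f z₀) (fun η hη i => ?_) hθ
  -- The formal solution is perturbed in order m + 2 by a family killed by the contraction. The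
  -- equations D^K G = 0 with |K| ≤ m persist, and the projection restores the others without
  -- changing orders up to m + 2.
  set ζ : Jet n := (0, fun I => if order I = m + 2 then η I else 0) with hζ
  have hζ0 : ∀ I, order I ≤ m + 1 → ζ.2 I = 0 := fun I hI => if_neg (by omega)
  have hw : toJet1 (z₀ + ζ) ∈ V := by
    rw [toJet1_add, toJet1_eq_zero rfl fun I hI => hζ0 I (by omega), add_zero]
    exact hz₀
  have hws : ∀ K, order K < m + 1 → iterD K G (z₀ + ζ) = 0 := by
    intro K hK
    rw [hG.iterD_add hV hz₀ rfl fun I hI => hζ0 I (by omega), hs₀ K, zero_add]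
    by_cases h : order K = m
    · rw [hz₁, ← hη K, contract, contract]
      simp only [hζ, order_add_e_add_e, h, if_true]
    · exact contract_eq_zero fun I hI => if_neg (by omega)
  have hE' : EqUpTo (m + 2) (proj A G (z₀ + ζ)) (z₀ + ζ) := eqUpTo_proj_self hws
  have hs' := hG.isFormalSolution_proj hV ha hw
  set w := proj A G (z₀ + ζ) with hwdef
  have hwV : toJet1 w ∈ V := by rwa [hwdef, toJet1_proj]
  have hwz : EqUpTo (m + 1) w z₀ := (hE'.mono (by omega)).trans
    ⟨by simp [hζ], fun I hI => by simp [hζ0 I hI]⟩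
  have h3 := hD w hwV hs' i
  have h4 := hD z₀ hz₀ hs₀ i
  rw [hf.totalDeriv_eq hV hm hwV, hf.dirD_eq_of_eqUpTo hV hm hwz hwV] at h3
  rw [hf.totalDeriv_eq hV hm hz₀] at h4
  -- D_i f vanishes at both formal solutions, and f has the same differential at both; the
  -- difference is the top symbol of f paired with the shift of η by e_i.
  have h5 : dirD f z₀ (cartan i w - cartan i z₀) = 0 := by
    rw [hf.dirD_sub hV hm hz₀, h3, h4, sub_zero]
  have h6 : ∀ I, (cartan i w - cartan i z₀ : Jet n).2 I = w.2 (I + e i) - z₀.2 (I + e i) :=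
    fun I => rfl
  rw [hf.dirD_of_top hV hm hz₀ (sub_self _) fun I hI => by
    rw [h6, hwz.2 _ (by rw [order_add, order_e]; omega), sub_self]] at h5
  rw [← h5]
  refine Finset.sum_congr rfl fun I hI => ?_
  have hI' : order (I + e i) = m + 2 := by rw [order_add, order_e, mem_homIdx.1 hI]
  rw [h6, hE'.2 _ hI'.le]
  simp [hζ, hI']

/-- The truncation of a jet at order `k`. -/
noncomputable def trunc (k : ℕ) (z : Jet n) : Jet n := ofKJet (toKJet k z)

theorem eqUpTo_trunc (k : ℕ) (z : Jet n) : EqUpTo k (trunc k z) z :=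
  ⟨rfl, fun _ hI => ofKJet_toKJet_apply hI z⟩

theorem smooth_trunc (hk : 1 ≤ k) (I : Fin n → ℕ) :
    SmoothOfOrderLE U k fun z => (trunc k z).2 I := by
  by_cases h : order I ≤ k
  · exact (smoothOfOrderLE_coord h).congr hk fun z _ => ofKJet_toKJet_apply h z
  · refine (smoothOfOrderLE_const hk 0).congr hk fun z _ => ?_
    simp [trunc, ofKJet, mem_multiIdx, h]

/-- On formal solutions, a function whose total derivatives vanish there coincides with a function
of lower order. -/
theorem IsSymmQuasilinear.exists_lower_order (hn : 2 ≤ n) (hG : IsSymmQuasilinear V A B G)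
    (hV : IsOpen V) (ha : ∀ q ∈ V, quadForm (fun i j => A i j q) ≠ 0)
    (hf : SmoothOfOrderLE V (m + 2) f)
    (hD : ∀ z, toJet1 z ∈ V → IsFormalSolution G z → ∀ i, totalDeriv i f z = 0) :
    ∃ f', SmoothOfOrderLE V (m + 1) f' ∧
      ∀ z, toJet1 z ∈ V → IsFormalSolution G z → f z = f' z := by
  have htV : ∀ z : Jet n, toJet1 z ∈ V → toJet1 (trunc (m + 1) z) ∈ V := fun z hz => by
    rwa [(eqUpTo_trunc (m + 1) z).toJet1_eq (by omega)]
  -- The coordinates of order m + 2 are forgotten and refilled by the correction procedure, so the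
  -- value depends on the (m + 1)-jet only.
  refine ⟨fun z => f (level A G (m + 1) (trunc (m + 1) z)), ?_, fun z hz hs => ?_⟩
  · have h1 : SmoothOfOrderLE V (m + 2) fun z => f (level A G (m + 1) z) :=
      hf.comp_jet (by omega) (by omega) (fun z => (eqUpTo_level (Nat.zero_le _)).1)
        (fun I hI => hG.smooth_level hV ha (by omega) hI) fun z hz => by rwa [toJet1_level]
    exact h1.comp_jet (by omega) (by omega) (fun z => rfl) (fun I _ => smooth_trunc (by omega) I) htV
  · change f z = f (level A G (m + 1) (trunc (m + 1) z))
    have ht := eqUpTo_trunc (m + 1) z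
    have h1 : level A G m (trunc (m + 1) z) = trunc (m + 1) z := level_eq_self fun K hK => by
      rw [(hG.smooth_iterD hV K).eq_of_eqUpTo (ht.mono (by omega)) (htV z hz), hs K]
    have hE : EqUpTo (m + 1) (level A G (m + 1) (trunc (m + 1) z)) z := by
      have h2 := eqUpTo_level (A := A) (G := G) (z := trunc (m + 1) z) (Nat.le_succ m)
      rw [h1] at h2
      exact h2.trans ht
    have hws : ∀ K, order K < m + 1 → iterD K G (level A G (m + 1) (trunc (m + 1) z)) = 0 :=
      fun K hK => hG.iterD_level hV ha (htV z hz) hK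
    set w := level A G (m + 1) (trunc (m + 1) z) with hw
    -- Up to order m + 2 the refilled jet differs from z by a top-order direction killed by the
    -- contraction. Jets on the segment satisfy D^K G = 0 only for |K| ≤ m, which is all that
    -- `dirD_eq_zero_of_contract` requires.
    set θ : Jet n := (0, fun I => if order I = m + 2 then w.2 I - z.2 I else 0) with hθ
    have hθ0 : ∀ I, order I ≤ m + 1 → θ.2 I = 0 := fun I hI => if_neg (by omega)
    have hθc : ∀ K, order K < m + 1 → contract (fun i j => A i j (toJet1 z)) θ.2 K = 0 := by
      intro K hK
      by_cases h : order K = m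
      · have h3 := hG.iterD_sub hV K (hE.symm.mono (by omega)) hz
        rw [hws K hK, hs K, sub_zero] at h3
        rw [h3, contract, contract]
        simp only [hθ, order_add_e_add_e, h, if_true]
      · exact contract_eq_zero fun I hI => if_neg (by omega)
    have hl1 : ∀ t : ℝ, toJet1 (z + t • θ) = toJet1 z := fun t => by
      rw [toJet1_add, toJet1_smul, toJet1_eq_zero rfl fun I hI => hθ0 I (by omega), smul_zero,
        add_zero]
    have hl2 : ∀ t : ℝ, ∀ K, order K < m + 1 → iterD K G (z + t • θ) = 0 := by
      intro t K hK
      rw [hG.iterD_add hV hz (by simp [hθ]) fun I hI => by simp [hθ0 I (by omega)], hs K, zero_add]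
      have h4 := hθc K hK
      rw [contract] at h4
      rw [contract, ← mul_zero t, ← h4]
      simp only [Finset.mul_sum, Prod.smul_snd, Pi.smul_apply, smul_eq_mul]
      exact Finset.sum_congr rfl fun _ _ => Finset.sum_congr rfl fun _ _ => by ring
    have hder : ∀ t : ℝ, HasDerivAt (fun s => f (z + s • θ)) 0 t := by
      intro t
      have h5 := hf.hasDerivAt hV (by omega) (hasVelocity_line z θ t) (by rwa [hl1])
      rwa [hG.dirD_eq_zero_of_contract hn hV ha hf hD (by rwa [hl1]) (hl2 t) rfl
        (fun I hI => hθ0 I (by omega)) (fun K hK => by rw [hl1]; exact hθc K (by omega))] at h5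
    have h6 := is_const_of_deriv_eq_zero (fun t => (hder t).differentiableAt)
      (fun t => (hder t).deriv) 0 1
    simp only [zero_smul, add_zero, one_smul] at h6
    rw [h6]
    refine hf.eq_of_eqUpTo ⟨by simpa [hθ] using hE.1.symm, fun I hI => ?_⟩ ?_
    · by_cases h : order I = m + 2
      · simp [hθ, h]
      · simp [hθ, h, hE.2 I (by omega)]
    · have := hl1 1
      rw [one_smul] at this
      rwa [this]

/-- In order one the contraction condition is void, so f_{u_i} = 0. Then D_i f no longer involves
second-order coordinates and vanishes at all jets; the commutator [∂/∂u_i, D_i] = ∂/∂u gives f_u =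
0, and D_i f = 0 finally gives f_{x^i} = 0. -/
theorem IsSymmQuasilinear.eq_of_order_one (hn : 2 ≤ n) (hG : IsSymmQuasilinear V A B G)
    (hV : IsOpen V) (hVc : Convex ℝ V) (ha : ∀ q ∈ V, quadForm (fun i j => A i j q) ≠ 0)
    (hf : SmoothOfOrderLE V 1 f)
    (hD : ∀ z, toJet1 z ∈ V → IsFormalSolution G z → ∀ i, totalDeriv i f z = 0)
    (hz : toJet1 z ∈ V) (hz' : toJet1 z' ∈ V) : f z = f z' := by
  have hvert : ∀ z, toJet1 z ∈ V → ∀ θ : Jet n, θ.1 = 0 → θ.2 0 = 0 → dirD f z θ = 0 :=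
    fun z hz θ h1 h2 => hG.dirD_eq_zero_of_contract hn hV ha hf hD hz (fun K hK => by omega) h1
      (fun I hI => by
        have : I = 0 := funext fun i => by
          simpa using Finset.sum_eq_zero_iff.1 (Nat.lt_one_iff.1 hI) i (Finset.mem_univ i)
        rw [this, h2]) fun K hK => by omega
  have htot : ∀ z, toJet1 z ∈ V → ∀ i, totalDeriv i f z = 0 := by
    intro z hz i
    have hE : EqUpTo 1 (proj A G z) z := eqUpTo_proj 0 z
    have hp : toJet1 (proj A G z) ∈ V := by rwa [toJet1_proj]
    have h1 := hD _ hp (hG.isFormalSolution_proj hV ha hz) i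
    rw [hf.totalDeriv_eq hV le_rfl hp, hf.dirD_eq_of_eqUpTo hV le_rfl hE hp] at h1
    have h2 := hvert z hz (cartan i z - cartan i (proj A G z)) (sub_self _) (by
      change z.2 (0 + e i) - (proj A G z).2 (0 + e i) = 0
      rw [zero_add, hE.2 _ (order_e i).le, sub_self])
    rwa [hf.dirD_sub hV le_rfl hz, h1, sub_zero, ← hf.totalDeriv_eq hV le_rfl hz] at h2
  have hzero : ∀ (z : Jet n) v, dirD (fun _ => (0 : ℝ)) z v = 0 := fun z v => by simp [dirD]
  have he : ∀ z, toJet1 z ∈ V → ∀ i, dirD f z (vert (e i)) = 0 := fun z hz i =>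
    hvert z hz _ rfl (by simp [vert, (e_ne_zero i).symm])
  have hdu : ∀ z, toJet1 z ∈ V → du 0 f z = 0 := by
    intro z hz
    set i : Fin n := ⟨0, by omega⟩ with hi
    have h1 := hf.dirD_totalDeriv hV le_rfl hz i (vert (e i))
    rw [dirD_congr hV (fun z hz => htot z hz i) hz, hzero,
      dirD_congr hV (fun z hz => he z hz i) hz, hzero, zero_add, shift_vert,
      if_pos (by simp [e]), tsub_self] at h1
    rw [du_eq_dirD, ← h1]
  have hdu' : ∀ z, toJet1 z ∈ V → ∀ v : Jet n, dirD f z v = ∑ i, v.1 i * dx i f z := by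
    intro z hz v
    rw [hf.dirD_expand hV le_rfl hz, add_eq_left]
    refine Finset.sum_eq_zero ?_
    intro I hI
    rcases mem_multiIdx_one.1 hI with rfl | ⟨i, rfl⟩
    · rw [hdu z hz, mul_zero]
    · rw [du_eq_dirD, he z hz, mul_zero]
  have hdx : ∀ z, toJet1 z ∈ V → ∀ i, dx i f z = 0 := by
    intro z hz i
    have h1 := htot z hz i
    rw [hf.totalDeriv_eq hV le_rfl hz, hdu' z hz] at h1
    simpa [cartan, Pi.single_apply] using h1
  have hseg : ∀ t ∈ Set.Icc (0 : ℝ) 1, toJet1 (z + t • (z' - z)) ∈ V := by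
    intro t ht
    have h1 : toJet1 (z + t • (z' - z)) = toJet1 z + t • (toJet1 z' - toJet1 z) := rfl
    rw [h1]
    exact hVc.add_smul_sub_mem hz hz' ht
  have hder : ∀ t ∈ Set.Icc (0 : ℝ) 1, HasDerivAt (fun s : ℝ => f (z + s • (z' - z))) 0 t := by
    intro t ht
    have h1 := hf.hasDerivAt hV le_rfl (hasVelocity_line z (z' - z) t) (hseg t ht)
    rw [hdu' _ (hseg t ht)] at h1
    simpa only [hdx _ (hseg t ht), mul_zero, Finset.sum_const_zero] using h1
  have h1 := constant_of_has_deriv_right_zero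
    (fun t ht => (hder t ht).continuousAt.continuousWithinAt)
    (fun t ht => (hder t (Set.Ico_subset_Icc_self ht)).hasDerivWithinAt) 1 (by simp)
  simpa using h1.symm

/-- A differential function whose total derivatives vanish on formal solutions is constant on
them. -/
theorem IsSymmQuasilinear.eq_of_totalDeriv_eq_zero (hn : 2 ≤ n) (hG : IsSymmQuasilinear V A B G)
    (hV : IsOpen V) (hVc : Convex ℝ V) (ha : ∀ q ∈ V, quadForm (fun i j => A i j q) ≠ 0)
    (hf : IsDifferentialFunction V f)
    (hD : ∀ z, toJet1 z ∈ V → IsFormalSolution G z → ∀ i, totalDeriv i f z = 0)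
    (hz : toJet1 z ∈ V) (hz' : toJet1 z' ∈ V) (hs : IsFormalSolution G z)
    (hs' : IsFormalSolution G z') : f z = f z' := by
  obtain ⟨k, hk, hf⟩ := hf
  obtain ⟨m, rfl⟩ : ∃ m, k = m + 1 := ⟨k - 1, by omega⟩
  induction m generalizing f with
  | zero => exact hG.eq_of_order_one hn hV hVc ha hf hD hz hz'
  | succ m ih =>
    obtain ⟨f', hf', h⟩ := hG.exists_lower_order hn hV ha hf hD
    rw [h z hz hs, h z' hz' hs']
    refine ih (fun z hz hs i => ?_) (by omega) hf'
    -- The lower-order replacement inherits the hypothesis because total derivatives are tangent to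
    -- the formal solutions.
    rw [← hG.totalDeriv_eq_of_eqOn hV ha ⟨_, by omega, hf⟩ ⟨_, by omega, hf'⟩ h hz hs i]
    exact hD z hz hs i

end FirstIntegrals

end VarIF

/-! ### Constancy of integrating factors where the leading matrix is invertible. -/

namespace VarIF

variable {n k m : ℕ} {U V : Set (Jet1 n)} {f f' g : Jet n → ℝ} {z z' v w θ : Jet n}
  {A : Fin n → Fin n → Jet1 n → ℝ} {B : Jet1 n → ℝ} {G W : Jet n → ℝ} {L : Jet1 n → ℝ}

section IntegratingFactor

/-- The jet direction of order `k` with coordinates `ξ^I`. -/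
noncomputable def powerDir (k : ℕ) (ξ : Fin n → ℝ) : Jet n :=
  (0, fun I => if order I = k then MvPolynomial.eval ξ (mono I) else 0)

theorem powerDir_apply_of_eq {ξ : Fin n → ℝ} {I : Fin n → ℕ} (h : order I = k) :
    (powerDir k ξ).2 I = MvPolynomial.eval ξ (mono I) :=
  if_pos h

theorem powerDir_apply_of_ne {ξ : Fin n → ℝ} {I : Fin n → ℕ} (h : order I ≠ k) :
    (powerDir k ξ).2 I = 0 :=
  if_neg h

theorem shift_powerDir (i : Fin n) (ξ : Fin n → ℝ) :
    shift i (powerDir (k + 1) ξ) = ξ i • powerDir k ξ := by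
  refine Prod.ext (by simp [shift, powerDir]) (funext fun I => ?_)
  simp only [shift, powerDir, order_add, order_e, add_left_inj, mono_add, mono_e, map_mul,
    MvPolynomial.eval_X, Prod.smul_snd, Pi.smul_apply, smul_eq_mul, mul_comm (ξ i), ite_mul,
    zero_mul]

theorem toJet1_add_smul_powerDir (z : Jet n) (ξ : Fin n → ℝ) (t : ℝ) :
    toJet1 (z + t • powerDir 2 ξ) = toJet1 z := by
  rw [toJet1_add, toJet1_smul, toJet1_eq_zero (v := powerDir 2 ξ) rfl
    fun I hI => powerDir_apply_of_ne (by omega), smul_zero, add_zero]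

/-- A second-order Euler--Lagrange expression is affine along the directions `ξ^I`, `|I| = 2`. -/
theorem dirD_dirD_powerDir (hU : IsOpen U) (hEL : IsEulerLagrange U f)
    (hf : SmoothOfOrderLE U 2 f) (hz : toJet1 z ∈ U) (ξ : Fin n → ℝ) :
    dirD (fun y => dirD f y (powerDir 2 ξ)) z (powerDir 2 ξ) = 0 := by
  have h2 : (1 : ℕ) ≤ 2 := by norm_num
  have hE : EqUpTo 2 (z + powerDir 3 ξ) z := ⟨by simp [powerDir], fun I hI => by
    simp [powerDir_apply_of_ne (k := 3) (ξ := ξ) (I := I) (by omega)]⟩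
  have hz' : toJet1 (z + powerDir 3 ξ) ∈ U := by rwa [hE.toJet1_eq h2]
  -- The Helmholtz condition is compared at z and at z + `powerDir 3 ξ`. Its left side has order two
  -- and is unchanged; on the right the direction of D_j moves by ξ_j times `powerDir 2 ξ`.
  have h3 : ∀ i, ∑ j, symCoeff i j * (ξ j * dirD (du (e j + e i) f) z (powerDir 2 ξ)) = 0 := by
    intro i
    have h4 := helmholtz_order_two hU hEL hf hz i
    have h5 := helmholtz_order_two hU hEL hf hz' i
    rw [(hf.du hU h2 (e i)).eq_of_eqUpTo hE hz', h4, ← sub_eq_zero, ← Finset.sum_sub_distrib] at h5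
    rw [← neg_eq_zero, ← h5, ← Finset.sum_neg_distrib]
    refine Finset.sum_congr rfl fun j _ => ?_
    have hd := hf.du hU h2 (e j + e i)
    rw [hd.totalDeriv_eq hU h2 hz, hd.totalDeriv_eq hU h2 hz', hd.dirD_eq_of_eqUpTo hU h2 hE hz',
      ← mul_sub, ← hd.dirD_sub hU h2 hz, ← hd.dirD_smul hU h2 hz, ← shift_powerDir, ← mul_neg]
    congr 1
    have : cartan j z - cartan j (z + powerDir 3 ξ) = (-1 : ℝ) • shift j (powerDir 3 ξ) := by
      refine Prod.ext ?_ (funext fun I => ?_) <;> simp [cartan, shift]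
    rw [this, hd.dirD_smul hU h2 hz, neg_one_mul]
  have h6 : ∀ y, toJet1 y ∈ U → dirD f y (powerDir 2 ξ) =
      ∑ I ∈ multiIdx n 2, du I f y * (powerDir 2 ξ).2 I := by
    intro y hy
    rw [hf.dirD_expand hU h2 hy]
    simp [powerDir, mul_comm]
  rw [dirD_congr hU h6 hz, dirD_fun_sum hU h2 hz _ fun I _ =>
    (hf.du hU h2 I).mul (smoothOfOrderLE_const h2 _)]
  have h7 := sum_order_two (n := n)
    (fun I => dirD (fun y => du I f y * (powerDir 2 ξ).2 I) z (powerDir 2 ξ)) 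
    (by
      simp only [powerDir_apply_of_ne (k := 2) (ξ := ξ) (I := 0) (by simp [order_zero]), mul_zero]
      simp [dirD])
    (fun i => by
      simp only [powerDir_apply_of_ne (k := 2) (ξ := ξ) (I := e i) (by simp [order_e]), mul_zero]
      simp [dirD])
  -- Twice the second derivative is the sum over i of ξ_i times the identities `h3`.
  rw [← mul_eq_zero_iff_left (two_ne_zero' ℝ), h7]
  refine Finset.sum_eq_zero fun i _ => ?_
  rw [← mul_zero (ξ i), ← h3 i, Finset.mul_sum]
  refine Finset.sum_congr rfl fun j _ => ?_
  rw [powerDir_apply_of_eq (order_e_add_e j i), mono_add, mono_e, mono_e, map_mul,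
    MvPolynomial.eval_X, MvPolynomial.eval_X]
  simp only [mul_comm (du _ f _)]
  rw [dirD_fun_const_mul]
  ring

/-- The right side must vanish at the root of b + t a, so the two affine functions are proportional;
continuity of h covers the root itself. -/
theorem eq_const_of_mul_affine {h : ℝ → ℝ} (hh : Continuous h) {a b c d : ℝ} (ha : a ≠ 0)
    (heq : ∀ t, h t * (b + t * a) = c + t * d) (t : ℝ) : h t = d / a := by
  have h0 := heq (-b / a)
  have h1 : b + -b / a * a = 0 := by field_simp; ring
  rw [h1, mul_zero] at h0
  have hE : Set.EqOn h (fun _ => d / a) {-b / a}ᶜ := by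
    intro t ht
    have ht' : b + t * a ≠ 0 := fun h2 => ht (by
      rw [Set.mem_singleton_iff, eq_div_iff ha]; linarith)
    apply mul_right_cancel₀ ht'
    rw [heq t]
    have : c = b * d / a := by
      have : c + -b / a * d = 0 := h0.symm
      field_simp at this ⊢
      linarith
    rw [this]
    field_simp
  exact congrFun (hh.ext_on (dense_compl_singleton _) continuous_const hE) t

/-- A second-order variational integrating factor does not depend on the second-order
coordinates. -/
theorem IsSymmQuasilinear.du_eq_zero_of_integratingFactor (hG : IsSymmQuasilinear U A B G)
    (hU : IsOpen U) (hW : SmoothOfOrderLE U 2 W) (hWG : IsEulerLagrange U fun z => W z * G z)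
    (hz : toJet1 z ∈ U) (ha : quadForm (fun i j => A i j (toJet1 z)) ≠ 0) {I : Fin n → ℕ}
    (hI : I ∈ homIdx n 2) : du I W z = 0 := by
  have h2 : (1 : ℕ) ≤ 2 := by norm_num
  have hF : SmoothOfOrderLE U 2 fun z => W z * G z := hW.mul hG.smooth
  set a : Fin n → Fin n → ℝ := fun i j => A i j (toJet1 z) with hadef
  -- Along such a direction WG and G are both affine in t and G has slope Q(ξ) ≠ 0, so W is
  -- constant.
  have hdir : ∀ ξ : Fin n → ℝ, MvPolynomial.eval ξ (quadForm a) ≠ 0 →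
      dirD W z (powerDir 2 ξ) = 0 := by
    intro ξ hξ
    have hl : ∀ t : ℝ, toJet1 (z + t • powerDir 2 ξ) ∈ U := fun t => by
      rwa [toJet1_add_smul_powerDir]
    have hd1 : ∀ t : ℝ, HasDerivAt (fun t : ℝ => (fun z => W z * G z) (z + t • powerDir 2 ξ))
        (dirD (fun z => W z * G z) (z + t • powerDir 2 ξ) (powerDir 2 ξ)) t := fun t =>
      hF.hasDerivAt hU h2 (hasVelocity_line z _ t) (hl t)
    have hd2 : ∀ t : ℝ, HasDerivAt (fun t : ℝ =>
        dirD (fun z => W z * G z) (z + t • powerDir 2 ξ) (powerDir 2 ξ)) 0 t := fun t => by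
      have h3 := (hF.dirD_const hU h2 (powerDir 2 ξ)).hasDerivAt hU h2 (hasVelocity_line z _ t)
        (hl t)
      rwa [dirD_dirD_powerDir hU hWG hF (hl t)] at h3
    set d := dirD (fun z => W z * G z) z (powerDir 2 ξ) with hddef
    have hd3 : ∀ t : ℝ, dirD (fun z => W z * G z) (z + t • powerDir 2 ξ) (powerDir 2 ξ) = d :=
      fun t => by
        have h3 := is_const_of_deriv_eq_zero (fun t => (hd2 t).differentiableAt)
          (fun t => (hd2 t).deriv) t 0
        simpa [hddef] using h3
    have hd4 : ∀ t : ℝ, HasDerivAt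
        (fun t : ℝ => (fun z => W z * G z) (z + t • powerDir 2 ξ) - t * d) 0 t := fun t => by
      have h3 := (hd1 t).fun_sub ((hasDerivAt_id t).mul_const d)
      rwa [hd3, one_mul, sub_self] at h3
    have hG1 : ∀ t : ℝ, G (z + t • powerDir 2 ξ) =
        G z + t * MvPolynomial.eval ξ (quadForm a) := by
      intro t
      have h3 := hG.iterD_add hU hz (θ := t • powerDir 2 ξ) (by simp [powerDir]) (K := 0)
        fun I hI => by
          rw [order_zero] at hI
          simp [powerDir_apply_of_ne (k := 2) (ξ := ξ) (I := I) (by omega)]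
      rw [iterD_zero] at h3
      rw [h3, eval_quadForm, contract, Finset.mul_sum]
      congr 1
      refine Finset.sum_congr rfl fun i _ => ?_
      rw [Finset.mul_sum]
      refine Finset.sum_congr rfl fun j _ => ?_
      rw [zero_add, Prod.smul_snd, Pi.smul_apply, powerDir_apply_of_eq (order_e_add_e i j),
        mono_add, mono_e, mono_e, map_mul, MvPolynomial.eval_X, MvPolynomial.eval_X, smul_eq_mul]
      ring
    have hWc : Continuous fun t : ℝ => W (z + t • powerDir 2 ξ) :=
      continuous_iff_continuousAt.2 fun t =>
        (hW.hasDerivAt hU h2 (hasVelocity_line z _ t) (hl t)).continuousAt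
    have hconst := eq_const_of_mul_affine hWc hξ (b := G z) (c := W z * G z) (d := d) fun t => by
      have h3 := is_const_of_deriv_eq_zero (fun t => (hd4 t).differentiableAt)
        (fun t => (hd4 t).deriv) t 0
      simp only [zero_smul, add_zero, zero_mul, sub_zero, sub_eq_iff_eq_add] at h3
      rw [← hG1, h3]
    simp only [dirD, hconst, deriv_const]
  -- Multiplication by Q covers the ξ with Q(ξ) = 0: the product vanishes at every point, hence as a
  -- polynomial, and Q can be cancelled.
  have hP : quadForm a * ∑ I ∈ homIdx n 2, du I W z • VarIF.mono I = 0 := by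
    refine MvPolynomial.funext fun ξ => ?_
    rw [map_mul, map_zero, mul_eq_zero, or_iff_not_imp_left]
    intro hξ
    have h3 := hdir ξ hξ
    rw [hW.dirD_of_top hU h2 hz rfl fun I hI => powerDir_apply_of_ne (by omega)] at h3
    rw [map_sum, ← h3]
    refine Finset.sum_congr rfl fun I hI => ?_
    rw [MvPolynomial.smul_eval, powerDir_apply_of_eq (mem_homIdx.1 hI)]
  have h3 := congrArg (MvPolynomial.coeff (Finsupp.equivFunOnFinite.symm I))
    ((mul_eq_zero.1 hP).resolve_left ha)
  rw [MvPolynomial.coeff_sum, MvPolynomial.coeff_zero] at h3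
  simpa only [MvPolynomial.coeff_smul, coeff_mono, smul_eq_mul, mul_ite, mul_one, mul_zero,
    Finset.sum_ite_eq', hI, if_true] using h3

theorem IsSymmQuasilinear.eq_of_eqUpTo_one (hG : IsSymmQuasilinear U A B G)
    (hU : IsOpen U) (ha : ∀ q ∈ U, quadForm (fun i j => A i j q) ≠ 0)
    (hW : SmoothOfOrderLE U 2 W) (hWG : IsEulerLagrange U fun z => W z * G z)
    (hz : toJet1 z ∈ U) (h : EqUpTo 1 z z') : W z = W z' := by
  have h2 : (1 : ℕ) ≤ 2 := by norm_num
  have hv1 : (z' - z : Jet n).1 = 0 := sub_eq_zero.2 h.1.symm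
  have hv2 : ∀ I, order I < 2 → (z' - z : Jet n).2 I = 0 := fun I hI =>
    sub_eq_zero.2 (h.2 I (by omega)).symm
  have hl : ∀ t : ℝ, toJet1 (z + t • (z' - z)) ∈ U := fun t => by
    rwa [toJet1_add, toJet1_smul, toJet1_eq_zero hv1 fun I hI => hv2 I (by omega), smul_zero,
      add_zero]
  have hder : ∀ t : ℝ, HasDerivAt (fun s : ℝ => W (z + s • (z' - z))) 0 t := fun t => by
    have h3 := hW.hasDerivAt hU h2 (hasVelocity_line z (z' - z) t) (hl t)
    rwa [hW.dirD_of_top hU h2 (hl t) hv1 hv2, Finset.sum_eq_zero fun I hI => by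
      rw [hG.du_eq_zero_of_integratingFactor hU hW hWG (hl t) (ha _ (hl t)) hI, zero_mul]] at h3
  have h3 := is_const_of_deriv_eq_zero (fun t => (hder t).differentiableAt)
    (fun t => (hder t).deriv) 0 1
  simpa using h3

/-- Where the matrix of leading coefficients is invertible, variational integrating factors are
constant on formal solutions. -/
theorem IsSymmQuasilinear.eq_on_solutions (hn : 2 ≤ n) (hG : IsSymmQuasilinear V A B G)
    (hV : IsOpen V) (hVc : Convex ℝ V) (ha : ∀ q ∈ V, quadForm (fun i j => A i j q) ≠ 0)
    (hdet : ∀ q ∈ V, (Matrix.of fun i j => A i j q).det ≠ 0) (hEL : IsEulerLagrange V G)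
    (hW : IsDifferentialFunction V W) (hWG : IsEulerLagrange V fun z => W z * G z)
    (hz : toJet1 z ∈ V) (hz' : toJet1 z' ∈ V) (hs : IsFormalSolution G z)
    (hs' : IsFormalSolution G z') : W z = W z' := by
  refine hG.eq_of_totalDeriv_eq_zero hn hV hVc ha hW (fun z hz hs i => ?_) hz hz' hs hs'
  have h1 := Matrix.eq_zero_of_mulVec_eq_zero (hdet _ hz) (v := fun j => totalDeriv j W z)
    (funext fun i => hG.sum_mul_totalDeriv_eq_zero hV hEL hW hWG hz hs i)
  exact congrFun h1 i

/-- By polarization a symmetric matrix with zero quadratic form is zero. -/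
theorem quadForm_ne_zero_of_det_ne_zero (hn : 2 ≤ n) {a : Fin n → Fin n → ℝ}
    (hsymm : ∀ i j, a i j = a j i) (hdet : (Matrix.of a).det ≠ 0) : quadForm a ≠ 0 := by
  intro h
  have hq : ∀ ξ : Fin n → ℝ, ∑ i, ∑ j, a i j * (ξ i * ξ j) = 0 := fun ξ => by
    rw [← eval_quadForm, h, map_zero]
  have hdiag : ∀ k, a k k = 0 := fun k => by
    have := hq (Pi.single k 1)
    simpa [Pi.single_apply] using this
  have hz : ∀ k l, a k l = 0 := by
    intro k l
    have h1 := hq (Pi.single k 1 + Pi.single l 1)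
    simp only [Pi.add_apply, Pi.single_apply, mul_add, Finset.sum_add_distrib,
      mul_ite, mul_one, mul_zero, Finset.sum_ite_eq', Finset.mem_univ, if_true,
      hdiag, hsymm l k] at h1
    simp at h1
    linarith
  apply hdet
  have : Nonempty (Fin n) := ⟨⟨0, by omega⟩⟩
  rw [show Matrix.of a = 0 from Matrix.ext hz, Matrix.det_zero]

theorem IsFirstOrderLagrangian.exists_ball_det_ne_zero (hL : IsFirstOrderLagrangian V L G)
    (hV : IsOpen V) (hG : IsSymmQuasilinear V A B G) {q : Jet1 n} (hq : q ∈ V)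
    (hdet : (hessian L q).det ≠ 0) : ∃ ε > 0, Metric.ball q ε ⊆ V ∧
      ∀ q' ∈ Metric.ball q ε, (Matrix.of fun i j => A i j q').det ≠ 0 := by
  have h1 : (Matrix.of fun i j => A i j q).det ≠ 0 := by
    have h2 : hessian L q = -Matrix.of fun i j => A i j q :=
      Matrix.ext fun i j => hL.hessian_eq hV hG hq i j
    rw [h2, Matrix.det_neg] at hdet
    exact right_ne_zero_of_mul hdet
  have h2 : ContDiffOn ℝ ∞ (fun q => (Matrix.of fun i j => A i j q).det) V :=
    contDiffOn_det fun i j => hG.smooth_A i j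
  have h3 := (h2.continuousOn.continuousAt (hV.mem_nhds hq)).eventually_ne h1
  obtain ⟨ε, hε, hball⟩ := Metric.mem_nhds_iff.1 (Filter.inter_mem (hV.mem_nhds hq) h3)
  exact ⟨ε, hε, fun x hx => (hball hx).1, fun x hx => (hball hx).2⟩

end IntegratingFactor

end VarIF

theorem proposition3p4 (n : ℕ) (hn : 2 ≤ n) (U : Set (VarIF.Jet1 n)) (hU : IsOpen U)
    (G W : VarIF.Jet n → ℝ)
    (hG : VarIF.IsQuasilinearSecondOrder U G) (hEL : VarIF.IsEulerLagrange U G)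
    (hW : VarIF.IsVariationalIntegratingFactor U G W) :
    -- first-order Lagrangians exist on every box contained in `U`
    (∀ (X : Set (Fin n → ℝ)) (Y : Set ℝ) (P : Set (Fin n → ℝ)), IsOpen X → IsOpen Y → Convex ℝ Y →
      IsOpen P → Convex ℝ P → X ×ˢ (Y ×ˢ P) ⊆ U →
      ∃ L : VarIF.Jet1 n → ℝ, VarIF.IsFirstOrderLagrangian (X ×ˢ (Y ×ˢ P)) L G) ∧
    -- and every first-order Lagrangian satisfies the Monge--Ampere equation where `W` is
    -- not locally constant
    (∀ (V : Set (VarIF.Jet1 n)) (L : VarIF.Jet1 n → ℝ), IsOpen V → V ⊆ U →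
      VarIF.IsFirstOrderLagrangian V L G → ∀ q ∈ V,
      VarIF.NonconstantOnSolutionsNear G W q ∨
        (VarIF.SmoothOfOrderLE U 2 W ∧ VarIF.NonconstantNear W q) →
      (VarIF.hessian L q).det = 0) := by
  obtain ⟨A, B, hG⟩ := hG.exists_symm
  obtain ⟨hWd, -, hWG⟩ := hW
  refine ⟨fun X Y P hX hY hYc hP hPc hsub =>
    VarIF.exists_isFirstOrderLagrangian hX hY hYc hP hPc (hG.mono hsub) (hEL.mono hsub), ?_⟩
  intro V L hV hVU hL q hq hnon
  -- If the determinant is nonzero at q, then A is invertible on a ball about q, which is open and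
  -- convex as the constancy argument requires.
  by_contra hdet
  obtain ⟨ε, hε, hball, hdet'⟩ := hL.exists_ball_det_ne_zero hV (hG.mono hVU) hq hdet
  have hB : IsOpen (Metric.ball q ε) := Metric.isOpen_ball
  have hBU := hball.trans hVU
  have hGB := hG.mono hBU
  have ha : ∀ q' ∈ Metric.ball q ε, VarIF.quadForm (fun i j => A i j q') ≠ 0 := fun q' hq' =>
    VarIF.quadForm_ne_zero_of_det_ne_zero hn (fun i j => congrFun (hG.symm i j) q') (hdet' q' hq')
  have hconst : ∀ z z' : VarIF.Jet n, VarIF.toJet1 z ∈ Metric.ball q ε →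
      VarIF.toJet1 z' ∈ Metric.ball q ε → VarIF.IsFormalSolution G z →
      VarIF.IsFormalSolution G z' → W z = W z' := fun z z' =>
    hGB.eq_on_solutions hn hB (convex_ball q ε) ha hdet' (hEL.mono hBU) (hWd.mono hBU)
      (hWG.mono hBU)
  rcases hnon with h | ⟨hW2, h⟩
  · obtain ⟨z, z', hz, hz', hs, hs', hne⟩ := h _ hB (Metric.mem_ball_self hε)
    exact hne (hconst z z' hz hz' hs hs')
  · obtain ⟨z, z', hz, hz', hne⟩ := h _ hB (Metric.mem_ball_self hε)
    -- In case (b) W sees only the first-order jet, which the projection preserves, so every jet may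
    -- be replaced by a formal solution.
    have hp : ∀ z, VarIF.toJet1 z ∈ Metric.ball q ε → W z = W (VarIF.proj A G z) := fun z hz =>
      hGB.eq_of_eqUpTo_one hB ha (hW2.mono hBU) (hWG.mono hBU) hz (VarIF.eqUpTo_proj 0 z).symm
    refine hne ((hp z hz).trans (Eq.trans ?_ (hp z' hz').symm))
    exact hconst _ _ (by rwa [VarIF.toJet1_proj]) (by rwa [VarIF.toJet1_proj])
      (hGB.isFormalSolution_proj hB ha hz) (hGB.isFormalSolution_proj hB ha hz')
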